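/- **Theorem 2 (Consistency of the sieve maximum likelihood estimator).** Let $\mathcal A$ be the class of functions $C:[0,\infty)\to\mathbb R$ of the form $C(h)=\int_0^\infty e^{-r^2h^2}f(r)\,dr$ with $f\ge 0$ continuous and integrable on $(0,\infty)$. For $1\le k\le m$ let $A_{k,m}(h)=\prod_{j=k}^m(1+h^2/j)^{-1}$ and $\mathcal A_m=\{\sum_{k=1}^m w_kA_{k,m}: w_k\ge 0\}\subset\mathcal A$. Write $\|C\|_\infty=\sup_{h\ge0}|C(h)|$. Fix constants $0<L_C$, $U_C$, $U_\beta$ and put $\mathcal B=\{\beta\in\mathbb R^p:\|\beta\|_2\le U_\beta\}$, $\Omega=\{C\in\mathcal A: L_C\le\|C\|_\infty\le U_C\}$, $\Omega_m=\Omega\cap\mathcal A_m$, $\Theta=\mathcal B\times\Omega$. Let $\{Y(s):s\in\mathcal S\subset\mathbb R^d\}$ be a Gaussian process with mean $X(s)^T\beta_0$, where $X(s)\in\mathbb R^p$ is known, and covariance $\mathrm{Cov}(Y(s),Y(t))=C_0(\|s-t\|_2)$, where $\theta_0=(\beta_0,C_0)$ is an interior point of $\Theta$ relative to $\mathbb R^p\times\mathcal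 A$ with the distance $\bar d((\beta_1,C_1),(\beta_2,C_2))=\|\beta_1-\beta_2\|_2+\|C_1-C_2\|_\infty$. For each $n$ the process is observed at locations $s_1,\dots,s_n\in\mathcal S$ (which may depend on $n$), giving $Y_n=(Y(s_1),\dots,Y(s_n))^T$. Let $X_n$ be the $n\times p$ matrix with rows $X(s_i)^T$; for a function $C$ let $\Sigma_{C,n}=(C(\|s_i-s_j\|_2))_{i,j}$, and write $\Sigma_{0,n}=\Sigma_{C_0,n}$ and $A_{m,m,n}=\Sigma_{A_{m,m},n}$. Let $m(n)\ge1$ be integers with $m(n)\to\infty$. Assume: 1. (identifiability) for every $\theta=(\beta,C)\in\Theta$ with $\theta\ne\theta_0$ there is $n\ge1$ with $\Sigma_{C,n}\ne\Sigma_{0,n}$ or $X_n\beta\ne X_n\beta_0$; 2. $\limsup_n\lambda_{\max}(\frac1nX_n^TX_n)<\infty$ and $\liminf_n\lambda_{\min}(\frac1nX_n^TX_n)>0$; 3. $\limsup_n\lambda_{\max}(\Sigma_{0,n})<\infty$ and $\liminf_n\lambda_{\min}(\Sigma_{0,n})>0$; 4. for every fixed $m\ge1$, $\limsup_n\lambda_{\max}(A_{m,m,n})<\infty$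 and $\liminf_n\lambda_{\min}(A_{m,m,n})>0$; 5. $\limsup_{n}\lambda_{\max}(A_{m(n),m(n),n})<\infty$; 6. for every $\epsilon>0$, $\displaystyle\liminf_{n\to\infty}\ \inf_{C\in\Omega,\ \|C-C_0\|_\infty\ge\epsilon}\ \frac1n\sum_{i,j=1}^n\bigl(C(\|s_i-s_j\|_2)-C_0(\|s_i-s_j\|_2)\bigr)^2>0$. Let $\hat\theta_n=(\hat\beta_n,\hat C_n)$ be a maximizer over $\mathcal B\times\Omega_{m(n)}$ of $\frac1n l_n$, where $$l_n(\beta,C)=-\tfrac12\log\det\Sigma_{C,n}-\tfrac12(Y_n-X_n\beta)^T\Sigma_{C,n}^{-1}(Y_n-X_n\beta)-\tfrac n2\log(2\pi).$$ Then $\|\hat\beta_n-\beta_0\|_2+\|\hat C_n-C_0\|_\infty\to0$ in $P_{\theta_0}$-probability as $n\to\infty$. -/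

import Mathlib

open MeasureTheory ProbabilityTheory Filter Topology
open scoped NNReal Matrix

noncomputable section

namespace SieveCov

/-- The class `𝒜` of isotropic covariance functions `C : [0, ∞) → ℝ` with a continuous spectral
density: `C h = ∫₀^∞ exp (-r² h²) f r dr` with `f ≥ 0` continuous and integrable on `(0, ∞)`. -/
def classA : Set (ℝ≥0 → ℝ) :=
  {C | ∃ f : ℝ → ℝ, ContinuousOn f (Set.Ioi 0) ∧ (∀ r ∈ Set.Ioi (0 : ℝ), 0 ≤ f r) ∧
    IntegrableOn f (Set.Ioi 0) ∧
    ∀ h : ℝ≥0, C h = ∫ r in Set.Ioi (0 : ℝ), Real.exp (-(r ^ 2 * (h : ℝ) ^ 2)) * f r}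

/-- The basis function `A_{k,m}(h) = ∏_{j=k}^m (1 + h²/j)⁻¹`. -/
def basisFn (k m : ℕ) (h : ℝ≥0) : ℝ :=
  ∏ j ∈ Finset.Icc k m, (1 + (h : ℝ) ^ 2 / (j : ℝ))⁻¹

/-- The sieve `𝒜_m`: nonnegative combinations of `A_{1,m}, …, A_{m,m}`. -/
def sieveA (m : ℕ) : Set (ℝ≥0 → ℝ) :=
  {C | ∃ w : ℕ → ℝ, (∀ k ∈ Finset.Icc 1 m, 0 ≤ w k) ∧
    ∀ h : ℝ≥0, C h = ∑ k ∈ Finset.Icc 1 m, w k * basisFn k m h}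

/-- The sup norm on `[0, ∞)`. It is only applied to members of `𝒜` and to differences of such
members, all of which are bounded. -/
def supNorm (C : ℝ≥0 → ℝ) : ℝ := ⨆ h : ℝ≥0, |C h|

/-- The covariance parameter space `{C ∈ 𝒜 : L ≤ ‖C‖_∞ ≤ U}`. -/
def covSpace (L U : ℝ) : Set (ℝ≥0 → ℝ) := {C | C ∈ classA ∧ L ≤ supNorm C ∧ supNorm C ≤ U}

/-- The mean parameter space: the closed Euclidean ball of radius `Uβ`. -/
def meanSpace (p : ℕ) (Uβ : ℝ) : Set (EuclideanSpace ℝ (Fin p)) := {β | ‖β‖ ≤ Uβ}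

/-- The full parameter space `Θ`. -/
def paramSpace (p : ℕ) (Uβ L U : ℝ) : Set (EuclideanSpace ℝ (Fin p) × (ℝ≥0 → ℝ)) :=
  meanSpace p Uβ ×ˢ covSpace L U

/-- The sieve parameter space `Θ_m`. -/
def sieveSpace (p : ℕ) (Uβ L U : ℝ) (m : ℕ) : Set (EuclideanSpace ℝ (Fin p) × (ℝ≥0 → ℝ)) :=
  meanSpace p Uβ ×ˢ (covSpace L U ∩ sieveA m)

/-- The distance `‖β₁ - β₂‖₂ + ‖C₁ - C₂‖_∞`. -/
def dbar {p : ℕ} (θ₁ θ₂ : EuclideanSpace ℝ (Fin p) × (ℝ≥0 → ℝ)) : ℝ :=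
  ‖θ₁.1 - θ₂.1‖ + supNorm (θ₁.2 - θ₂.2)

/-- `θ₀` is an interior point of `Θ`, relative to the ambient space `ℝ^p × 𝒜` with distance
`dbar`. -/
def IsInteriorParam {p : ℕ} (Uβ L U : ℝ) (θ₀ : EuclideanSpace ℝ (Fin p) × (ℝ≥0 → ℝ)) : Prop :=
  θ₀ ∈ paramSpace p Uβ L U ∧
    ∃ ε > 0, ∀ θ : EuclideanSpace ℝ (Fin p) × (ℝ≥0 → ℝ),
      θ.2 ∈ classA → dbar θ θ₀ < ε → θ ∈ paramSpace p Uβ L U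

/-- The matrix with entries `C (‖s_i - s_j‖₂)`. -/
def covMatrix {d n : ℕ} (s : Fin n → EuclideanSpace ℝ (Fin d)) (C : ℝ≥0 → ℝ) :
    Matrix (Fin n) (Fin n) ℝ :=
  Matrix.of fun i j => C (nndist (s i) (s j))

/-- The design matrix with rows `X_i`. -/
def designMatrix {p n : ℕ} (X : Fin n → EuclideanSpace ℝ (Fin p)) : Matrix (Fin n) (Fin p) ℝ :=
  Matrix.of fun i j => X i j

/-- The largest eigenvalue of a real symmetric matrix. -/
def lamMax {ι : Type*} [Fintype ι] [DecidableEq ι] (A : Matrix ι ι ℝ) : EReal :=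
  ⨆ μ ∈ spectrum ℝ A, (μ : EReal)

/-- The smallest eigenvalue of a real symmetric matrix. -/
def lamMin {ι : Type*} [Fintype ι] [DecidableEq ι] (A : Matrix ι ι ℝ) : EReal :=
  ⨅ μ ∈ spectrum ℝ A, (μ : EReal)

/-- The Gaussian log-likelihood with mean `X β` and covariance matrix `Σ_C`, at the data `y`. -/
def logLik {d p n : ℕ} (s : Fin n → EuclideanSpace ℝ (Fin d))
    (X : Fin n → EuclideanSpace ℝ (Fin p)) (y : Fin n → ℝ)
    (θ : EuclideanSpace ℝ (Fin p) × (ℝ≥0 → ℝ)) : ℝ :=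
  -(1 / 2) * Real.log (covMatrix s θ.2).det
    - (1 / 2) * ((y - designMatrix X *ᵥ θ.1.ofLp) ⬝ᵥ
        ((covMatrix s θ.2)⁻¹ *ᵥ (y - designMatrix X *ᵥ θ.1.ofLp)))
    - (1 / 2) * (n : ℝ) * Real.log (2 * Real.pi)

/-- `(1/n) ∑_{i,j} (C (‖s_i - s_j‖) - C₀ (‖s_i - s_j‖))²`. -/
def covDiscrepancy {d n : ℕ} (s : Fin n → EuclideanSpace ℝ (Fin d)) (C C₀ : ℝ≥0 → ℝ) : ℝ :=
  (1 / (n : ℝ)) * ∑ i, ∑ j, (C (nndist (s i) (s j)) - C₀ (nndist (s i) (s j))) ^ 2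

/-- `θhat` maximizes the criterion `(1/n) l_n(·; y)` over the sieve space `Θ_m`. -/
def IsSieveMLE {d p n : ℕ} (Uβ L U : ℝ) (m : ℕ) (s : Fin n → EuclideanSpace ℝ (Fin d))
    (X : Fin n → EuclideanSpace ℝ (Fin p)) (y : Fin n → ℝ)
    (θhat : EuclideanSpace ℝ (Fin p) × (ℝ≥0 → ℝ)) : Prop :=
  θhat ∈ sieveSpace p Uβ L U m ∧
    ∀ θ ∈ sieveSpace p Uβ L U m,
      (1 / (n : ℝ)) * logLik s X y θ ≤ (1 / (n : ℝ)) * logLik s X y θhat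

end SieveCov

end

/-!
Consistency of the sieve maximum likelihood estimator rests on a comparison of likelihoods that is
uniform over the sieve, although the eigenvalues of the covariance matrices in the sieve have no
uniform lower bound. Write `Z` for the centered observations, `Σ₀` for their covariance matrix,
`δ = β₀ - β` for the error of the mean, and `D(C, δ) = log det Σ_C + (Z + X δ)ᵀ Σ_C⁻¹ (Z + X δ)` for
the deviance at a parameter.

* *A competitor.* The sieve contains approximations `sieveApprox f₀ m` of the true covariance
  function, uniform on `[0, ∞)`, with the true variance. Since `∑_{i,j} C(‖s_i - s_j‖)` is of order
  `n` for bounded matrices, uniform closeness turns into closeness in squared Frobenius norm of order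
  `o(n)`, and the deviance of the competitor is at most `log det Σ₀ + n + o(n)`
  (`exists_competitor_bound`).
* *Nearly degenerate covariance functions lose.* A covariance matrix `Σ_C` is nearly singular only if
  the spectral density of `C` concentrates at the frequency zero, as measured by the degeneracy
  `τ = ∫ min(1, r) f r dr`. For every `η > 0` its smallest eigenvalue is at least
  `exp (-(η / τ + D))` (`exists_sieve_lower`): kernel matrices at frequency `r` have a lower bound
  polynomial in `r` down to a frequency `m ^ (-3/8)`, by products of rank-one minorants and a
  localization, and below it the explicit density of the last basis function is used. On the other
  hand the residual form is at least `a n / τ` (`exists_degenerate_bound`): applying the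
  Laplacian of the neighbourhood graph of the sites to `Z` gives a vector that correlates with `Z`
  and is almost orthogonal to the low frequencies. That graph has of the order of `n` edges because
  the design separates the truth from some other covariance function of the same variance
  (`exists_nbr_lower`). With `η = a / 2` the deviance exceeds that of the competitor unless `τ` is
  bounded below, and then the smallest eigenvalue of `Σ_C` is bounded below as well.
* *A uniform lower bound.* For all `C` in the sieve and all bounded `δ`, up to `o(n)`, the residual
  form is at least `tr ((Σ_C + η)⁻¹ Σ₀) + κ c n |δ|²` (`exists_uniform_lower`). By the variational
  formula for the inverse form it suffices to test with `(N + η)⁻¹ Z + κ X δ`, where `N` runs through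
  a finite net of the sieve whose size does not depend on `n` (`exists_sieve_net`). The required
  uniformity in `C` is linear in `C`, hence a statement about the basis functions `A_{k,m}`. These
  are monotone in `k`, so that finitely many brackets and second moments give it
  (`exists_uniform_basis`).
* *Conclusion.* The relative entropy `log det T + tr (T⁻¹ Σ₀) - log det Σ₀ - n` at `T = Σ_C + η`
  dominates the squared Frobenius distance of `T` and `Σ₀` (`frobenius_le_entropy`). A maximizer
  therefore has small discrepancy and small `|δ|` (`exists_mle_bound`), and the separation
  assumption on the design turns the discrepancy into the sup norm.

The exceptional events are not required to be measurable: `P` acts on them as an outer measure, and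
only its monotonicity and subadditivity are used.
-/

namespace SieveCov

section

/-! ### Quadratic form bounds for symmetric matrices -/

section Quadratic

set_option linter.unusedSectionVars false

variable {ι : Type*} [Fintype ι]

/-- `c` is a lower bound of the quadratic form of `A` on the unit sphere. -/
def QLower (c : ℝ) (A : Matrix ι ι ℝ) : Prop := ∀ v : ι → ℝ, c * (v ⬝ᵥ v) ≤ v ⬝ᵥ A *ᵥ v

/-- `K` is an upper bound of the quadratic form of `A` on the unit sphere. -/
def QUpper (A : Matrix ι ι ℝ) (K : ℝ) : Prop := ∀ v : ι → ℝ, v ⬝ᵥ A *ᵥ v ≤ K * (v ⬝ᵥ v)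

lemma dotProduct_self_nonneg' (v : ι → ℝ) : 0 ≤ v ⬝ᵥ v :=
  Finset.sum_nonneg fun i _ => mul_self_nonneg (v i)

lemma quadForm_eq_sum (A : Matrix ι ι ℝ) (u v : ι → ℝ) :
    u ⬝ᵥ A *ᵥ v = ∑ i, ∑ j, u i * v j * A i j := by
  simp only [dotProduct, Matrix.mulVec, Finset.mul_sum]
  exact Finset.sum_congr rfl fun i _ => Finset.sum_congr rfl fun j _ => by ring

lemma posSemidef_iff_real (A : Matrix ι ι ℝ) :
    A.PosSemidef ↔ A.IsSymm ∧ ∀ v : ι → ℝ, 0 ≤ v ⬝ᵥ A *ᵥ v := by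
  rw [Matrix.posSemidef_iff_dotProduct_mulVec]
  simp [Matrix.IsHermitian, Matrix.IsSymm]

lemma _root_.Matrix.PosSemidef.quad_nonneg {A : Matrix ι ι ℝ} (hA : A.PosSemidef) (v : ι → ℝ) :
    0 ≤ v ⬝ᵥ A *ᵥ v := ((posSemidef_iff_real A).1 hA).2 v

lemma _root_.Matrix.PosSemidef.isSymm {A : Matrix ι ι ℝ} (hA : A.PosSemidef) : A.IsSymm :=
  ((posSemidef_iff_real A).1 hA).1

lemma dotProduct_mulVec_comm {A : Matrix ι ι ℝ} (hA : A.IsSymm) (u v : ι → ℝ) :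
    u ⬝ᵥ A *ᵥ v = v ⬝ᵥ A *ᵥ u := by
  rw [Matrix.dotProduct_mulVec, ← Matrix.mulVec_transpose, hA.eq, dotProduct_comm]

lemma quad_add {A : Matrix ι ι ℝ} (hA : A.IsSymm) (u v : ι → ℝ) :
    (u + v) ⬝ᵥ A *ᵥ (u + v) = u ⬝ᵥ A *ᵥ u + 2 * (u ⬝ᵥ A *ᵥ v) + v ⬝ᵥ A *ᵥ v := by
  rw [Matrix.mulVec_add, add_dotProduct, dotProduct_add, dotProduct_add,
    dotProduct_mulVec_comm hA v u]
  ring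

lemma quad_smul (A : Matrix ι ι ℝ) (a : ℝ) (v : ι → ℝ) :
    (a • v) ⬝ᵥ A *ᵥ (a • v) = a ^ 2 * (v ⬝ᵥ A *ᵥ v) := by
  rw [Matrix.mulVec_smul, smul_dotProduct, dotProduct_smul, smul_eq_mul, smul_eq_mul]; ring

lemma quad_conj (A : Matrix ι ι ℝ) {B : Matrix ι ι ℝ} (hB : B.IsSymm) (v : ι → ℝ) :
    v ⬝ᵥ (B * A * B) *ᵥ v = (B *ᵥ v) ⬝ᵥ A *ᵥ (B *ᵥ v) := by
  rw [← Matrix.mulVec_mulVec, ← Matrix.mulVec_mulVec, Matrix.dotProduct_mulVec,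
    ← Matrix.mulVec_transpose, hB.eq]

lemma _root_.Matrix.PosSemidef.conj {A B : Matrix ι ι ℝ} (hA : A.PosSemidef) (hB : B.IsSymm) :
    (B * A * B).PosSemidef := by
  have := hA.conjTranspose_mul_mul_same B
  rwa [Matrix.conjTranspose_eq_transpose_of_trivial, hB.eq] at this

lemma _root_.Matrix.PosSemidef.mul_self_of_symm {B : Matrix ι ι ℝ} (hB : B.IsSymm) :
    (B * B).PosSemidef := by
  have := Matrix.posSemidef_conjTranspose_mul_self B
  rwa [Matrix.conjTranspose_eq_transpose_of_trivial, hB.eq] at this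

lemma dotProduct_mulVec_self {B : Matrix ι ι ℝ} (hB : B.IsSymm) (v : ι → ℝ) :
    v ⬝ᵥ (B * B) *ᵥ v = (B *ᵥ v) ⬝ᵥ (B *ᵥ v) := by
  rw [← Matrix.mulVec_mulVec, Matrix.dotProduct_mulVec, ← Matrix.mulVec_transpose, hB.eq]

/-- Cauchy-Schwarz for a positive semidefinite form. -/
lemma _root_.Matrix.PosSemidef.cauchy {A : Matrix ι ι ℝ} (hA : A.PosSemidef) (u v : ι → ℝ) :
    (u ⬝ᵥ A *ᵥ v) ^ 2 ≤ (u ⬝ᵥ A *ᵥ u) * (v ⬝ᵥ A *ᵥ v) := by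
  have h : ∀ x : ℝ, 0 ≤ (v ⬝ᵥ A *ᵥ v) * (x * x) + (2 * (u ⬝ᵥ A *ᵥ v)) * x + u ⬝ᵥ A *ᵥ u := by
    intro x
    have := hA.quad_nonneg (u + x • v)
    rw [quad_add hA.isSymm, quad_smul, Matrix.mulVec_smul, dotProduct_smul, smul_eq_mul] at this
    nlinarith
  have := discrim_le_zero h
  unfold discrim at this
  nlinarith

/-- The sum of two vectors has at least half the quadratic form of the first, less that of the
second. -/
lemma _root_.Matrix.PosSemidef.quad_add_ge {A : Matrix ι ι ℝ} (hA : A.PosSemidef) (u v : ι → ℝ) :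
    (1 / 2) * (u ⬝ᵥ A *ᵥ u) - v ⬝ᵥ A *ᵥ v ≤ (u + v) ⬝ᵥ A *ᵥ (u + v) := by
  have h := hA.quad_nonneg (u + (2 : ℝ) • v)
  rw [quad_add hA.isSymm, quad_smul, Matrix.mulVec_smul, dotProduct_smul, smul_eq_mul] at h
  rw [quad_add hA.isSymm]
  nlinarith

lemma _root_.Matrix.PosSemidef.quad_sum_le {A : Matrix ι ι ℝ} (hA : A.PosSemidef) {κ : Type*}
    (s : Finset κ) (y : κ → ι → ℝ) :
    (∑ k ∈ s, y k) ⬝ᵥ A *ᵥ (∑ k ∈ s, y k) ≤ s.card * ∑ k ∈ s, y k ⬝ᵥ A *ᵥ y k := by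
  have h1 : (∑ k ∈ s, y k) ⬝ᵥ A *ᵥ (∑ k ∈ s, y k)
      = ∑ k ∈ s, ∑ l ∈ s, y k ⬝ᵥ A *ᵥ y l := by
    rw [Matrix.mulVec_sum, sum_dotProduct]
    exact Finset.sum_congr rfl fun k _ => dotProduct_sum _ _ _
  have h2 : ∀ k l, y k ⬝ᵥ A *ᵥ y l ≤ (y k ⬝ᵥ A *ᵥ y k + y l ⬝ᵥ A *ᵥ y l) / 2 := by
    intro k l
    have h := hA.quad_nonneg (y k + (-1 : ℝ) • y l)
    rw [quad_add hA.isSymm, quad_smul, Matrix.mulVec_smul, dotProduct_smul, smul_eq_mul] at h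
    linarith
  rw [h1]
  refine (Finset.sum_le_sum fun k _ => Finset.sum_le_sum fun l _ => h2 k l).trans (le_of_eq ?_)
  simp only [← Finset.sum_div, Finset.sum_add_distrib, Finset.sum_const, nsmul_eq_mul,
    ← Finset.mul_sum]
  ring

lemma QLower.mono {A : Matrix ι ι ℝ} {c c' : ℝ} (h : QLower c A) (hc : c' ≤ c) : QLower c' A :=
  fun v => (mul_le_mul_of_nonneg_right hc (dotProduct_self_nonneg' v)).trans (h v)

lemma QUpper.mono {A : Matrix ι ι ℝ} {K K' : ℝ} (h : QUpper A K) (hK : K ≤ K') : QUpper A K' :=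
  fun v => (h v).trans (mul_le_mul_of_nonneg_right hK (dotProduct_self_nonneg' v))

/-- For a nonnegative entrywise majorant, the form of the smaller matrix is bounded by the form of
the larger one at the vector of absolute values. -/
lemma abs_quad_le_of_entry_le {A B : Matrix ι ι ℝ} (h : ∀ i j, |A i j| ≤ B i j) (u v : ι → ℝ) :
    |u ⬝ᵥ A *ᵥ v| ≤ (fun i => |u i|) ⬝ᵥ B *ᵥ (fun i => |v i|) := by
  rw [quadForm_eq_sum, quadForm_eq_sum]
  refine (Finset.abs_sum_le_sum_abs _ _).trans (Finset.sum_le_sum fun i _ => ?_)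
  refine (Finset.abs_sum_le_sum_abs _ _).trans (Finset.sum_le_sum fun j _ => ?_)
  rw [abs_mul, abs_mul]
  exact mul_le_mul_of_nonneg_left (h i j) (by positivity)

lemma QUpper.of_entry_le {A B : Matrix ι ι ℝ} {K : ℝ} (hB : QUpper B K)
    (h : ∀ i j, |A i j| ≤ B i j) : QUpper A K := by
  intro v
  have h1 := (le_abs_self _).trans (abs_quad_le_of_entry_le h v v)
  refine h1.trans ((hB _).trans (le_of_eq ?_))
  simp [dotProduct]

/-- The image of a vector under a bounded positive semidefinite matrix. -/
lemma _root_.Matrix.PosSemidef.mulVec_sq_le {A : Matrix ι ι ℝ} (hA : A.PosSemidef) {K : ℝ}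
    (hK : 0 ≤ K) (h : QUpper A K) (v : ι → ℝ) :
    (A *ᵥ v) ⬝ᵥ (A *ᵥ v) ≤ K ^ 2 * (v ⬝ᵥ v) := by
  set w := A *ᵥ v with hw
  have h1 := hA.cauchy w v
  rw [← hw] at h1
  have h2 := h w
  have h3 := h v
  have hw0 := dotProduct_self_nonneg' w
  have hv0 := dotProduct_self_nonneg' v
  rcases hw0.eq_or_lt with h0 | h0
  · rw [← h0]; positivity
  · have h4 : (w ⬝ᵥ w) ^ 2 ≤ (K * (w ⬝ᵥ w)) * (K * (v ⬝ᵥ v)) :=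
      h1.trans (mul_le_mul h2 h3 (hA.quad_nonneg v) (by positivity))
    have h5 : (w ⬝ᵥ w) * (w ⬝ᵥ w) ≤ (w ⬝ᵥ w) * (K ^ 2 * (v ⬝ᵥ v)) := by nlinarith
    exact le_of_mul_le_mul_left h5 h0

lemma dotProduct_sq_le (u v : ι → ℝ) : (u ⬝ᵥ v) ^ 2 ≤ (u ⬝ᵥ u) * (v ⬝ᵥ v) := by
  classical
  simpa using (Matrix.PosSemidef.one : (1 : Matrix ι ι ℝ).PosSemidef).cauchy u v

variable [DecidableEq ι]

lemma QLower.posDef {A : Matrix ι ι ℝ} {c : ℝ} (h : QLower c A) (hc : 0 < c) (hA : A.IsSymm) :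
    A.PosDef := by
  refine Matrix.PosDef.of_dotProduct_mulVec_pos ?_ fun x hx => ?_
  · simpa [Matrix.IsHermitian, Matrix.IsSymm] using hA
  · have : 0 < x ⬝ᵥ x := lt_of_le_of_ne (dotProduct_self_nonneg' x)
      (Ne.symm (by simpa [dotProduct_self_eq_zero] using hx))
    simpa using (mul_pos hc this).trans_le (h x)

lemma diag_le_of_qUpper {A : Matrix ι ι ℝ} {K : ℝ} (h : QUpper A K) (i : ι) : A i i ≤ K := by
  simpa using h (Pi.single i 1)

/-- The rows of a bounded positive semidefinite matrix have bounded sums of squares. -/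
lemma _root_.Matrix.PosSemidef.row_sq_sum_le {A : Matrix ι ι ℝ} (hA : A.PosSemidef) {K : ℝ}
    (hK : 0 ≤ K) (h : QUpper A K) (i : ι) : ∑ j, A i j ^ 2 ≤ K ^ 2 := by
  have h1 := hA.mulVec_sq_le hK h (Pi.single i 1)
  have h2 : (A *ᵥ Pi.single i 1) ⬝ᵥ (A *ᵥ Pi.single i 1) = ∑ j, A i j ^ 2 := by
    simp only [Matrix.mulVec_single_one, dotProduct, Matrix.col_apply]
    refine Finset.sum_congr rfl fun j _ => ?_
    rw [hA.isSymm.apply, sq]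
  rw [h2] at h1
  simpa using h1

/-- Orthogonal diagonalization of a symmetric real matrix. -/
lemma exists_orthogonal_diag {A : Matrix ι ι ℝ} (hA : A.IsHermitian) :
    ∃ U : Matrix ι ι ℝ, U * Uᵀ = 1 ∧ Uᵀ * U = 1 ∧
      A = U * Matrix.diagonal hA.eigenvalues * Uᵀ := by
  have hUU : (hA.eigenvectorUnitary : Matrix ι ι ℝ) * (hA.eigenvectorUnitary : Matrix ι ι ℝ)ᵀ = 1 := by
    simpa [Matrix.star_eq_conjTranspose] using
      (Unitary.mem_iff.1 hA.eigenvectorUnitary.2).2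
  refine ⟨hA.eigenvectorUnitary, hUU, mul_eq_one_comm.1 hUU, ?_⟩
  have := hA.spectral_theorem
  simpa [Unitary.conjStarAlgAut_apply, Matrix.star_eq_conjTranspose,
    Function.comp_def] using this

lemma quad_transpose_diagonal (U : Matrix ι ι ℝ) (d v : ι → ℝ) :
    v ⬝ᵥ (Uᵀ * Matrix.diagonal d * U) *ᵥ v = ∑ i, d i * (U *ᵥ v) i ^ 2 := by
  rw [← Matrix.mulVec_mulVec, ← Matrix.mulVec_mulVec, Matrix.dotProduct_mulVec,
    ← Matrix.mulVec_transpose, Matrix.transpose_transpose]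
  simp only [dotProduct, Matrix.mulVec_diagonal]
  exact Finset.sum_congr rfl fun i _ => by ring

/-- The spectral theorem for the quadratic form of a symmetric real matrix. -/
lemma quad_eq_sum_eigenvalues {A : Matrix ι ι ℝ} (hA : A.IsHermitian) (v : ι → ℝ) :
    ∃ w : ι → ℝ, w ⬝ᵥ w = v ⬝ᵥ v ∧ v ⬝ᵥ A *ᵥ v = ∑ i, hA.eigenvalues i * w i ^ 2 := by
  obtain ⟨U, hUU, -, hspec⟩ := exists_orthogonal_diag hA
  refine ⟨Uᵀ *ᵥ v, ?_, ?_⟩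
  · rw [Matrix.dotProduct_mulVec, Matrix.vecMul_transpose, Matrix.mulVec_mulVec, hUU,
      Matrix.one_mulVec]
  · conv_lhs => rw [hspec]
    exact quad_transpose_diagonal Uᵀ _ v

open scoped MatrixOrder in
lemma _root_.Matrix.PosSemidef.exists_transpose_mul_self {A : Matrix ι ι ℝ} (hA : A.PosSemidef) :
    ∃ V : Matrix ι ι ℝ, A = Vᵀ * V := by
  obtain ⟨V, hV⟩ := (CStarAlgebra.nonneg_iff_eq_star_mul_self (a := A)).1
    (Matrix.nonneg_iff_posSemidef.2 hA)
  refine ⟨V, ?_⟩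
  rwa [Matrix.star_eq_conjTranspose, Matrix.conjTranspose_eq_transpose_of_trivial] at hV

lemma qUpper_of_lamMax_le {A : Matrix ι ι ℝ} (hA : A.IsSymm) {K : ℝ}
    (h : lamMax A ≤ (K : EReal)) : QUpper A K := by
  have hH : A.IsHermitian := by simpa [Matrix.IsHermitian, Matrix.IsSymm] using hA
  intro v
  obtain ⟨w, hw, hq⟩ := quad_eq_sum_eigenvalues hH v
  rw [hq, ← hw, dotProduct, Finset.mul_sum]
  refine Finset.sum_le_sum fun i _ => ?_
  have : hH.eigenvalues i ≤ K := by
    have h1 : (hH.eigenvalues i : EReal) ≤ lamMax A :=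
      le_iSup₂ (f := fun μ (_ : μ ∈ spectrum ℝ A) => (μ : EReal)) _
        (hH.eigenvalues_mem_spectrum_real i)
    exact_mod_cast h1.trans h
  nlinarith [sq_nonneg (w i)]

lemma qLower_of_le_lamMin {A : Matrix ι ι ℝ} (hA : A.IsSymm) {c : ℝ}
    (h : (c : EReal) ≤ lamMin A) : QLower c A := by
  have hH : A.IsHermitian := by simpa [Matrix.IsHermitian, Matrix.IsSymm] using hA
  intro v
  obtain ⟨w, hw, hq⟩ := quad_eq_sum_eigenvalues hH v
  rw [hq, ← hw, dotProduct, Finset.mul_sum]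
  refine Finset.sum_le_sum fun i _ => ?_
  have : c ≤ hH.eigenvalues i := by
    have h1 : lamMin A ≤ (hH.eigenvalues i : EReal) :=
      iInf₂_le (f := fun μ (_ : μ ∈ spectrum ℝ A) => (μ : EReal)) _
        (hH.eigenvalues_mem_spectrum_real i)
    exact_mod_cast h.trans h1
  nlinarith [sq_nonneg (w i)]

lemma qUpper_inv {A : Matrix ι ι ℝ} (hA : A.IsSymm) {c : ℝ} (hc : 0 < c) (h : QLower c A) :
    QUpper A⁻¹ (1 / c) := by
  have hP := h.posDef hc hA
  intro v
  set w := A⁻¹ *ᵥ v with hw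
  have hv : v = A *ᵥ w := by
    rw [hw, Matrix.mulVec_mulVec, Matrix.mul_nonsing_inv _ ((Matrix.isUnit_iff_isUnit_det _).1
      hP.isUnit), Matrix.one_mulVec]
  have h1 := h w
  rw [← hv] at h1
  have h2 := dotProduct_self_nonneg' (v - c • w)
  simp only [sub_dotProduct, dotProduct_sub, smul_dotProduct, dotProduct_smul, smul_eq_mul] at h2
  rw [dotProduct_comm w v] at h1 h2
  rw [one_div, ← div_eq_inv_mul, le_div_iff₀ hc]
  nlinarith

lemma _root_.Matrix.PosDef.mulVec_inv_mulVec {A : Matrix ι ι ℝ} (hA : A.PosDef) (v : ι → ℝ) :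
    A *ᵥ (A⁻¹ *ᵥ v) = v := by
  rw [Matrix.mulVec_mulVec, Matrix.mul_nonsing_inv _ ((Matrix.isUnit_iff_isUnit_det _).1
      hA.isUnit), Matrix.one_mulVec]

/-- Variational lower bound for the inverse form, by completing the square. -/
lemma two_mul_sub_quad_le_inv {A : Matrix ι ι ℝ} (hA : A.PosDef) (u e : ι → ℝ) :
    2 * (u ⬝ᵥ e) - u ⬝ᵥ A *ᵥ u ≤ e ⬝ᵥ A⁻¹ *ᵥ e := by
  have hS := hA.posSemidef.isSymm
  set w := A⁻¹ *ᵥ e with hw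
  have hv : A *ᵥ w = e := hA.mulVec_inv_mulVec e
  have h := hA.posSemidef.quad_nonneg (u + (-1 : ℝ) • w)
  rw [quad_add hS, quad_smul, Matrix.mulVec_smul, dotProduct_smul, smul_eq_mul, hv] at h
  rw [dotProduct_comm w e] at h
  nlinarith

lemma sq_dotProduct_le_mul_inv {A : Matrix ι ι ℝ} (hA : A.PosDef) (v e : ι → ℝ) :
    (v ⬝ᵥ e) ^ 2 ≤ (v ⬝ᵥ A *ᵥ v) * (e ⬝ᵥ A⁻¹ *ᵥ e) := by
  have hv : A *ᵥ (A⁻¹ *ᵥ e) = e := hA.mulVec_inv_mulVec e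
  have h := hA.posSemidef.cauchy v (A⁻¹ *ᵥ e)
  rwa [hv, dotProduct_comm (A⁻¹ *ᵥ e) e] at h

/-! ### Traces and log-determinants -/

lemma trace_mul_nonneg {A B : Matrix ι ι ℝ} (hA : A.PosSemidef) (hB : B.PosSemidef) :
    0 ≤ (A * B).trace := by
  obtain ⟨V, rfl⟩ := hB.exists_transpose_mul_self
  rw [← mul_assoc, Matrix.trace_mul_comm, ← mul_assoc]
  simpa using (hA.mul_mul_conjTranspose_same V).trace_nonneg

lemma trace_mul_le {A B : Matrix ι ι ℝ} (hA : A.IsSymm) {K : ℝ} (h : QUpper A K)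
    (hB : B.PosSemidef) : (A * B).trace ≤ K * B.trace := by
  have hP : (K • (1 : Matrix ι ι ℝ) - A).PosSemidef := by
    rw [posSemidef_iff_real]
    refine ⟨?_, fun v => ?_⟩
    · rw [Matrix.IsSymm, Matrix.transpose_sub, hA.eq]; simp
    · rw [Matrix.sub_mulVec, Matrix.smul_mulVec, Matrix.one_mulVec, dotProduct_sub,
        dotProduct_smul, smul_eq_mul]
      linarith [h v]
  have := trace_mul_nonneg hP hB
  rw [sub_mul, Matrix.smul_mul, one_mul, Matrix.trace_sub, Matrix.trace_smul, smul_eq_mul] at this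
  linarith

lemma trace_mul_self_symm {E : Matrix ι ι ℝ} (hE : E.IsSymm) :
    (E * E).trace = ∑ i, ∑ j, E i j ^ 2 := by
  simp only [Matrix.trace, Matrix.diag, Matrix.mul_apply]
  exact Finset.sum_congr rfl fun i _ => Finset.sum_congr rfl fun j _ => by
    rw [hE.apply i j, sq]

/-- `tr (P E Q E) ≤ p q ‖E‖²` for positive semidefinite `P ≤ p` and `Q ≤ q`. -/
lemma trace_conj_conj_le {P Q E : Matrix ι ι ℝ} (hP : P.PosSemidef) (hQ : Q.PosSemidef)
    (hE : E.IsSymm) {p q : ℝ} (hp : 0 ≤ p) (hPp : QUpper P p) (hQq : QUpper Q q) :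
    (P * (E * Q * E)).trace ≤ p * q * ∑ i, ∑ j, E i j ^ 2 := by
  have h1 := trace_mul_le hP.isSymm hPp (hQ.conj hE)
  have h2 := trace_mul_le hQ.isSymm hQq (Matrix.PosSemidef.mul_self_of_symm hE)
  have h3 : (E * Q * E).trace = (Q * (E * E)).trace := by
    rw [mul_assoc, Matrix.trace_mul_comm, mul_assoc]
  rw [trace_mul_self_symm hE] at h2
  rw [h3] at h1
  nlinarith

lemma logdet_ge {A : Matrix ι ι ℝ} (hA : A.IsSymm) {c : ℝ} (hc : 0 < c) (h : QLower c A) :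
    Fintype.card ι * Real.log c ≤ Real.log A.det := by
  have hP := h.posDef hc hA
  have hH := hP.isHermitian
  have hev : ∀ i, c ≤ hH.eigenvalues i := fun i => by
    have hi : QLower c A := h
    have h1 := hi (hH.eigenvectorBasis i).ofLp
    rw [hH.mulVec_eigenvectorBasis, dotProduct_smul, smul_eq_mul] at h1
    have h2 : (hH.eigenvectorBasis i).ofLp ⬝ᵥ (hH.eigenvectorBasis i).ofLp = 1 := by
      have := hH.eigenvectorBasis.orthonormal.1 i
      have h3 := EuclideanSpace.real_norm_sq_eq (hH.eigenvectorBasis i)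
      rw [this] at h3
      simp only [dotProduct]
      rw [← Finset.sum_congr rfl fun j _ => sq ((hH.eigenvectorBasis i).ofLp j)]
      linarith
    rw [h2] at h1; linarith
  rw [hH.det_eq_prod_eigenvalues]
  simp only [RCLike.ofReal_real_eq_id, id]
  rw [Real.log_prod fun i _ => (hc.trans_le (hev i)).ne', ← nsmul_eq_mul, ← Finset.card_univ,
    ← Finset.sum_const]
  exact Finset.sum_le_sum fun i _ => Real.log_le_log hc (hev i)

/-- Simultaneous diagonalization of two positive definite forms. -/
lemma exists_simul_diag {A B : Matrix ι ι ℝ} (hA : A.PosDef) (hB : B.PosDef) :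
    ∃ (V : Matrix ι ι ℝ) (x : ι → ℝ), IsUnit V ∧ (∀ i, 0 < x i) ∧ B = Vᵀ * V ∧
      A = Vᵀ * Matrix.diagonal x * V := by
  obtain ⟨W, hW⟩ := hB.posSemidef.exists_transpose_mul_self
  have hWu : IsUnit W := by
    have := hB.isUnit
    rw [Matrix.isUnit_iff_isUnit_det] at this ⊢
    rw [hW, Matrix.det_mul] at this
    exact isUnit_of_mul_isUnit_right this
  have hWi : W⁻¹ * W = 1 := Matrix.nonsing_inv_mul _ ((Matrix.isUnit_iff_isUnit_det _).1 hWu)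
  have hWi' : Wᵀ * (W⁻¹)ᵀ = 1 := by rw [← Matrix.transpose_mul, hWi, Matrix.transpose_one]
  have hM : ((W⁻¹)ᵀ * A * W⁻¹).PosDef := by
    have hu : IsUnit W⁻¹ := by
      rw [Matrix.isUnit_nonsing_inv_iff]; exact hWu
    have := (Matrix.IsUnit.posDef_star_left_conjugate_iff (x := A) hu).2 hA
    rwa [Matrix.star_eq_conjTranspose, Matrix.conjTranspose_eq_transpose_of_trivial] at this
  have hH := hM.isHermitian
  obtain ⟨U, hUU, hUt, hspec⟩ := exists_orthogonal_diag hH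
  have hpos : ∀ i, 0 < hH.eigenvalues i := fun i => hM.eigenvalues_pos i
  generalize hH.eigenvalues = x at hspec hpos
  refine ⟨Uᵀ * W, x, ?_, hpos, ?_, ?_⟩
  · exact (IsUnit.of_mul_eq_one _ hUt).mul hWu
  · rw [Matrix.transpose_mul, Matrix.transpose_transpose, mul_assoc, ← mul_assoc U, hUU, one_mul,
      hW]
  · calc A = (Wᵀ * (W⁻¹)ᵀ) * A * (W⁻¹ * W) := by rw [hWi, hWi', one_mul, mul_one]
      _ = Wᵀ * ((W⁻¹)ᵀ * A * W⁻¹) * W := by simp only [mul_assoc]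
      _ = _ := by
        rw [hspec, Matrix.transpose_mul, Matrix.transpose_transpose]; simp only [mul_assoc]

section Simul

variable {A B V : Matrix ι ι ℝ} {x : ι → ℝ}

lemma simul_logdet (hV : IsUnit V) (hx : ∀ i, 0 < x i) (hB : B = Vᵀ * V)
    (hA : A = Vᵀ * Matrix.diagonal x * V) :
    Real.log A.det = Real.log B.det + ∑ i, Real.log (x i) := by
  have hd : V.det ≠ 0 := ((Matrix.isUnit_iff_isUnit_det _).1 hV).ne_zero
  have hp : ∏ i, x i ≠ 0 := Finset.prod_ne_zero_iff.2 fun i _ => (hx i).ne'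
  rw [← Real.log_prod fun i _ => (hx i).ne', ← Real.log_mul _ hp]
  · congr 1
    rw [hA, hB, Matrix.det_mul, Matrix.det_mul, Matrix.det_mul, Matrix.det_diagonal]; ring
  · rw [hB, Matrix.det_mul, Matrix.det_transpose]; exact mul_ne_zero hd hd

lemma simul_inv (hV : IsUnit V) (hx : ∀ i, 0 < x i)
    (hA : A = Vᵀ * Matrix.diagonal x * V) :
    A⁻¹ = V⁻¹ * Matrix.diagonal (fun i => (x i)⁻¹) * (V⁻¹)ᵀ := by
  have h1 : V * V⁻¹ = 1 := Matrix.mul_nonsing_inv _ ((Matrix.isUnit_iff_isUnit_det _).1 hV)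
  have h1' : V⁻¹ * V = 1 := mul_eq_one_comm.1 h1
  have h2 : Vᵀ * (V⁻¹)ᵀ = 1 := by rw [← Matrix.transpose_mul, h1', Matrix.transpose_one]
  have h3 : Matrix.diagonal x * Matrix.diagonal (fun i => (x i)⁻¹) = 1 := by
    rw [Matrix.diagonal_mul_diagonal, ← Matrix.diagonal_one]
    congr 1; ext i; exact mul_inv_cancel₀ (hx i).ne'
  refine Matrix.inv_eq_right_inv ?_
  calc A * (V⁻¹ * Matrix.diagonal (fun i => (x i)⁻¹) * (V⁻¹)ᵀ)
      = Vᵀ * (Matrix.diagonal x * (V * V⁻¹) * Matrix.diagonal (fun i => (x i)⁻¹)) * (V⁻¹)ᵀ := by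
        rw [hA]; simp only [mul_assoc]
    _ = 1 := by rw [h1, mul_one, h3, mul_one, h2]

lemma simul_trace_inv_mul (hV : IsUnit V) (hx : ∀ i, 0 < x i) (hB : B = Vᵀ * V)
    (hA : A = Vᵀ * Matrix.diagonal x * V) : (A⁻¹ * B).trace = ∑ i, (x i)⁻¹ := by
  have h1 : V * V⁻¹ = 1 := Matrix.mul_nonsing_inv _ ((Matrix.isUnit_iff_isUnit_det _).1 hV)
  have h2 : (V⁻¹)ᵀ * Vᵀ = 1 := by rw [← Matrix.transpose_mul, h1, Matrix.transpose_one]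
  rw [simul_inv hV hx hA, hB]
  calc _ = (V⁻¹ * (Matrix.diagonal (fun i => (x i)⁻¹) * ((V⁻¹)ᵀ * Vᵀ) * V)).trace := by
        simp only [mul_assoc]
    _ = _ := by
        rw [h2, mul_one, Matrix.trace_mul_comm, mul_assoc, h1, mul_one, Matrix.trace_diagonal]

lemma simul_trace_mul_inv (hV : IsUnit V) (hB : B = Vᵀ * V)
    (hA : A = Vᵀ * Matrix.diagonal x * V) : (B⁻¹ * A).trace = ∑ i, x i := by
  have hB' : B = Vᵀ * Matrix.diagonal (fun _ => (1 : ℝ)) * V := by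
    rw [hB, Matrix.diagonal_one, mul_one]
  have h1 : V * V⁻¹ = 1 := Matrix.mul_nonsing_inv _ ((Matrix.isUnit_iff_isUnit_det _).1 hV)
  have h2 : (V⁻¹)ᵀ * Vᵀ = 1 := by rw [← Matrix.transpose_mul, h1, Matrix.transpose_one]
  rw [simul_inv hV (fun _ => one_pos) hB', hA]
  simp only [inv_one, Matrix.diagonal_one, mul_one]
  calc _ = (V⁻¹ * (((V⁻¹)ᵀ * Vᵀ) * Matrix.diagonal x * V)).trace := by simp only [mul_assoc]
    _ = _ := by
        rw [h2, one_mul, Matrix.trace_mul_comm, mul_assoc, h1, mul_one, Matrix.trace_diagonal]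

end Simul

/-- Concavity of the log-determinant, as a tangent inequality. -/
lemma logdet_sub_le_trace {A B : Matrix ι ι ℝ} (hA : A.PosDef) (hB : B.PosDef) :
    Real.log A.det ≤ Real.log B.det + (B⁻¹ * A).trace - Fintype.card ι := by
  obtain ⟨V, x, hV, hx, hB', hA'⟩ := exists_simul_diag hA hB
  rw [simul_logdet hV hx hB' hA', simul_trace_mul_inv hV hB' hA']
  have : ∑ i, Real.log (x i) ≤ ∑ i, (x i - 1) :=
    Finset.sum_le_sum fun i _ => Real.log_le_sub_one_of_pos (hx i)
  simp only [Finset.sum_sub_distrib, Finset.sum_const, Finset.card_univ, nsmul_eq_mul,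
    mul_one] at this
  linarith

/-- The scalar form of the lower bound on the Gaussian relative entropy. -/
lemma inv_sub_one_add_log_ge {x R : ℝ} (hx : 0 < x) (hR : x ≤ R) :
    (x - 1) ^ 2 / (R * (1 + √R) ^ 2) ≤ x⁻¹ - 1 + Real.log x := by
  set y := √x with hy
  have hy0 : 0 < y := Real.sqrt_pos.2 hx
  have hyx : x = y ^ 2 := (Real.sq_sqrt hx.le).symm
  have hlog : 1 - y⁻¹ ≤ Real.log y := by
    have := Real.one_sub_inv_le_log_of_pos hy0; exact this
  have hlx : Real.log x = 2 * Real.log y := by rw [hyx, Real.log_pow]; norm_num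
  have h1 : (y⁻¹ - 1) ^ 2 ≤ x⁻¹ - 1 + Real.log x := by
    rw [hlx, hyx]
    have : (y ^ 2)⁻¹ = y⁻¹ ^ 2 := by rw [inv_pow]
    rw [this]; nlinarith
  refine le_trans ?_ h1
  have hyR : y ≤ √R := Real.sqrt_le_sqrt hR
  have h2 : (y⁻¹ - 1) ^ 2 = (x - 1) ^ 2 / (x * (1 + y) ^ 2) := by
    rw [hyx]; field_simp; ring
  rw [h2]
  have hR0 : 0 ≤ R := hx.le.trans hR
  have : 0 < x * (1 + y) ^ 2 := by positivity
  gcongr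

/-- The Gaussian relative entropy dominates the squared Frobenius distance of the covariances. -/
lemma frobenius_le_entropy {A B : Matrix ι ι ℝ} (hA : A.PosDef) (hB : B.PosDef) {c K K' : ℝ}
    (hc : 0 < c) (hK : 0 ≤ K) (hcB : QLower c B) (hBK : QUpper B K) (hAK : QUpper A K')
    (hK' : 0 ≤ K') :
    (∑ i, ∑ j, (A i j - B i j) ^ 2) / (K ^ 2 * ((K' / c) * (1 + √(K' / c)) ^ 2)) ≤
      Real.log A.det + (A⁻¹ * B).trace - Real.log B.det - Fintype.card ι := by
  obtain ⟨V, x, hV, hx, hB', hA'⟩ := exists_simul_diag hA hB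
  rw [simul_logdet hV hx hB' hA', simul_trace_inv_mul hV hx hB' hA']
  set R := K' / c with hR
  have h1 : V * V⁻¹ = 1 := Matrix.mul_nonsing_inv _ ((Matrix.isUnit_iff_isUnit_det _).1 hV)
  have hAq : ∀ w : ι → ℝ, w ⬝ᵥ A *ᵥ w = ∑ i, x i * (V *ᵥ w) i ^ 2 := fun w => by
    rw [hA', quad_transpose_diagonal]
  have hBq : ∀ w : ι → ℝ, w ⬝ᵥ B *ᵥ w = ∑ i, (V *ᵥ w) i ^ 2 := fun w => by
    have := quad_transpose_diagonal V (fun _ => 1) w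
    rwa [Matrix.diagonal_one, mul_one, ← hB', Finset.sum_congr rfl fun i _ => one_mul _] at this
  have hxR : ∀ i, x i ≤ R := by
    intro i
    set w := V⁻¹ *ᵥ Pi.single i 1 with hw
    have hVw : V *ᵥ w = Pi.single i 1 := by rw [hw, Matrix.mulVec_mulVec, h1, Matrix.one_mulVec]
    have ha := hAK w
    have hb := hcB w
    rw [hAq, hVw] at ha
    rw [hBq, hVw] at hb
    have e1 : ∑ j, x j * (Pi.single i 1 : ι → ℝ) j ^ 2 = x i := by
      rw [Finset.sum_eq_single i] <;> simp +contextual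
    have e2 : ∑ j, (Pi.single i 1 : ι → ℝ) j ^ 2 = 1 := by
      rw [Finset.sum_eq_single i] <;> simp +contextual
    rw [e1] at ha
    rw [e2] at hb
    rw [hR, le_div_iff₀ hc]
    calc x i * c ≤ K' * (w ⬝ᵥ w) * c := by gcongr
      _ = K' * (c * (w ⬝ᵥ w)) := by ring
      _ ≤ K' * 1 := by gcongr
      _ = K' := mul_one _
  have hP : (V * Vᵀ).PosSemidef := by
    simpa using Matrix.posSemidef_self_mul_conjTranspose V
  have hPK : QUpper (V * Vᵀ) K := by
    intro v
    set w := Vᵀ *ᵥ v with hw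
    have e1 : v ⬝ᵥ (V * Vᵀ) *ᵥ v = w ⬝ᵥ w := by
      rw [← Matrix.mulVec_mulVec, Matrix.dotProduct_mulVec, ← Matrix.mulVec_transpose]
    have e2 : w ⬝ᵥ w = v ⬝ᵥ (V *ᵥ w) := by
      rw [← e1, ← Matrix.mulVec_mulVec]
    have e3 : (V *ᵥ w) ⬝ᵥ (V *ᵥ w) ≤ K * (w ⬝ᵥ w) := by
      refine le_trans (le_of_eq ?_) (hBK w)
      rw [hBq]; simp only [dotProduct]; exact Finset.sum_congr rfl fun i _ => by ring
    rw [e1]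
    have h4 := dotProduct_sq_le v (V *ᵥ w)
    rw [← e2] at h4
    have hw0 := dotProduct_self_nonneg' w
    have hv0 := dotProduct_self_nonneg' v
    rcases hw0.eq_or_lt with h0 | h0
    · rw [← h0]; positivity
    · have h5 : (w ⬝ᵥ w) * (w ⬝ᵥ w) ≤ (w ⬝ᵥ w) * (K * (v ⬝ᵥ v)) := by nlinarith
      exact le_of_mul_le_mul_left h5 h0
  set D : Matrix ι ι ℝ := Matrix.diagonal fun i => x i - 1 with hD
  have hDs : D.IsSymm := Matrix.isSymm_diagonal _
  have hE : A - B = Vᵀ * D * V := by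
    have : D = Matrix.diagonal x - 1 := by rw [hD, ← Matrix.diagonal_one, Matrix.diagonal_sub]
    rw [this, mul_sub, sub_mul, mul_one, ← hA', ← hB']
  have hEs : (A - B).IsSymm := by
    rw [Matrix.IsSymm, Matrix.transpose_sub, hA.posSemidef.isSymm.eq, hB.posSemidef.isSymm.eq]
  have hfro : ∑ i, ∑ j, (A i j - B i j) ^ 2 ≤ K ^ 2 * ∑ i, (x i - 1) ^ 2 := by
    have e1 : ∑ i, ∑ j, (A i j - B i j) ^ 2 = ((V * Vᵀ) * (D * (V * Vᵀ) * D)).trace := by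
      have := trace_mul_self_symm hEs
      simp only [Matrix.sub_apply] at this
      rw [← this, hE]
      calc _ = (Vᵀ * (D * (V * Vᵀ) * D * V)).trace := by simp only [mul_assoc]
        _ = (V * Vᵀ * (D * (V * Vᵀ) * D)).trace := by
          rw [← mul_assoc, Matrix.trace_mul_comm, ← mul_assoc]
    rw [e1]
    refine (trace_conj_conj_le hP hP hDs hK hPK hPK).trans (le_of_eq ?_)
    rw [sq K]
    congr 1
    refine Finset.sum_congr rfl fun i _ => ?_
    rw [Finset.sum_eq_single i]
    · simp [hD]
    · intro j _ hj; simp [hD, Matrix.diagonal_apply_ne' _ hj]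
    · simp
  have hterm : ∀ i, (x i - 1) ^ 2 / (R * (1 + √R) ^ 2) ≤ (x i)⁻¹ - 1 + Real.log (x i) :=
    fun i => inv_sub_one_add_log_ge (hx i) (hxR i)
  have hsum := Finset.sum_le_sum fun i (_ : i ∈ Finset.univ) => hterm i
  rw [Finset.sum_add_distrib, Finset.sum_sub_distrib, ← Finset.sum_div] at hsum
  simp only [Finset.sum_const, Finset.card_univ, nsmul_eq_mul, mul_one] at hsum
  have hRn : 0 ≤ R := div_nonneg hK' hc.le
  have : (∑ i, ∑ j, (A i j - B i j) ^ 2) / (K ^ 2 * (R * (1 + √R) ^ 2)) ≤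
      (∑ i, (x i - 1) ^ 2) / (R * (1 + √R) ^ 2) := by
    rcases hK.eq_or_lt with h0 | h0
    · rw [← h0]; simp; positivity
    · rw [← div_div]
      gcongr
      rw [div_le_iff₀ (by positivity)]; linarith
  linarith

end Quadratic

end

section

/-! ### Gaussian kernel matrices -/

section GaussKernel

set_option linter.unusedSectionVars false

variable {d : ℕ} {ι : Type*} [Fintype ι] [DecidableEq ι]

/-- The Gaussian kernel matrix with entries `exp (-t ‖x i - x j‖²)`. -/
noncomputable def gaussMat (x : ι → EuclideanSpace ℝ (Fin d)) (t : ℝ) : Matrix ι ι ℝ :=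
  Matrix.of fun i j => Real.exp (-(t * dist (x i) (x j) ^ 2))

lemma gaussMat_apply (x : ι → EuclideanSpace ℝ (Fin d)) (t : ℝ) (i j : ι) :
    gaussMat x t i j = Real.exp (-(t * dist (x i) (x j) ^ 2)) := rfl

lemma gaussMat_isSymm (x : ι → EuclideanSpace ℝ (Fin d)) (t : ℝ) : (gaussMat x t).IsSymm :=
  Matrix.IsSymm.ext fun i j => by rw [gaussMat_apply, gaussMat_apply, dist_comm]

lemma gaussMat_diag (x : ι → EuclideanSpace ℝ (Fin d)) (t : ℝ) (i : ι) :
    gaussMat x t i i = 1 := by simp [gaussMat_apply]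

lemma gaussMat_hadamard (x : ι → EuclideanSpace ℝ (Fin d)) (s t : ℝ) :
    Matrix.hadamard (gaussMat x s) (gaussMat x t) = gaussMat x (s + t) := by
  ext i j
  rw [Matrix.hadamard_apply, gaussMat_apply, gaussMat_apply, gaussMat_apply, ← Real.exp_add]
  congr 1; ring

/-- The total mass of the Gaussian weight `exp (-b ‖v‖²)`. -/
noncomputable def gaussMass (d : ℕ) (b : ℝ) : ℝ :=
  ∫ v : EuclideanSpace ℝ (Fin d), Real.exp (-b * ‖v‖ ^ 2)

lemma gaussMass_eq {b : ℝ} (hb : 0 < b) : gaussMass d b = (Real.pi / b) ^ ((d : ℝ) / 2) := by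
  rw [gaussMass, GaussianFourier.integral_rexp_neg_mul_sq_norm hb, finrank_euclideanSpace_fin]

lemma gaussMass_pos {b : ℝ} (hb : 0 < b) : 0 < gaussMass d b := by
  rw [gaussMass_eq hb]; have := Real.pi_pos; positivity

lemma gaussMass_le {b b' : ℝ} (hb : 0 < b) (h : b' ≤ 4 * b) (hb' : 0 < b') :
    gaussMass d b ≤ 2 ^ d * gaussMass d b' := by
  rw [gaussMass_eq hb, gaussMass_eq hb']
  have hpi := Real.pi_pos
  have e : (2 : ℝ) ^ d = (4 : ℝ) ^ ((d : ℝ) / 2) := by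
    rw [show (4 : ℝ) = 2 ^ (2 : ℝ) by norm_num, ← Real.rpow_mul (by norm_num),
      ← Real.rpow_natCast]
    congr 1; ring
  rw [e, ← Real.mul_rpow (by norm_num) (by positivity)]
  apply Real.rpow_le_rpow (by positivity) _ (by positivity)
  rw [div_le_iff₀ hb, mul_div_assoc', div_mul_eq_mul_div, le_div_iff₀ hb']
  nlinarith

lemma integrable_gauss {b : ℝ} (hb : 0 < b) :
    Integrable fun v : EuclideanSpace ℝ (Fin d) => Real.exp (-b * ‖v‖ ^ 2) := by
  by_contra h
  exact (gaussMass_pos (d := d) hb).ne' (integral_undef h)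

/-- The Fourier transform of a Gaussian weight. -/
lemma integral_gauss_cos {b : ℝ} (hb : 0 < b) (w : EuclideanSpace ℝ (Fin d)) :
    ∫ v : EuclideanSpace ℝ (Fin d), Real.exp (-b * ‖v‖ ^ 2) * Real.cos (inner ℝ w v) =
      gaussMass d b * Real.exp (-(‖w‖ ^ 2 / (4 * b))) := by
  have h1 := GaussianFourier.integral_cexp_neg_mul_sq_norm_add (V := EuclideanSpace ℝ (Fin d))
    (b := (b : ℂ)) (by simpa using hb) Complex.I w
  have h2 := GaussianFourier.integrable_cexp_neg_mul_sq_norm_add (V := EuclideanSpace ℝ (Fin d))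
    (b := (b : ℂ)) (by simpa using hb) Complex.I w
  have h3 := congrArg Complex.re h1
  have h4 : ∀ v : EuclideanSpace ℝ (Fin d),
      (Complex.exp (-(b : ℂ) * (‖v‖ : ℂ) ^ 2 + Complex.I * ((inner ℝ w v : ℝ) : ℂ))).re =
        Real.exp (-b * ‖v‖ ^ 2) * Real.cos (inner ℝ w v) := by
    intro v
    rw [Complex.exp_re]
    have e0 : (-(b : ℂ) * (‖v‖ : ℂ) ^ 2 + Complex.I * ((inner ℝ w v : ℝ) : ℂ)) =
        ((-b * ‖v‖ ^ 2 : ℝ) : ℂ) + ((inner ℝ w v : ℝ) : ℂ) * Complex.I := by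
      push_cast; ring
    have e1 : (-(b : ℂ) * (‖v‖ : ℂ) ^ 2 + Complex.I * ((inner ℝ w v : ℝ) : ℂ)).re
        = -b * ‖v‖ ^ 2 := by
      rw [e0, Complex.add_re, Complex.ofReal_re, Complex.re_ofReal_mul, Complex.I_re, mul_zero,
        add_zero]
    have e2 : (-(b : ℂ) * (‖v‖ : ℂ) ^ 2 + Complex.I * ((inner ℝ w v : ℝ) : ℂ)).im
        = inner ℝ w v := by
      rw [e0, Complex.add_im, Complex.ofReal_im, Complex.im_ofReal_mul, Complex.I_im, mul_one,
        zero_add]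
    rw [e1, e2]
  have h5 : (∫ v : EuclideanSpace ℝ (Fin d), Complex.exp (-(b : ℂ) * (‖v‖ : ℂ) ^ 2 +
      Complex.I * ((inner ℝ w v : ℝ) : ℂ))).re =
      ∫ v : EuclideanSpace ℝ (Fin d), Real.exp (-b * ‖v‖ ^ 2) * Real.cos (inner ℝ w v) := by
    have := integral_re (𝕜 := ℂ) h2
    simp only [RCLike.re_to_complex] at this
    rw [← this]
    exact integral_congr_ae (Eventually.of_forall h4)
  rw [← h5, h3, gaussMass_eq hb]
  have h6 : ((Real.pi : ℂ) / (b : ℂ)) ^ ((Module.finrank ℝ (EuclideanSpace ℝ (Fin d)) : ℂ) / 2) =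
      (((Real.pi / b) ^ ((d : ℝ) / 2) : ℝ) : ℂ) := by
    rw [finrank_euclideanSpace_fin, Complex.ofReal_cpow (by have := Real.pi_pos; positivity)]
    push_cast; rfl
  have h7 : Complex.exp (Complex.I ^ 2 * (‖w‖ : ℂ) ^ 2 / (4 * (b : ℂ))) =
      ((Real.exp (-(‖w‖ ^ 2 / (4 * b))) : ℝ) : ℂ) := by
    rw [Complex.ofReal_exp, Complex.I_sq]; congr 1; push_cast; ring
  rw [h6, h7, ← Complex.ofReal_mul, Complex.ofReal_re]

/-- The spectral representation of the quadratic form of a Gaussian kernel matrix. -/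
lemma gaussMat_quad_eq (x : ι → EuclideanSpace ℝ (Fin d)) {s : ℝ} (hs : 0 < s) (v : ι → ℝ) :
    gaussMass d (1 / (4 * s)) * (v ⬝ᵥ gaussMat x s *ᵥ v) =
      ∫ ξ : EuclideanSpace ℝ (Fin d), Real.exp (-(1 / (4 * s)) * ‖ξ‖ ^ 2) *
        ((∑ i, v i * Real.cos (inner ℝ (x i) ξ)) ^ 2 +
          (∑ i, v i * Real.sin (inner ℝ (x i) ξ)) ^ 2) := by
  have hb : 0 < 1 / (4 * s) := by positivity
  have h1 : ∀ ξ : EuclideanSpace ℝ (Fin d),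
      (∑ i, v i * Real.cos (inner ℝ (x i) ξ)) ^ 2 +
          (∑ i, v i * Real.sin (inner ℝ (x i) ξ)) ^ 2 =
        ∑ i, ∑ j, v i * v j * Real.cos (inner ℝ (x i - x j) ξ) := by
    intro ξ
    rw [sq, sq, Finset.sum_mul_sum, Finset.sum_mul_sum, ← Finset.sum_add_distrib]
    refine Finset.sum_congr rfl fun i _ => ?_
    rw [← Finset.sum_add_distrib]
    refine Finset.sum_congr rfl fun j _ => ?_
    rw [inner_sub_left, Real.cos_sub]; ring
  have hint : ∀ w : EuclideanSpace ℝ (Fin d), Integrable fun ξ : EuclideanSpace ℝ (Fin d) =>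
      Real.exp (-(1 / (4 * s)) * ‖ξ‖ ^ 2) * Real.cos (inner ℝ w ξ) := by
    intro w
    refine (integrable_gauss hb).mono' (by fun_prop) (Eventually.of_forall fun ξ => ?_)
    rw [norm_mul, Real.norm_of_nonneg (Real.exp_pos _).le]
    exact mul_le_of_le_one_right (Real.exp_pos _).le (Real.abs_cos_le_one _)
  simp_rw [h1, Finset.mul_sum]
  rw [integral_finsetSum _ fun i _ => ?_]
  · rw [quadForm_eq_sum, Finset.mul_sum]
    refine Finset.sum_congr rfl fun i _ => ?_
    rw [integral_finsetSum _ fun j _ => ?_, Finset.mul_sum]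
    · refine Finset.sum_congr rfl fun j _ => ?_
      have e : ∀ ξ : EuclideanSpace ℝ (Fin d), Real.exp (-(1 / (4 * s)) * ‖ξ‖ ^ 2) *
          (v i * v j * Real.cos (inner ℝ (x i - x j) ξ)) = (v i * v j) *
          (Real.exp (-(1 / (4 * s)) * ‖ξ‖ ^ 2) * Real.cos (inner ℝ (x i - x j) ξ)) :=
        fun ξ => by ring
      simp_rw [e]
      rw [integral_const_mul, integral_gauss_cos hb, gaussMat_apply, dist_eq_norm]
      have : ‖x i - x j‖ ^ 2 / (4 * (1 / (4 * s))) = s * ‖x i - x j‖ ^ 2 := by field_simp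
      rw [this]; ring
    · have := (hint (x i - x j)).const_mul (v i * v j)
      refine this.congr (Eventually.of_forall fun ξ => ?_)
      ring
  · refine integrable_finsetSum _ fun j _ => ?_
    have := (hint (x i - x j)).const_mul (v i * v j)
    refine this.congr (Eventually.of_forall fun ξ => ?_)
    ring

lemma gaussMat_posSemidef (x : ι → EuclideanSpace ℝ (Fin d)) {t : ℝ} (ht : 0 ≤ t) :
    (gaussMat x t).PosSemidef := by
  rw [posSemidef_iff_real]
  refine ⟨gaussMat_isSymm x t, fun v => ?_⟩
  rcases ht.eq_or_lt with h0 | h0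
  · have : v ⬝ᵥ gaussMat x t *ᵥ v = (∑ i, v i) ^ 2 := by
      rw [quadForm_eq_sum, sq, Finset.sum_mul_sum]
      simp [gaussMat_apply, ← h0]
    rw [this]; positivity
  · have h1 := gaussMat_quad_eq x h0 v
    have h2 : 0 < gaussMass d (1 / (4 * t)) := gaussMass_pos (by positivity)
    refine nonneg_of_mul_nonneg_right ?_ h2
    rw [h1]
    exact integral_nonneg fun ξ => by positivity

/-- Comparison of Gaussian kernel matrices at comparable scales: the spectral density of the wider
kernel is at most a constant times that of the narrower one. -/
lemma gaussMat_quad_le (x : ι → EuclideanSpace ℝ (Fin d)) {s t : ℝ} (hs : 0 < s) (hst : s ≤ t)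
    (hts : t ≤ 4 * s) (v : ι → ℝ) :
    v ⬝ᵥ gaussMat x s *ᵥ v ≤ 2 ^ d * (v ⬝ᵥ gaussMat x t *ᵥ v) := by
  have ht : 0 < t := hs.trans_le hst
  have h1 := gaussMat_quad_eq x hs v
  have h2 := gaussMat_quad_eq x ht v
  have hbs : 0 < 1 / (4 * s) := by positivity
  have hbt : 0 < 1 / (4 * t) := by positivity
  have hb : 1 / (4 * t) ≤ 1 / (4 * s) := by gcongr
  have hint : ∀ {b : ℝ}, 0 < b → Integrable fun ξ : EuclideanSpace ℝ (Fin d) =>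
      Real.exp (-b * ‖ξ‖ ^ 2) *
        ((∑ i, v i * Real.cos (inner ℝ (x i) ξ)) ^ 2 +
          (∑ i, v i * Real.sin (inner ℝ (x i) ξ)) ^ 2) := by
    intro b hb
    refine ((integrable_gauss hb).mul_const (2 * (∑ i, |v i|) ^ 2)).mono' (by fun_prop)
      (Eventually.of_forall fun ξ => ?_)
    rw [Real.norm_of_nonneg (by positivity)]
    gcongr
    have e1 : |∑ i, v i * Real.cos (inner ℝ (x i) ξ)| ≤ ∑ i, |v i| :=
      (Finset.abs_sum_le_sum_abs _ _).trans (Finset.sum_le_sum fun i _ => by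
        rw [abs_mul]; exact mul_le_of_le_one_right (abs_nonneg _) (Real.abs_cos_le_one _))
    have e2 : |∑ i, v i * Real.sin (inner ℝ (x i) ξ)| ≤ ∑ i, |v i| :=
      (Finset.abs_sum_le_sum_abs _ _).trans (Finset.sum_le_sum fun i _ => by
        rw [abs_mul]; exact mul_le_of_le_one_right (abs_nonneg _) (Real.abs_sin_le_one _))
    have e3 := pow_le_pow_left₀ (abs_nonneg _) e1 2
    have e4 := pow_le_pow_left₀ (abs_nonneg _) e2 2
    rw [sq_abs] at e3 e4
    linarith
  have h3 : gaussMass d (1 / (4 * s)) * (v ⬝ᵥ gaussMat x s *ᵥ v) ≤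
      gaussMass d (1 / (4 * t)) * (v ⬝ᵥ gaussMat x t *ᵥ v) := by
    rw [h1, h2]
    refine integral_mono (hint hbs) (hint hbt) fun ξ => ?_
    simp only
    gcongr
  have h4 : gaussMass d (1 / (4 * t)) ≤ 2 ^ d * gaussMass d (1 / (4 * s)) := by
    refine gaussMass_le hbt ?_ hbs
    rw [div_le_iff₀ (by positivity)]
    field_simp
    linarith
  have hq := (gaussMat_posSemidef x ht.le).quad_nonneg v
  have hm := gaussMass_pos (d := d) hbs
  refine le_of_mul_le_mul_left ?_ hm
  calc _ ≤ _ := h3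
    _ ≤ (2 ^ d * gaussMass d (1 / (4 * s))) * (v ⬝ᵥ gaussMat x t *ᵥ v) := by gcongr
    _ = _ := by ring

/-! ### Lower bounds by Hadamard products of rank-one minorants -/

/-- Rank-one minorants multiply under Hadamard products. -/
lemma rank_one_minorant_hadamard {A B : Matrix ι ι ℝ} (hA : A.IsSymm) (hB : B.PosSemidef)
    {u w : ι → ℝ} {a b : ℝ} (ha : ∀ v : ι → ℝ, (u ⬝ᵥ v) ^ 2 ≤ a * (v ⬝ᵥ A *ᵥ v))
    (hb0 : 0 ≤ b) (hb : ∀ v : ι → ℝ, (w ⬝ᵥ v) ^ 2 ≤ b * (v ⬝ᵥ B *ᵥ v)) (v : ι → ℝ) :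
    ((u * w) ⬝ᵥ v) ^ 2 ≤ (a * b) * (v ⬝ᵥ Matrix.hadamard A B *ᵥ v) := by
  have hv : ∀ (y z : ι → ℝ), z ⬝ᵥ Matrix.vecMulVec y y *ᵥ z = (y ⬝ᵥ z) ^ 2 := fun y z => by
    rw [Matrix.vecMulVec_mulVec, dotProduct_smul, dotProduct_comm z y]
    simp [sq]
  have hsym : ∀ y : ι → ℝ, (Matrix.vecMulVec y y).IsSymm := fun y =>
    Matrix.IsSymm.ext fun i j => by simp [Matrix.vecMulVec_apply, mul_comm]
  have hP1 : (a • A - Matrix.vecMulVec u u).PosSemidef := by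
    rw [posSemidef_iff_real]
    refine ⟨(hA.smul a).sub (hsym u), fun z => ?_⟩
    rw [Matrix.sub_mulVec, dotProduct_sub, Matrix.smul_mulVec, dotProduct_smul, hv, smul_eq_mul]
    linarith [ha z]
  have hP2 : (b • B - Matrix.vecMulVec w w).PosSemidef := by
    rw [posSemidef_iff_real]
    refine ⟨(hB.isSymm.smul b).sub (hsym w), fun z => ?_⟩
    rw [Matrix.sub_mulVec, dotProduct_sub, Matrix.smul_mulVec, dotProduct_smul, hv, smul_eq_mul]
    linarith [hb z]
  have hP3 : (Matrix.vecMulVec u u).PosSemidef := by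
    have := Matrix.posSemidef_vecMulVec_self_star u
    simpa using this
  have h1 := (hP1.hadamard (hB.smul hb0)).quad_nonneg v
  have h2 := (hP3.hadamard hP2).quad_nonneg v
  have h3 : Matrix.hadamard (a • A - Matrix.vecMulVec u u) (b • B) +
      Matrix.hadamard (Matrix.vecMulVec u u) (b • B - Matrix.vecMulVec w w) =
      (a * b) • Matrix.hadamard A B - Matrix.vecMulVec (u * w) (u * w) := by
    ext i j
    simp [Matrix.hadamard_apply, Matrix.vecMulVec_apply]
    ring
  have h4 : 0 ≤ v ⬝ᵥ ((a * b) • Matrix.hadamard A B - Matrix.vecMulVec (u * w) (u * w)) *ᵥ v := by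
    rw [← h3, Matrix.add_mulVec, dotProduct_add]; exact add_nonneg h1 h2
  rw [Matrix.sub_mulVec, dotProduct_sub, Matrix.smul_mulVec, dotProduct_smul, hv, smul_eq_mul] at h4
  linarith

/-- Schur: the Hadamard product with a matrix of unit diagonal keeps a lower bound. -/
lemma QLower.hadamard {A B : Matrix ι ι ℝ} {c : ℝ} (hA : A.IsSymm) (h : QLower c A)
    (hB : B.PosSemidef) (hd : ∀ i, B i i = 1) : QLower c (Matrix.hadamard A B) := by
  have hP : (A - c • (1 : Matrix ι ι ℝ)).PosSemidef := by
    rw [posSemidef_iff_real]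
    refine ⟨hA.sub (Matrix.isSymm_one.smul c), fun z => ?_⟩
    rw [Matrix.sub_mulVec, dotProduct_sub, Matrix.smul_mulVec, dotProduct_smul, Matrix.one_mulVec,
      smul_eq_mul]
    linarith [h z]
  intro v
  have h1 := (hP.hadamard hB).quad_nonneg v
  have h2 : Matrix.hadamard (A - c • (1 : Matrix ι ι ℝ)) B =
      Matrix.hadamard A B - c • (1 : Matrix ι ι ℝ) := by
    ext i j
    by_cases hij : i = j
    · subst hij; simp [Matrix.hadamard_apply, hd]
    · simp [Matrix.hadamard_apply, Matrix.one_apply_ne hij]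
  rw [h2, Matrix.sub_mulVec, dotProduct_sub, Matrix.smul_mulVec, dotProduct_smul,
    Matrix.one_mulVec, smul_eq_mul] at h1
  linarith

/-- The kernel at `k s`, for `k` points `j ∈ J`, has a rank-one minorant that vanishes at these
points: a Hadamard product of `k` minorants that vanish at one point each. -/
lemma gaussMat_exists_minorant (x : ι → EuclideanSpace ℝ (Fin d)) {s : ℝ} (hs : 0 ≤ s) (i : ι)
    (J : Finset ι) (hi : i ∉ J) :
    ∃ U : ι → ℝ, U i = ∏ j ∈ J, (1 - Real.exp (-(2 * s * dist (x i) (x j) ^ 2))) ∧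
      (∀ j ∈ J, U j = 0) ∧ ∀ v : ι → ℝ, (U ⬝ᵥ v) ^ 2 ≤
        (∏ j ∈ J, (1 - Real.exp (-(2 * s * dist (x i) (x j) ^ 2)))) *
          (v ⬝ᵥ gaussMat x (J.card * s) *ᵥ v) := by
  induction J using Finset.induction_on with
  | empty =>
    refine ⟨1, by simp, by simp, fun v => ?_⟩
    rw [quadForm_eq_sum]
    simp [gaussMat_apply, dotProduct, sq, Finset.sum_mul_sum]
  | insert j J hj ih =>
    obtain ⟨U, hU1, hU2, hU3⟩ := ih fun h => hi (Finset.mem_insert_of_mem h)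
    set G := gaussMat x s with hG
    have hGp : G.PosSemidef := gaussMat_posSemidef x hs
    set b := G i j with hb
    have hbb : b ^ 2 = Real.exp (-(2 * s * dist (x i) (x j) ^ 2)) := by
      rw [hb, hG, gaussMat_apply, ← Real.exp_nat_mul]; congr 1; push_cast; ring
    set w : ι → ℝ := Pi.single i 1 - b • Pi.single j 1 with hw
    have hGw : ∀ k, (G *ᵥ w) k = G k i - b * G k j := fun k => by
      rw [hw, Matrix.mulVec_sub, Matrix.mulVec_smul]; simp
    have hk0 : 0 ≤ 1 - b ^ 2 := by
      rw [hbb, sub_nonneg, Real.exp_le_one_iff]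
      simp only [neg_nonpos]; positivity
    have hww : w ⬝ᵥ G *ᵥ w = 1 - b ^ 2 := by
      have e : w ⬝ᵥ G *ᵥ w = (G *ᵥ w) i - b * (G *ᵥ w) j := by
        generalize G *ᵥ w = y
        rw [hw, sub_dotProduct, smul_dotProduct]; simp
      rw [e, hGw, hGw, hG, gaussMat_diag, gaussMat_diag, (gaussMat_isSymm x s).apply i j,
        ← hG, ← hb]
      ring
    refine ⟨U * (G *ᵥ w), ?_, ?_, ?_⟩
    · rw [Finset.prod_insert hj, Pi.mul_apply, hU1, hGw, hG, gaussMat_diag, ← hG, ← hb, ← hbb]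
      ring
    · intro k hk
      rw [Pi.mul_apply]
      rcases Finset.mem_insert.1 hk with h | h
      · rw [h, hGw, hG, gaussMat_diag, (gaussMat_isSymm x s).apply i j, ← hG, ← hb]; ring
      · rw [hU2 k h, zero_mul]
    · intro v
      have hcard : ((insert j J).card : ℝ) * s = J.card * s + s := by
        rw [Finset.card_insert_of_notMem hj]; push_cast; ring
      rw [hcard, ← gaussMat_hadamard, Finset.prod_insert hj, ← hbb, mul_comm (1 - b ^ 2)]
      refine rank_one_minorant_hadamard (gaussMat_isSymm _ _) hGp hU3 hk0 (fun z => ?_) v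
      have := hGp.cauchy w z
      rw [hww] at this
      rwa [dotProduct_comm, dotProduct_mulVec_comm hGp.isSymm]

/-- A lower bound for the Gaussian kernel on a cluster of at most `N` points at mutual distance at
least `ρ`. -/
lemma gaussMat_cluster_lower (x : ι → EuclideanSpace ℝ (Fin d)) {s ρ : ℝ} (hs : 0 < s)
    (hρ : 0 < ρ) (hsep : ∀ i j, i ≠ j → ρ ≤ dist (x i) (x j)) {N : ℕ} (hN : 0 < N)
    (J : Finset ι) (hJ : J.card ≤ N) (a : ι → ℝ) (ha : ∀ i ∉ J, a i = 0) :
    (1 - Real.exp (-(2 * (s / N) * ρ ^ 2))) ^ N / N * (a ⬝ᵥ a) ≤ a ⬝ᵥ gaussMat x s *ᵥ a := by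
  set θ := 1 - Real.exp (-(2 * (s / N) * ρ ^ 2)) with hθ
  have hN' : (0 : ℝ) < N := by exact_mod_cast hN
  have hθ0 : 0 < θ := by
    rw [hθ, sub_pos, Real.exp_lt_one_iff]
    simp only [neg_lt_zero]; positivity
  have hθ1 : θ ≤ 1 := by rw [hθ]; linarith [Real.exp_pos (-(2 * (s / N) * ρ ^ 2))]
  have key : ∀ i ∈ J, θ ^ N * a i ^ 2 ≤ a ⬝ᵥ gaussMat x s *ᵥ a := by
    intro i hi
    obtain ⟨U, hU1, hU2, hU3⟩ := gaussMat_exists_minorant x (s := s / N) (by positivity) i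
      (J.erase i) (Finset.notMem_erase i J)
    set κ := ∏ j ∈ J.erase i, (1 - Real.exp (-(2 * (s / N) * dist (x i) (x j) ^ 2))) with hκ
    have hκθ : θ ^ N ≤ κ := by
      calc θ ^ N ≤ θ ^ (J.erase i).card :=
            pow_le_pow_of_le_one hθ0.le hθ1 ((Finset.card_erase_le).trans hJ)
        _ = ∏ _j ∈ J.erase i, θ := by rw [Finset.prod_const]
        _ ≤ κ := by
          refine Finset.prod_le_prod (fun _ _ => hθ0.le) fun j hj => ?_
          have := hsep i j (Finset.ne_of_mem_erase hj).symm
          rw [hθ]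
          gcongr
    have hκ0 : 0 < κ := (pow_pos hθ0 N).trans_le hκθ
    set r := s - (J.erase i).card * (s / N) with hr
    have hr0 : 0 ≤ r := by
      have h1 : ((J.erase i).card : ℝ) ≤ N := by exact_mod_cast (Finset.card_erase_le).trans hJ
      have h2 : ((J.erase i).card : ℝ) * (s / N) ≤ N * (s / N) := by gcongr
      rw [mul_div_cancel₀ _ hN'.ne'] at h2
      linarith
    have hGr := gaussMat_posSemidef x hr0
    have h1 := rank_one_minorant_hadamard (gaussMat_isSymm _ _) hGr hU3 zero_le_one
      (w := gaussMat x r *ᵥ Pi.single i 1) (fun z => by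
        have := hGr.cauchy (Pi.single i 1) z
        rw [dotProduct_comm, dotProduct_mulVec_comm hGr.isSymm]
        simpa [gaussMat_diag] using this) a
    rw [gaussMat_hadamard, hr, add_sub_cancel, mul_one] at h1
    have h2 : (U * gaussMat x r *ᵥ Pi.single i 1) ⬝ᵥ a = κ * a i := by
      rw [dotProduct, Finset.sum_eq_single i]
      · simp [hU1, gaussMat_diag]
      · intro j _ hj
        by_cases hjJ : j ∈ J
        · rw [Pi.mul_apply, hU2 j (Finset.mem_erase.2 ⟨hj, hjJ⟩)]; ring
        · rw [ha j hjJ, mul_zero]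
      · simp
    rw [← hr] at h1
    rw [h2] at h1
    have h3 : κ * (κ * a i ^ 2) ≤ κ * (a ⬝ᵥ gaussMat x s *ᵥ a) := by nlinarith
    have h4 := le_of_mul_le_mul_left h3 hκ0
    exact (mul_le_mul_of_nonneg_right hκθ (sq_nonneg _)).trans h4
  have h1 : θ ^ N * (a ⬝ᵥ a) ≤ N * (a ⬝ᵥ gaussMat x s *ᵥ a) := by
    have e : a ⬝ᵥ a = ∑ i ∈ J, a i ^ 2 := by
      rw [dotProduct, ← Finset.sum_subset (Finset.subset_univ J)]
      · exact Finset.sum_congr rfl fun i _ => by ring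
      · intro i _ hi; rw [ha i hi, zero_mul]
    rw [e, Finset.mul_sum]
    refine (Finset.sum_le_sum key).trans ?_
    rw [Finset.sum_const, nsmul_eq_mul]
    have : (J.card : ℝ) ≤ N := by exact_mod_cast hJ
    exact mul_le_mul_of_nonneg_right this ((gaussMat_posSemidef x hs.le).quad_nonneg a)
  rw [div_mul_eq_mul_div, div_le_iff₀ hN']
  linarith

/-! ### Localization -/

lemma norm_sub_sq_add_norm_sub_sq (x y z : EuclideanSpace ℝ (Fin d)) :
    dist x z ^ 2 + dist y z ^ 2 =
      2 * ‖z - (1 / 2 : ℝ) • (x + y)‖ ^ 2 + (1 / 2) * dist x y ^ 2 := by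
  rw [dist_eq_norm, dist_eq_norm, dist_eq_norm]
  have h := parallelogram_law_with_norm ℝ (x - z) (y - z)
  have e1 : x - z + (y - z) = (-2 : ℝ) • (z - (1 / 2 : ℝ) • (x + y)) := by module
  have e2 : x - z - (y - z) = x - y := by abel
  rw [e1, e2, norm_smul] at h
  rw [Real.norm_eq_abs, abs_neg, abs_two] at h
  linarith

lemma exp_mul_exp_eq (s : ℝ) (x y z : EuclideanSpace ℝ (Fin d)) :
    Real.exp (-(2 * s * dist x z ^ 2)) * Real.exp (-(2 * s * dist y z ^ 2)) =
      Real.exp (-(s * dist x y ^ 2)) *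
        Real.exp (-(4 * s) * ‖z - (1 / 2 : ℝ) • (x + y)‖ ^ 2) := by
  rw [← Real.exp_add, ← Real.exp_add]
  congr 1
  have := norm_sub_sq_add_norm_sub_sq x y z
  linear_combination (-2 * s) * this

lemma integrable_exp_mul_exp {s : ℝ} (hs : 0 < s) (x y : EuclideanSpace ℝ (Fin d)) :
    Integrable fun z : EuclideanSpace ℝ (Fin d) =>
      Real.exp (-(2 * s * dist x z ^ 2)) * Real.exp (-(2 * s * dist y z ^ 2)) := by
  simp_rw [exp_mul_exp_eq]
  exact ((integrable_gauss (by positivity)).comp_sub_right _).const_mul _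

lemma integral_exp_mul_exp (s : ℝ) (x y : EuclideanSpace ℝ (Fin d)) :
    ∫ z : EuclideanSpace ℝ (Fin d),
      Real.exp (-(2 * s * dist x z ^ 2)) * Real.exp (-(2 * s * dist y z ^ 2)) =
      Real.exp (-(s * dist x y ^ 2)) * gaussMass d (4 * s) := by
  simp_rw [exp_mul_exp_eq]
  rw [integral_const_mul, gaussMass,
    integral_sub_right_eq_self (fun z : EuclideanSpace ℝ (Fin d) => Real.exp (-(4 * s) * ‖z‖ ^ 2))]

lemma integral_exp_dist (b : ℝ) (x : EuclideanSpace ℝ (Fin d)) :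
    ∫ z : EuclideanSpace ℝ (Fin d), Real.exp (-b * dist x z ^ 2) = gaussMass d b := by
  have : ∀ z : EuclideanSpace ℝ (Fin d), Real.exp (-b * dist x z ^ 2) =
      (fun w : EuclideanSpace ℝ (Fin d) => Real.exp (-b * ‖w‖ ^ 2)) (z - x) := fun z => by
    rw [dist_comm, dist_eq_norm]
  simp_rw [this]
  rw [integral_sub_right_eq_self (fun w : EuclideanSpace ℝ (Fin d) => Real.exp (-b * ‖w‖ ^ 2)),
    gaussMass]

lemma integrable_exp_dist {b : ℝ} (hb : 0 < b) (x : EuclideanSpace ℝ (Fin d)) :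
    Integrable fun z : EuclideanSpace ℝ (Fin d) => Real.exp (-b * dist x z ^ 2) := by
  have := (integrable_gauss (d := d) hb).comp_sub_right x
  refine this.congr (Eventually.of_forall fun z => ?_)
  simp only [dist_comm x z, dist_eq_norm]

/-- A lower bound of the Gaussian kernel at well separated points when each ball of radius `2 r`
about one of the points contains at most `N` of them. The form is written as an average over `z` of
forms localized near `z`, and each of these is essentially supported on a single cluster. -/
lemma gaussMat_lower (x : ι → EuclideanSpace ℝ (Fin d)) {s ρ r K : ℝ} (hs : 0 < s)
    (hρ : 0 < ρ) (hsep : ∀ i j, i ≠ j → ρ ≤ dist (x i) (x j)) {N : ℕ} (hN : 0 < N)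
    (hr : 0 ≤ r) (hcount : ∀ i, (Finset.univ.filter fun j => dist (x i) (x j) ≤ 2 * r).card ≤ N)
    (hK : 0 ≤ K) (hup : QUpper (gaussMat x s) K) :
    QLower ((1 - Real.exp (-(2 * (s / N) * ρ ^ 2))) ^ N / N / 2 -
      (K + 1) * 2 ^ d * Real.exp (-(2 * s * r ^ 2))) (gaussMat x (2 * s)) := by
  intro v
  set θ := (1 - Real.exp (-(2 * (s / N) * ρ ^ 2))) ^ N / N with hθ
  have hN' : (1 : ℝ) ≤ N := by exact_mod_cast hN
  have hθ0' : 0 ≤ 1 - Real.exp (-(2 * (s / N) * ρ ^ 2)) := by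
    rw [sub_nonneg, Real.exp_le_one_iff, neg_nonpos]; positivity
  have hθ0 : 0 ≤ θ := by rw [hθ]; positivity
  have hθ1 : θ ≤ 1 := by
    rw [hθ, div_le_one (by positivity)]
    refine (pow_le_one₀ hθ0' ?_).trans hN'
    linarith [Real.exp_pos (-(2 * (s / N) * ρ ^ 2))]
  have hGp := gaussMat_posSemidef x hs.le
  set g : EuclideanSpace ℝ (Fin d) → ι → ℝ := fun z i => Real.exp (-(2 * s * dist (x i) z ^ 2))
    with hg
  have hg2 : ∀ z i, g z i * g z i = Real.exp (-(4 * s) * dist (x i) z ^ 2) := fun z i => by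
    simp only [hg]; rw [← Real.exp_add]; congr 1; ring
  set τ := Real.exp (-(2 * s * r ^ 2)) with hτ
  have hpt : ∀ z, ∑ i, v i ^ 2 * (θ / 2 * Real.exp (-(4 * s) * dist (x i) z ^ 2) -
      (K + 1) * τ * Real.exp (-(2 * s) * dist (x i) z ^ 2)) ≤
      (v * g z) ⬝ᵥ gaussMat x s *ᵥ (v * g z) := by
    intro z
    set J : Finset ι := Finset.univ.filter fun i => dist (x i) z ≤ r with hJ
    have hJN : J.card ≤ N := by
      rcases J.eq_empty_or_nonempty with h | ⟨i, hi⟩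
      · rw [h]; simp
      · refine (Finset.card_le_card fun j hj => ?_).trans (hcount i)
        rw [hJ, Finset.mem_filter] at hi hj
        rw [Finset.mem_filter]
        refine ⟨Finset.mem_univ _, ?_⟩
        have := dist_triangle_right (x i) (x j) z
        linarith [hi.2, hj.2]
    set a : ι → ℝ := fun i => if i ∈ J then v i * g z i else 0 with ha
    set b : ι → ℝ := fun i => if i ∈ J then 0 else v i * g z i with hb
    have hab : v * g z = a + b := by
      ext i; simp only [ha, hb, Pi.mul_apply, Pi.add_apply]; split_ifs <;> simp
    have h1 := hGp.quad_add_ge a b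
    have h2 := gaussMat_cluster_lower x hs hρ hsep hN J hJN a fun i hi => by simp [ha, hi]
    have h3 := hup b
    rw [← hab] at h1
    have h4 : ∑ i, v i ^ 2 * (θ / 2 * Real.exp (-(4 * s) * dist (x i) z ^ 2) -
      (K + 1) * τ * Real.exp (-(2 * s) * dist (x i) z ^ 2)) ≤
      1 / 2 * (θ * (a ⬝ᵥ a)) - K * (b ⬝ᵥ b) := by
      simp only [dotProduct, Finset.mul_sum, ← Finset.sum_sub_distrib]
      refine Finset.sum_le_sum fun i _ => ?_
      have hτ0 : 0 < τ := Real.exp_pos _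
      have hE : 0 < Real.exp (-(2 * s) * dist (x i) z ^ 2) := Real.exp_pos _
      by_cases hi : i ∈ J
      · simp only [ha, hb, hi, if_true, mul_zero, sub_zero]
        have : v i * g z i * (v i * g z i) = v i ^ 2 * Real.exp (-(4 * s) * dist (x i) z ^ 2) := by
          rw [← hg2]; ring
        rw [this]
        have : 0 ≤ v i ^ 2 * ((K + 1) * τ * Real.exp (-(2 * s) * dist (x i) z ^ 2)) := by
          positivity
        nlinarith
      · simp only [ha, hb, hi, if_false, mul_zero, zero_sub]
        have hd : r < dist (x i) z := by
          by_contra h; exact hi (by rw [hJ, Finset.mem_filter]; exact ⟨Finset.mem_univ _, not_lt.1 h⟩)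
        have h5 : v i * g z i * (v i * g z i) = v i ^ 2 * Real.exp (-(4 * s) * dist (x i) z ^ 2) := by
          rw [← hg2]; ring
        have h6 : Real.exp (-(4 * s) * dist (x i) z ^ 2) ≤
            τ * Real.exp (-(2 * s) * dist (x i) z ^ 2) := by
          rw [hτ, ← Real.exp_add, Real.exp_le_exp]
          have : r ^ 2 ≤ dist (x i) z ^ 2 := pow_le_pow_left₀ hr hd.le 2
          nlinarith
        rw [h5]
        have h7 : θ / 2 * Real.exp (-(4 * s) * dist (x i) z ^ 2) +
            K * Real.exp (-(4 * s) * dist (x i) z ^ 2) ≤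
            (K + 1) * τ * Real.exp (-(2 * s) * dist (x i) z ^ 2) := by
          have hE4 : 0 < Real.exp (-(4 * s) * dist (x i) z ^ 2) := Real.exp_pos _
          calc _ ≤ 1 * Real.exp (-(4 * s) * dist (x i) z ^ 2) +
                K * Real.exp (-(4 * s) * dist (x i) z ^ 2) := by gcongr; linarith
            _ = (K + 1) * Real.exp (-(4 * s) * dist (x i) z ^ 2) := by ring
            _ ≤ (K + 1) * (τ * Real.exp (-(2 * s) * dist (x i) z ^ 2)) := by gcongr
            _ = _ := by ring
        nlinarith [sq_nonneg (v i)]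
    refine h4.trans ?_
    linarith
  have hm := gaussMass_pos (d := d) (b := 4 * s) (by positivity)
  have hR : ∫ z : EuclideanSpace ℝ (Fin d), (v * g z) ⬝ᵥ gaussMat x s *ᵥ (v * g z) =
      gaussMass d (4 * s) * (v ⬝ᵥ gaussMat x (2 * s) *ᵥ v) := by
    simp_rw [quadForm_eq_sum]
    have hint : ∀ i j, Integrable fun z : EuclideanSpace ℝ (Fin d) =>
        (v * g z) i * (v * g z) j * gaussMat x s i j := by
      intro i j
      refine ((integrable_exp_mul_exp hs (x i) (x j)).const_mul
        (v i * v j * gaussMat x s i j)).congr (Eventually.of_forall fun z => ?_)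
      simp only [hg, Pi.mul_apply]; ring
    rw [integral_finsetSum _ fun i _ => integrable_finsetSum _ fun j _ => hint i j,
      Finset.mul_sum]
    refine Finset.sum_congr rfl fun i _ => ?_
    rw [integral_finsetSum _ fun j _ => hint i j, Finset.mul_sum]
    refine Finset.sum_congr rfl fun j _ => ?_
    have : ∀ z, (v * g z) i * (v * g z) j * gaussMat x s i j =
        (v i * v j * gaussMat x s i j) * (Real.exp (-(2 * s * dist (x i) z ^ 2)) *
          Real.exp (-(2 * s * dist (x j) z ^ 2))) := fun z => by
      simp only [hg, Pi.mul_apply]; ring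
    simp_rw [this]
    rw [integral_const_mul, integral_exp_mul_exp, ← gaussMat_apply, two_mul s,
      ← gaussMat_hadamard, Matrix.hadamard_apply]
    ring
  have hL : ∫ z : EuclideanSpace ℝ (Fin d), ∑ i, v i ^ 2 *
      (θ / 2 * Real.exp (-(4 * s) * dist (x i) z ^ 2) -
      (K + 1) * τ * Real.exp (-(2 * s) * dist (x i) z ^ 2)) =
      (θ / 2 * gaussMass d (4 * s) - (K + 1) * τ * gaussMass d (2 * s)) * (v ⬝ᵥ v) := by
    have h1 : ∀ i, Integrable fun z => θ / 2 * Real.exp (-(4 * s) * dist (x i) z ^ 2) := fun i =>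
      (integrable_exp_dist (by positivity) (x i)).const_mul _
    have h2 : ∀ i, Integrable fun z =>
        (K + 1) * τ * Real.exp (-(2 * s) * dist (x i) z ^ 2) := fun i =>
      (integrable_exp_dist (by positivity) (x i)).const_mul _
    have h3 : ∀ i, Integrable fun z => v i ^ 2 *
        (θ / 2 * Real.exp (-(4 * s) * dist (x i) z ^ 2) -
        (K + 1) * τ * Real.exp (-(2 * s) * dist (x i) z ^ 2)) := fun i =>
      ((h1 i).sub (h2 i)).const_mul _
    rw [integral_finsetSum _ fun i _ => h3 i, dotProduct, Finset.mul_sum]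
    refine Finset.sum_congr rfl fun i _ => ?_
    rw [integral_const_mul, integral_sub (h1 i) (h2 i), integral_const_mul, integral_const_mul,
      integral_exp_dist, integral_exp_dist]
    ring
  have hintL : Integrable fun z : EuclideanSpace ℝ (Fin d) => ∑ i, v i ^ 2 *
      (θ / 2 * Real.exp (-(4 * s) * dist (x i) z ^ 2) -
      (K + 1) * τ * Real.exp (-(2 * s) * dist (x i) z ^ 2)) := by
    refine integrable_finsetSum _ fun i _ => Integrable.const_mul ?_ _
    exact ((integrable_exp_dist (by positivity) (x i)).const_mul _).sub
      ((integrable_exp_dist (by positivity) (x i)).const_mul _)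
  have hintR : Integrable fun z : EuclideanSpace ℝ (Fin d) =>
      (v * g z) ⬝ᵥ gaussMat x s *ᵥ (v * g z) := by
    simp_rw [quadForm_eq_sum]
    refine integrable_finsetSum _ fun i _ => integrable_finsetSum _ fun j _ => ?_
    refine ((integrable_exp_mul_exp hs (x i) (x j)).const_mul
        (v i * v j * gaussMat x s i j)).congr (Eventually.of_forall fun z => ?_)
    simp only [hg, Pi.mul_apply]; ring
  have hfin := integral_mono hintL hintR hpt
  rw [hL, hR] at hfin
  have hmass := gaussMass_le (d := d) (b := 2 * s) (b' := 4 * s) (by positivity) (by linarith)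
    (by positivity)
  have hv0 := dotProduct_self_nonneg' v
  have hτ0 : 0 < τ := Real.exp_pos _
  refine le_of_mul_le_mul_left ?_ hm
  calc gaussMass d (4 * s) * ((θ / 2 - (K + 1) * 2 ^ d * τ) * (v ⬝ᵥ v))
      = (θ / 2 * gaussMass d (4 * s) - (K + 1) * τ * (2 ^ d * gaussMass d (4 * s))) * (v ⬝ᵥ v) := by
        ring
    _ ≤ (θ / 2 * gaussMass d (4 * s) - (K + 1) * τ * gaussMass d (2 * s)) * (v ⬝ᵥ v) := by
        gcongr
    _ ≤ _ := hfin

end GaussKernel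

end

section

/-! ### The basis functions and the covariance class -/

lemma basisFn_term_bounds {j : ℕ} (hj : 1 ≤ j) (h : ℝ≥0) :
    0 < (1 + (h : ℝ) ^ 2 / (j : ℝ))⁻¹ ∧ (1 + (h : ℝ) ^ 2 / (j : ℝ))⁻¹ ≤ 1 := by
  have : (0 : ℝ) < j := by exact_mod_cast hj
  have h2 : 0 ≤ (h : ℝ) ^ 2 / (j : ℝ) := by positivity
  exact ⟨by positivity, inv_le_one_of_one_le₀ (by linarith)⟩

lemma basisFn_pos {k m : ℕ} (hk : 1 ≤ k) (h : ℝ≥0) : 0 < basisFn k m h :=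
  Finset.prod_pos fun _ hj => (basisFn_term_bounds (hk.trans (Finset.mem_Icc.1 hj).1) h).1

lemma basisFn_le_one {k m : ℕ} (hk : 1 ≤ k) (h : ℝ≥0) : basisFn k m h ≤ 1 :=
  Finset.prod_le_one (fun _ hj => (basisFn_term_bounds (hk.trans (Finset.mem_Icc.1 hj).1) h).1.le)
    fun _ hj => (basisFn_term_bounds (hk.trans (Finset.mem_Icc.1 hj).1) h).2

lemma basisFn_zero (k m : ℕ) : basisFn k m 0 = 1 := by simp [basisFn]

lemma basisFn_antitone {k m : ℕ} (hk : 1 ≤ k) : Antitone (basisFn k m) := by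
  intro a b hab
  refine Finset.prod_le_prod (fun j hj => (basisFn_term_bounds
    (hk.trans (Finset.mem_Icc.1 hj).1) b).1.le) fun j hj => ?_
  have : (a : ℝ) ≤ b := hab
  gcongr

/-- The basis functions increase with `k`. -/
lemma basisFn_mono_left {k k' m : ℕ} (hk : 1 ≤ k) (hkk : k ≤ k') (h : ℝ≥0) :
    basisFn k m h ≤ basisFn k' m h := by
  rw [basisFn, basisFn, ← Finset.prod_sdiff (Finset.Icc_subset_Icc_left (b := m) hkk)]
  refine mul_le_of_le_one_left (basisFn_pos (hk.trans hkk) h).le (Finset.prod_le_one ?_ ?_)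
  · exact fun j hj => (basisFn_term_bounds (hk.trans
      (Finset.mem_Icc.1 (Finset.mem_sdiff.1 hj).1).1) h).1.le
  · exact fun j hj => (basisFn_term_bounds (hk.trans
      (Finset.mem_Icc.1 (Finset.mem_sdiff.1 hj).1).1) h).2

lemma basisFn_self (m : ℕ) (h : ℝ≥0) : basisFn m m h = (1 + (h : ℝ) ^ 2 / m)⁻¹ := by
  simp [basisFn]

lemma basisFn_mul (k m : ℕ) (hkm : k ≤ m) (h : ℝ≥0) :
    basisFn k (m + 1) h = basisFn (m + 1) (m + 1) h * basisFn k m h := by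
  rw [basisFn_self, basisFn, basisFn, Finset.prod_Icc_succ_top (by omega), mul_comm]

/-- The Beta integral in the variable `r` with `u = exp (-r²)`. -/
lemma integral_beta_weight (l : ℕ) {b : ℝ} (hb : 0 < b) :
    IntegrableOn (fun r : ℝ => r * Real.exp (-b * r ^ 2) * (1 - Real.exp (-r ^ 2)) ^ l)
        (Set.Ioi 0) ∧
      ∫ r in Set.Ioi (0 : ℝ), r * Real.exp (-b * r ^ 2) * (1 - Real.exp (-r ^ 2)) ^ l =
        (l.factorial : ℝ) / (2 * ∏ j ∈ Finset.range (l + 1), (b + j)) := by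
  induction l generalizing b with
  | zero =>
    simp only [pow_zero, mul_one]
    refine ⟨(integrable_mul_exp_neg_mul_sq hb).integrableOn, ?_⟩
    have h1 := integral_mul_cexp_neg_mul_sq (b := (b : ℂ)) (by simpa using hb)
    have h2 : ∀ r : ℝ, (r : ℂ) * Complex.exp (-(b : ℂ) * (r : ℂ) ^ 2) =
        ((r * Real.exp (-b * r ^ 2) : ℝ) : ℂ) := fun r => by push_cast; rfl
    simp_rw [h2] at h1
    rw [integral_complex_ofReal] at h1
    have h3 : ((∫ r in Set.Ioi (0 : ℝ), r * Real.exp (-b * r ^ 2) : ℝ) : ℂ) =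
        (((2 * b)⁻¹ : ℝ) : ℂ) := by rw [h1]; push_cast; rfl
    rw [Complex.ofReal_inj.1 h3]
    simp
  | succ l ih =>
    obtain ⟨i1, e1⟩ := ih hb
    obtain ⟨i2, e2⟩ := ih (b := b + 1) (by linarith)
    have hpt : ∀ r : ℝ, r * Real.exp (-b * r ^ 2) * (1 - Real.exp (-r ^ 2)) ^ (l + 1) =
        r * Real.exp (-b * r ^ 2) * (1 - Real.exp (-r ^ 2)) ^ l -
        r * Real.exp (-(b + 1) * r ^ 2) * (1 - Real.exp (-r ^ 2)) ^ l := fun r => by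
      rw [show -(b + 1) * r ^ 2 = -b * r ^ 2 + -r ^ 2 by ring, Real.exp_add]; ring
    simp_rw [hpt]
    refine ⟨i1.sub i2, ?_⟩
    rw [integral_sub i1 i2, e1, e2]
    have hp1 : ∏ j ∈ Finset.range (l + 1 + 1), (b + j) =
        (∏ j ∈ Finset.range (l + 1), (b + j)) * (b + (l + 1)) := by
      rw [Finset.prod_range_succ]; push_cast; ring
    have hp2 : (∏ j ∈ Finset.range (l + 1), (b + j)) * (b + (l + 1)) =
        b * ∏ j ∈ Finset.range (l + 1), (b + 1 + j) := by
      rw [← hp1, Finset.prod_range_succ']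
      push_cast
      rw [add_zero, mul_comm]
      congr 1
      exact Finset.prod_congr rfl fun j _ => by ring
    have hq1 : 0 < ∏ j ∈ Finset.range (l + 1), (b + j) :=
      Finset.prod_pos fun j _ => by positivity
    have hq2 : 0 < ∏ j ∈ Finset.range (l + 1), (b + 1 + j) :=
      Finset.prod_pos fun j _ => by positivity
    rw [hp1, Nat.factorial_succ]
    push_cast
    have hbl : 0 < b + (l + 1) := by positivity
    set Q1 := ∏ j ∈ Finset.range (l + 1), (b + j)
    set Q2 := ∏ j ∈ Finset.range (l + 1), (b + 1 + j)
    have : Q2 = Q1 * (b + (l + 1)) / b := by rw [hp2]; field_simp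
    rw [this]
    field_simp
    ring

lemma basisFn_eq_prod_range {k m : ℕ} (hk : 1 ≤ k) (hkm : k ≤ m) (h : ℝ≥0) :
    basisFn k m h = (∏ i ∈ Finset.range (m - k + 1), ((k : ℝ) + i)) /
      ∏ i ∈ Finset.range (m - k + 1), ((k : ℝ) + (h : ℝ) ^ 2 + i) := by
  rw [basisFn, ← Finset.prod_div_distrib, ← Finset.Ico_add_one_right_eq_Icc,
    Finset.prod_Ico_eq_prod_range, show m + 1 - k = m - k + 1 by omega]
  refine Finset.prod_congr rfl fun i _ => ?_
  have : (0 : ℝ) < k := by exact_mod_cast hk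
  push_cast
  rw [one_add_div (by positivity), inv_div]
  congr 1; ring

lemma basisFn_mem_classA {k m : ℕ} (hk : 1 ≤ k) (hkm : k ≤ m) : basisFn k m ∈ classA := by
  set l := m - k with hl
  set c : ℝ := 2 * (∏ i ∈ Finset.range (l + 1), ((k : ℝ) + i)) / l.factorial with hc
  have hk0 : (0 : ℝ) < k := by exact_mod_cast hk
  have hc0 : 0 ≤ c := by
    have : 0 ≤ ∏ i ∈ Finset.range (l + 1), ((k : ℝ) + i) :=
      Finset.prod_nonneg fun i _ => by positivity
    positivity
  refine ⟨fun r => c * (r * Real.exp (-(k : ℝ) * r ^ 2) * (1 - Real.exp (-r ^ 2)) ^ l), ?_, ?_,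
    ?_, fun h => ?_⟩
  · exact Continuous.continuousOn (by fun_prop)
  · intro r hr
    have hr' : 0 < r := hr
    have : 0 ≤ 1 - Real.exp (-r ^ 2) := by
      rw [sub_nonneg, Real.exp_le_one_iff, neg_nonpos]; positivity
    positivity
  · exact (integral_beta_weight l hk0).1.const_mul c
  · have hb : 0 < (k : ℝ) + (h : ℝ) ^ 2 := by positivity
    have h1 := (integral_beta_weight l hb).2
    have h2 : ∀ r : ℝ, Real.exp (-(r ^ 2 * (h : ℝ) ^ 2)) *
        (c * (r * Real.exp (-(k : ℝ) * r ^ 2) * (1 - Real.exp (-r ^ 2)) ^ l)) =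
        c * (r * Real.exp (-((k : ℝ) + (h : ℝ) ^ 2) * r ^ 2) * (1 - Real.exp (-r ^ 2)) ^ l) := by
      intro r
      rw [show -((k : ℝ) + (h : ℝ) ^ 2) * r ^ 2 = -(r ^ 2 * (h : ℝ) ^ 2) + -(k : ℝ) * r ^ 2 by ring,
        Real.exp_add]
      ring
    simp_rw [h2]
    rw [integral_const_mul, h1, basisFn_eq_prod_range hk hkm, ← hl, hc]
    have : 0 < ∏ i ∈ Finset.range (l + 1), ((k : ℝ) + (h : ℝ) ^ 2 + i) :=
      Finset.prod_pos fun i _ => by positivity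
    have hf : (0 : ℝ) < l.factorial := by exact_mod_cast Nat.factorial_pos l
    field_simp

/-- `f` is a spectral density of `C`. -/
structure IsDensity (C : ℝ≥0 → ℝ) (f : ℝ → ℝ) : Prop where
  cont : ContinuousOn f (Set.Ioi 0)
  nonneg : ∀ r ∈ Set.Ioi (0 : ℝ), 0 ≤ f r
  integrable : IntegrableOn f (Set.Ioi 0)
  eq : ∀ h : ℝ≥0, C h = ∫ r in Set.Ioi (0 : ℝ), Real.exp (-(r ^ 2 * (h : ℝ) ^ 2)) * f r

lemma exists_density {C : ℝ≥0 → ℝ} (hC : C ∈ classA) : ∃ f, IsDensity C f := by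
  obtain ⟨f, h1, h2, h3, h4⟩ := hC
  exact ⟨f, h1, h2, h3, h4⟩

namespace IsDensity

variable {C : ℝ≥0 → ℝ} {f : ℝ → ℝ}

lemma mem_classA (hf : IsDensity C f) : C ∈ classA :=
  ⟨f, hf.cont, hf.nonneg, hf.integrable, hf.eq⟩

/-- The product of a density with a bounded measurable function is integrable. -/
lemma integrable_mul (hf : IsDensity C f) {g : ℝ → ℝ} (hg : Measurable g) {B : ℝ}
    (hB : ∀ r ∈ Set.Ioi (0 : ℝ), |g r| ≤ B) : IntegrableOn (fun r => g r * f r) (Set.Ioi 0) := by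
  refine Integrable.bdd_mul (c := B) hf.integrable hg.aestronglyMeasurable ?_
  exact (ae_restrict_iff' measurableSet_Ioi).2 (Eventually.of_forall hB)

lemma exp_bound (h : ℝ≥0) (r : ℝ) : |Real.exp (-(r ^ 2 * (h : ℝ) ^ 2))| ≤ 1 := by
  rw [abs_of_pos (Real.exp_pos _), Real.exp_le_one_iff, neg_nonpos]; positivity

lemma integrable_exp_mul (hf : IsDensity C f) (h : ℝ≥0) :
    IntegrableOn (fun r => Real.exp (-(r ^ 2 * (h : ℝ) ^ 2)) * f r) (Set.Ioi 0) :=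
  hf.integrable_mul (by fun_prop) fun r _ => exp_bound h r

lemma apply_zero (hf : IsDensity C f) : C 0 = ∫ r in Set.Ioi (0 : ℝ), f r := by
  rw [hf.eq 0]; simp

lemma antitone (hf : IsDensity C f) : Antitone C := by
  intro a b hab
  rw [hf.eq a, hf.eq b]
  refine setIntegral_mono_on (hf.integrable_exp_mul b) (hf.integrable_exp_mul a) measurableSet_Ioi
    fun r hr => ?_
  have : (a : ℝ) ≤ b := hab
  have := hf.nonneg r hr
  gcongr

lemma apply_nonneg (hf : IsDensity C f) (h : ℝ≥0) : 0 ≤ C h := by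
  rw [hf.eq h]
  exact setIntegral_nonneg measurableSet_Ioi fun r hr =>
    mul_nonneg (Real.exp_pos _).le (hf.nonneg r hr)

lemma continuous (hf : IsDensity C f) : Continuous C := by
  have : C = fun h : ℝ≥0 => ∫ r in Set.Ioi (0 : ℝ), Real.exp (-(r ^ 2 * (h : ℝ) ^ 2)) * f r :=
    funext hf.eq
  rw [this]
  refine continuous_of_dominated (bound := fun r => ‖f r‖) (fun h =>
    (hf.integrable_exp_mul h).aestronglyMeasurable) (fun h => Eventually.of_forall fun r => ?_)
    hf.integrable.norm (Eventually.of_forall fun r => by fun_prop)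
  rw [norm_mul]
  exact mul_le_of_le_one_left (norm_nonneg _) (exp_bound h r)

lemma tendsto_atTop (hf : IsDensity C f) : Tendsto C atTop (𝓝 0) := by
  have : C = fun h : ℝ≥0 => ∫ r in Set.Ioi (0 : ℝ), Real.exp (-(r ^ 2 * (h : ℝ) ^ 2)) * f r :=
    funext hf.eq
  rw [this]
  rw [show 𝓝 (0 : ℝ) = 𝓝 (∫ r in Set.Ioi (0 : ℝ), (0 : ℝ)) by simp]
  refine tendsto_integral_filter_of_dominated_convergence (l := (atTop : Filter ℝ≥0)) (fun r => ‖f r‖)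
    (Eventually.of_forall fun h => (hf.integrable_exp_mul h).aestronglyMeasurable)
    (Eventually.of_forall fun h => Eventually.of_forall fun r => ?_) hf.integrable.norm ?_
  · rw [norm_mul]
    exact mul_le_of_le_one_left (norm_nonneg _) (exp_bound h r)
  · refine (ae_restrict_iff' measurableSet_Ioi).2 (Eventually.of_forall fun r hr => ?_)
    have hr' : 0 < r := hr
    have h1 : Tendsto (fun h : ℝ≥0 => r ^ 2 * (h : ℝ) ^ 2) atTop atTop :=
      Tendsto.const_mul_atTop (by positivity)
        ((tendsto_pow_atTop two_ne_zero).comp (NNReal.tendsto_coe_atTop.2 tendsto_id))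
    have h2 := (Real.tendsto_exp_neg_atTop_nhds_zero.comp h1).mul_const (f r)
    simpa using h2

end IsDensity

lemma classA_smul {C : ℝ≥0 → ℝ} (hC : C ∈ classA) {a : ℝ} (ha : 0 ≤ a) :
    (fun h => a * C h) ∈ classA := by
  obtain ⟨f, hf⟩ := exists_density hC
  refine ⟨fun r => a * f r, hf.cont.const_smul a |>.congr fun _ _ => rfl, fun r hr =>
    mul_nonneg ha (hf.nonneg r hr), hf.integrable.const_mul a, fun h => ?_⟩
  change a * C h = _
  rw [hf.eq h, ← integral_const_mul]
  congr 1; ext r; ring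

lemma classA_add {C C' : ℝ≥0 → ℝ} (hC : C ∈ classA) (hC' : C' ∈ classA) :
    (fun h => C h + C' h) ∈ classA := by
  obtain ⟨f, hf⟩ := exists_density hC
  obtain ⟨g, hg⟩ := exists_density hC'
  refine ⟨fun r => f r + g r, hf.cont.add hg.cont, fun r hr =>
    add_nonneg (hf.nonneg r hr) (hg.nonneg r hr), hf.integrable.add hg.integrable, fun h => ?_⟩
  simp only [mul_add]
  rw [hf.eq h, hg.eq h, integral_add (hf.integrable_exp_mul h) (hg.integrable_exp_mul h)]

lemma classA_zero : (fun _ => 0 : ℝ≥0 → ℝ) ∈ classA :=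
  ⟨fun _ => 0, continuousOn_const, fun _ _ => le_rfl, integrableOn_zero, fun h => by simp⟩

lemma classA_sum {κ : Type*} (s : Finset κ) {w : κ → ℝ} {C : κ → ℝ≥0 → ℝ}
    (hw : ∀ k ∈ s, 0 ≤ w k) (hC : ∀ k ∈ s, C k ∈ classA) :
    (fun h => ∑ k ∈ s, w k * C k h) ∈ classA := by
  classical
  induction s using Finset.induction_on with
  | empty => simpa using classA_zero
  | insert a s ha ih =>
    simp only [Finset.sum_insert ha]
    exact classA_add (classA_smul (hC a (Finset.mem_insert_self a s))
      (hw a (Finset.mem_insert_self a s)))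
      (ih (fun k hk => hw k (Finset.mem_insert_of_mem hk))
        fun k hk => hC k (Finset.mem_insert_of_mem hk))

lemma supNorm_eq {C : ℝ≥0 → ℝ} (hC : C ∈ classA) : supNorm C = C 0 := by
  obtain ⟨f, hf⟩ := exists_density hC
  have hb : ∀ h, |C h| ≤ C 0 := fun h => by
    rw [abs_of_nonneg (hf.apply_nonneg h)]; exact hf.antitone zero_le
  refine le_antisymm (ciSup_le hb) ?_
  have := le_ciSup (f := fun h => |C h|) ⟨C 0, by rintro _ ⟨h, rfl⟩; exact hb h⟩ 0
  exact (le_abs_self _).trans this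

lemma abs_sub_le_supNorm {C C' : ℝ≥0 → ℝ} (hC : C ∈ classA) (hC' : C' ∈ classA) (h : ℝ≥0) :
    |C h - C' h| ≤ supNorm (C - C') := by
  obtain ⟨f, hf⟩ := exists_density hC
  obtain ⟨g, hg⟩ := exists_density hC'
  refine le_ciSup (f := fun h => |(C - C') h|) ⟨C 0 + C' 0, ?_⟩ h
  rintro _ ⟨h, rfl⟩
  have h1 := hf.apply_nonneg h
  have h2 := hg.apply_nonneg h
  have h3 := hf.antitone (zero_le : (0 : ℝ≥0) ≤ h)
  have h4 := hg.antitone (zero_le : (0 : ℝ≥0) ≤ h)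
  simp only [Pi.sub_apply]
  rw [abs_le]; constructor <;> linarith

/-! ### Approximation by the sieve -/

/-- Pointwise limit of the basis functions along `k / m → u`, from Euler's limit formula for the
Gamma function. -/
lemma tendsto_basisFn {u : ℝ} (hu0 : 0 < u) (hu1 : u < 1) (h : ℝ≥0) :
    Tendsto (fun m : ℕ => basisFn (⌊(m : ℝ) * u⌋₊ + 1) m h) atTop (𝓝 (u ^ ((h : ℝ) ^ 2))) := by
  rcases eq_or_ne h 0 with rfl | hh
  · simp [basisFn_zero]
  set a : ℝ := (h : ℝ) ^ 2 with ha
  have ha0 : 0 < a := by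
    have : 0 < (h : ℝ) := by exact_mod_cast pos_iff_ne_zero.2 hh
    positivity
  set q : ℕ → ℕ := fun m => ⌊(m : ℝ) * u⌋₊ with hq
  have hcast : Tendsto (fun m : ℕ => (m : ℝ) * u) atTop atTop :=
    tendsto_natCast_atTop_atTop.atTop_mul_const hu0
  have hqt : Tendsto q atTop atTop := tendsto_nat_floor_atTop.comp hcast
  have hP : ∀ n : ℕ, 1 ≤ n → ∏ j ∈ Finset.Icc 1 n, (1 + a / (j : ℝ))⁻¹ =
      a * Real.GammaSeq a n / (n : ℝ) ^ a := by
    intro n hn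
    have hn0 : (0 : ℝ) < n := by exact_mod_cast hn
    have h1 := basisFn_eq_prod_range le_rfl hn h
    rw [basisFn, ← ha] at h1
    rw [h1, Real.GammaSeq, show n - 1 + 1 = n by omega, Finset.prod_range_succ']
    have e1 : ∏ i ∈ Finset.range n, (((1 : ℕ) : ℝ) + i) = n.factorial := by
      rw [← Finset.prod_range_add_one_eq_factorial]; push_cast
      exact Finset.prod_congr rfl fun i _ => by ring
    have e2 : ∏ i ∈ Finset.range n, (((1 : ℕ) : ℝ) + a + i) =
        ∏ i ∈ Finset.range n, (a + ((i + 1 : ℕ) : ℝ)) :=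
      Finset.prod_congr rfl fun i _ => by push_cast; ring
    rw [e1, e2]
    have hpos : 0 < ∏ i ∈ Finset.range n, (a + ((i + 1 : ℕ) : ℝ)) :=
      Finset.prod_pos fun i _ => by positivity
    have hna : 0 < (n : ℝ) ^ a := Real.rpow_pos_of_pos hn0 a
    field_simp
    push_cast; ring
  have hev : ∀ᶠ m : ℕ in atTop, Real.GammaSeq a m / Real.GammaSeq a (q m) *
      ((q m : ℝ) / m) ^ a = basisFn (q m + 1) m h := by
    filter_upwards [eventually_ge_atTop 1, hqt.eventually_ge_atTop 1] with m hm hqm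
    have hm0 : (0 : ℝ) < m := by exact_mod_cast hm
    have hq0 : (0 : ℝ) < q m := by exact_mod_cast hqm
    have hqle : q m ≤ m := by
      have h1 : (q m : ℝ) ≤ m * u := Nat.floor_le (by positivity)
      have h2 : (m : ℝ) * u ≤ m := by nlinarith
      exact_mod_cast h1.trans h2
    have hsplit : (∏ j ∈ Finset.Icc 1 m, (1 + a / (j : ℝ))⁻¹) =
        (∏ j ∈ Finset.Icc 1 (q m), (1 + a / (j : ℝ))⁻¹) * basisFn (q m + 1) m h := by
      rw [basisFn, ← ha, ← Finset.Ico_add_one_right_eq_Icc, ← Finset.Ico_add_one_right_eq_Icc,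
        ← Finset.Ico_add_one_right_eq_Icc]
      exact (Finset.prod_Ico_consecutive _ (by omega) (by omega)).symm
    have hpq : 0 < ∏ j ∈ Finset.Icc 1 (q m), (1 + a / (j : ℝ))⁻¹ :=
      Finset.prod_pos fun j _ => by positivity
    rw [hP m hm, hP (q m) hqm] at hsplit
    rw [hP (q m) hqm] at hpq
    have hma : 0 < (m : ℝ) ^ a := Real.rpow_pos_of_pos hm0 a
    have hqa : 0 < (q m : ℝ) ^ a := Real.rpow_pos_of_pos hq0 a
    have hG : 0 < Real.GammaSeq a (q m) := by
      by_contra hcon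
      have : a * Real.GammaSeq a (q m) / (q m : ℝ) ^ a ≤ 0 :=
        div_nonpos_of_nonpos_of_nonneg (mul_nonpos_of_nonneg_of_nonpos ha0.le (not_lt.1 hcon)) hqa.le
      linarith
    rw [Real.div_rpow hq0.le hm0.le]
    field_simp at hsplit ⊢
    linarith
  refine Tendsto.congr' hev ?_
  have hG0 : Real.Gamma a ≠ 0 := (Real.Gamma_pos_of_pos ha0).ne'
  have h1 : Tendsto (fun m => Real.GammaSeq a m / Real.GammaSeq a (q m)) atTop (𝓝 1) := by
    have := (Real.GammaSeq_tendsto_Gamma a).div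
      ((Real.GammaSeq_tendsto_Gamma a).comp hqt) hG0
    rwa [div_self hG0] at this
  have h2 : Tendsto (fun m : ℕ => ((q m : ℝ) / m)) atTop (𝓝 u) := by
    have := (tendsto_nat_floor_mul_div_atTop (R := ℝ) hu0.le).comp tendsto_natCast_atTop_atTop
    refine this.congr fun m => ?_
    simp [hq, mul_comm]
  have h3 := h2.rpow_const (p := a) (Or.inl hu0.ne')
  simpa using h1.mul h3

/-- The index of the basis function used for the mass at `r` by the approximant of order `m`. -/
noncomputable def sieveIndex (m : ℕ) (r : ℝ) : ℕ := ⌊(m : ℝ) * Real.exp (-r ^ 2)⌋₊ + 1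

lemma measurable_sieveIndex (m : ℕ) : Measurable (sieveIndex m) := by
  unfold sieveIndex
  exact (Nat.measurable_floor.comp (by fun_prop)).add_const 1

lemma sieveIndex_mem {m : ℕ} (hm : 1 ≤ m) {r : ℝ} (hr : 0 < r) :
    sieveIndex m r ∈ Finset.Icc 1 m := by
  have hm0 : (0 : ℝ) < m := by exact_mod_cast hm
  rw [Finset.mem_Icc, sieveIndex]
  refine ⟨by omega, ?_⟩
  have : Real.exp (-r ^ 2) < 1 := by
    rw [Real.exp_lt_one_iff, neg_lt_zero]; positivity
  have h2 : ⌊(m : ℝ) * Real.exp (-r ^ 2)⌋₊ < m := by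
    rw [Nat.floor_lt (by positivity)]; nlinarith
  omega

/-- The sieve approximant: each mass `f r dr` is moved to a basis function that is close to
`exp (-r² h²)`. -/
noncomputable def sieveApprox (f : ℝ → ℝ) (m : ℕ) (h : ℝ≥0) : ℝ :=
  ∫ r in Set.Ioi (0 : ℝ), basisFn (sieveIndex m r) m h * f r

section Approx

variable {C : ℝ≥0 → ℝ} {f : ℝ → ℝ}

lemma sieveIndex_pos (m : ℕ) (r : ℝ) : 1 ≤ sieveIndex m r := by simp [sieveIndex]

lemma integrable_sieveApprox (hf : IsDensity C f) (m : ℕ) (h : ℝ≥0) :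
    IntegrableOn (fun r => basisFn (sieveIndex m r) m h * f r) (Set.Ioi 0) := by
  refine hf.integrable_mul (B := 1) ?_ fun r _ => ?_
  · exact (measurable_of_countable fun k : ℕ => basisFn k m h).comp (measurable_sieveIndex m)
  · rw [abs_of_pos (basisFn_pos (sieveIndex_pos m r) h)]
    exact basisFn_le_one (sieveIndex_pos m r) h

lemma sieveApprox_zero (hf : IsDensity C f) (m : ℕ) : sieveApprox f m 0 = C 0 := by
  simp [sieveApprox, basisFn_zero, hf.apply_zero]

lemma sieveApprox_mem_sieveA (hf : IsDensity C f) {m : ℕ} (hm : 1 ≤ m) :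
    sieveApprox f m ∈ sieveA m := by
  refine ⟨fun k => ∫ r in Set.Ioi (0 : ℝ), (sieveIndex m ⁻¹' {k}).indicator f r,
    fun k _ => setIntegral_nonneg measurableSet_Ioi fun r hr =>
      Set.indicator_apply_nonneg fun _ => hf.nonneg r hr, fun h => ?_⟩
  have hmeas : ∀ k, MeasurableSet (sieveIndex m ⁻¹' {k}) := fun k =>
    measurable_sieveIndex m (measurableSet_singleton k)
  have hint : ∀ k, IntegrableOn ((sieveIndex m ⁻¹' {k}).indicator f) (Set.Ioi 0) := fun k =>
    hf.integrable.indicator (hmeas k)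
  have h1 : ∀ k, (∫ r in Set.Ioi (0 : ℝ), (sieveIndex m ⁻¹' {k}).indicator f r) * basisFn k m h =
      ∫ r in Set.Ioi (0 : ℝ), (sieveIndex m ⁻¹' {k}).indicator f r * basisFn k m h := fun k =>
    (integral_mul_const _ _).symm
  simp_rw [h1]
  rw [← integral_finsetSum _ fun k _ => (hint k).mul_const _, sieveApprox]
  refine setIntegral_congr_fun measurableSet_Ioi fun r hr => ?_
  rw [Finset.sum_eq_single (sieveIndex m r)]
  · simp [mul_comm]
  · intro k _ hk
    rw [Set.indicator_of_notMem (by simpa using hk.symm), zero_mul]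
  · intro hn; exact absurd (sieveIndex_mem hm hr) hn

lemma sieveA_subset_classA (m : ℕ) : sieveA m ⊆ classA := by
  rintro C ⟨w, hw, hC⟩
  have := classA_sum (Finset.Icc 1 m) hw fun k hk =>
    basisFn_mem_classA (Finset.mem_Icc.1 hk).1 (Finset.mem_Icc.1 hk).2
  rwa [← funext hC] at this

lemma tendsto_sieveApprox (hf : IsDensity C f) (h : ℝ≥0) :
    Tendsto (fun m => sieveApprox f m h) atTop (𝓝 (C h)) := by
  rw [hf.eq h]
  refine tendsto_integral_of_dominated_convergence (fun r => ‖f r‖)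
    (fun m => (integrable_sieveApprox hf m h).aestronglyMeasurable) hf.integrable.norm
    (fun m => Eventually.of_forall fun r => ?_) ?_
  · rw [norm_mul, Real.norm_of_nonneg (basisFn_pos (sieveIndex_pos m r) h).le]
    exact mul_le_of_le_one_left (norm_nonneg _) (basisFn_le_one (sieveIndex_pos m r) h)
  · refine (ae_restrict_iff' measurableSet_Ioi).2 (Eventually.of_forall fun r hr => ?_)
    have hr' : 0 < r := hr
    have hu1 : Real.exp (-r ^ 2) < 1 := by
      rw [Real.exp_lt_one_iff, neg_lt_zero]; positivity
    have := (tendsto_basisFn (Real.exp_pos (-r ^ 2)) hu1 h).mul_const (f r)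
    rw [← Real.exp_mul] at this
    rwa [neg_mul] at this

/-- Pointwise convergence of antitone functions to a continuous antitone function that vanishes at
infinity is uniform. -/
lemma uniform_of_pointwise_antitone {F : ℕ → ℝ≥0 → ℝ} (hF : ∀ n, Antitone (F n))
    (hF0 : ∀ n h, 0 ≤ F n h) (hC : Antitone C) (hC0 : ∀ h, 0 ≤ C h) (hcont : Continuous C)
    (hlim : Tendsto C atTop (𝓝 0)) (hpt : ∀ h, Tendsto (fun n => F n h) atTop (𝓝 (C h)))
    {ε : ℝ} (hε : 0 < ε) : ∀ᶠ n in atTop, ∀ h, |F n h - C h| ≤ ε := by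
  obtain ⟨R, hR, hR0⟩ : ∃ R : ℝ≥0, C R < ε / 2 ∧ 0 < R :=
    (((hlim.eventually (gt_mem_nhds (half_pos hε)))).and (eventually_gt_atTop 0)).exists
  have huc := (isCompact_Icc (a := (0 : ℝ≥0)) (b := R)).uniformContinuousOn_of_continuous
    hcont.continuousOn
  rw [Metric.uniformContinuousOn_iff] at huc
  obtain ⟨δ, hδ, hunif⟩ := huc (ε / 2) (half_pos hε)
  have hR0' : (0 : ℝ) < R := hR0
  obtain ⟨M, hM⟩ := exists_nat_gt ((R : ℝ) / δ)
  have hM0 : (0 : ℝ) < M := lt_of_le_of_lt (by positivity) hM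
  set g : ℕ → ℝ≥0 := fun i => (i : ℝ≥0) * R / (M : ℝ≥0) with hg
  have hgr : ∀ i, (g i : ℝ) = i * R / M := fun i => by simp [hg]
  have hfin : ∀ᶠ n in atTop, ∀ i ∈ Finset.range (M + 1), |F n (g i) - C (g i)| < ε / 2 := by
    rw [eventually_all_finset]
    intro i _
    have := (hpt (g i)).eventually (Metric.ball_mem_nhds _ (half_pos hε))
    simpa [Real.dist_eq] using this
  filter_upwards [hfin] with n hn h
  have hgM : g M = R := by
    apply NNReal.coe_injective; rw [hgr]; field_simp
  rcases le_or_gt R h with hRh | hRh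
  · have h1 := hn M (by simp)
    rw [hgM, abs_lt] at h1
    have h2 := hF n hRh
    have h3 := hC hRh
    have h4 := hF0 n h
    have h5 := hC0 h
    rw [abs_le]; constructor <;> linarith
  · set i := ⌊(h : ℝ) * M / R⌋₊ with hi
    have hRh' : (h : ℝ) < R := hRh
    have hiM : i < M := by
      rw [hi, Nat.floor_lt (by positivity), div_lt_iff₀ hR0']; nlinarith
    have hlo : g i ≤ h := by
      rw [← NNReal.coe_le_coe, hgr, div_le_iff₀ hM0]
      have : (i : ℝ) ≤ (h : ℝ) * M / R := Nat.floor_le (by positivity)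
      rwa [le_div_iff₀ hR0'] at this
    have hhi : h ≤ g (i + 1) := by
      rw [← NNReal.coe_le_coe, hgr, le_div_iff₀ hM0]
      have : (h : ℝ) * M / R < (i : ℝ) + 1 := Nat.lt_floor_add_one _
      rw [div_lt_iff₀ hR0'] at this
      push_cast; linarith
    have hhiR : g (i + 1) ≤ R := by
      rw [← NNReal.coe_le_coe, hgr, div_le_iff₀ hM0]
      have : ((i + 1 : ℕ) : ℝ) ≤ M := by exact_mod_cast hiM
      nlinarith
    have hdist : dist (g i) (g (i + 1)) < δ := by
      rw [NNReal.dist_eq, hgr, hgr, abs_sub_comm]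
      have : ((i + 1 : ℕ) : ℝ) * R / M - i * R / M = R / M := by push_cast; ring
      rw [this, abs_of_pos (by positivity), div_lt_iff₀ hM0]
      rw [div_lt_iff₀ hδ] at hM; linarith
    have h1 := hunif (g i) ⟨zero_le, (hlo.trans hhi).trans hhiR⟩ (g (i + 1)) ⟨zero_le, hhiR⟩ hdist
    rw [Real.dist_eq, abs_lt] at h1
    have h2 := hn i (Finset.mem_range.2 (by omega))
    have h3 := hn (i + 1) (Finset.mem_range.2 (by omega))
    rw [abs_lt] at h2 h3
    have h4 := hF n hlo
    have h5 := hF n hhi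
    have h6 := hC hlo
    have h7 := hC hhi
    rw [abs_le]; constructor <;> linarith

lemma sieveApprox_uniform (hf : IsDensity C f) {ε : ℝ} (hε : 0 < ε) :
    ∀ᶠ m in atTop, ∀ h, |sieveApprox f m h - C h| ≤ ε := by
  refine uniform_of_pointwise_antitone (fun m a b hab => ?_) (fun m h => ?_) hf.antitone
    hf.apply_nonneg hf.continuous hf.tendsto_atTop (tendsto_sieveApprox hf) hε
  · refine setIntegral_mono_on (integrable_sieveApprox hf m b) (integrable_sieveApprox hf m a)
      measurableSet_Ioi fun r hr => ?_
    exact mul_le_mul_of_nonneg_right (basisFn_antitone (sieveIndex_pos m r) hab) (hf.nonneg r hr)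
  · exact setIntegral_nonneg measurableSet_Ioi fun r hr =>
      mul_nonneg (basisFn_pos (sieveIndex_pos m r) h).le (hf.nonneg r hr)

end Approx

end

section

/-! ### Centered Gaussian vectors -/

variable {ι κ Ω : Type*} [Fintype ι] [Fintype κ] [MeasurableSpace Ω] {P : Measure Ω}

/-- `Z` is a centered Gaussian vector with covariance matrix `S` under `P`. -/
structure IsCenteredGauss (P : Measure Ω) (S : Matrix ι ι ℝ) (Z : Ω → ι → ℝ) : Prop where
  gauss : HasGaussianLaw Z P
  mean : ∀ i, ∫ ω, Z ω i ∂P = 0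
  cov : ∀ i j, ∫ ω, Z ω i * Z ω j ∂P = S i j

/-- The fourth moment of the standard normal law. -/
noncomputable def gaussFourth : ℝ := ∫ x, x ^ 4 ∂(gaussianReal 0 1)

lemma gaussFourth_nonneg : 0 ≤ gaussFourth := integral_nonneg fun x => by positivity

namespace IsCenteredGauss

variable {S : Matrix ι ι ℝ} {Z : Ω → ι → ℝ}

lemma coord (h : IsCenteredGauss P S Z) (i : ι) : HasGaussianLaw (fun ω => Z ω i) P :=
  HasGaussianLaw.eval (X := fun i ω => Z ω i) h.gauss i

lemma isProbabilityMeasure (h : IsCenteredGauss P S Z) : IsProbabilityMeasure P :=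
  h.gauss.isProbabilityMeasure

lemma memLp_coord (h : IsCenteredGauss P S Z) (i : ι) (p : ENNReal) (hp : p ≠ ⊤) :
    MemLp (fun ω => Z ω i) p P := (h.coord i).memLp hp

lemma integrable_mul_coord (h : IsCenteredGauss P S Z) (i j : ι) :
    Integrable (fun ω => Z ω i * Z ω j) P :=
  (h.memLp_coord i 2 (by simp)).integrable_mul (h.memLp_coord j 2 (by simp))

/-- Linear images of centered Gaussian vectors. -/
lemma map (h : IsCenteredGauss P S Z) (M : Matrix κ ι ℝ) :
    IsCenteredGauss P (M * S * Mᵀ) (fun ω => M *ᵥ Z ω) where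
  gauss := h.gauss.map_fun (Matrix.mulVecLin M).toContinuousLinearMap
  mean i := by
    have h1 : ∀ j, Integrable (fun ω => Z ω j) P := fun j => (h.coord j).integrable
    simp only [Matrix.mulVec, dotProduct]
    rw [integral_finsetSum _ fun j _ => (h1 j).const_mul _]
    simp [integral_const_mul, h.mean]
  cov i j := by
    have e : ∀ ω, (M *ᵥ Z ω) i * (M *ᵥ Z ω) j =
        ∑ a, ∑ b, (M i a * M j b) * (Z ω a * Z ω b) := fun ω => by
      simp only [Matrix.mulVec, dotProduct]
      rw [Finset.sum_mul_sum]
      exact Finset.sum_congr rfl fun a _ => Finset.sum_congr rfl fun b _ => by ring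
    simp_rw [e]
    rw [integral_finsetSum _ fun a _ => integrable_finsetSum _ fun b _ =>
      (h.integrable_mul_coord a b).const_mul _]
    simp only [Matrix.mul_apply, Finset.sum_mul, Matrix.transpose_apply]
    rw [Finset.sum_comm]
    refine Finset.sum_congr rfl fun a _ => ?_
    rw [integral_finsetSum _ fun b _ => (h.integrable_mul_coord a b).const_mul _]
    refine Finset.sum_congr rfl fun b _ => ?_
    rw [integral_const_mul, h.cov]; ring

lemma cov_symm (h : IsCenteredGauss P S Z) : S.IsSymm :=
  Matrix.IsSymm.ext fun i j => by
    rw [← h.cov, ← h.cov]; exact integral_congr_ae (Eventually.of_forall fun ω => mul_comm _ _)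

/-- Powers of a coordinate, in terms of the standard normal law. -/
lemma integral_pow_coord (h : IsCenteredGauss P S Z) (i : ι) (k : ℕ) :
    ∫ ω, Z ω i ^ k ∂P = √(S i i) ^ k * ∫ x, x ^ k ∂(gaussianReal 0 1) := by
  have hP := h.isProbabilityMeasure
  have hmap := (h.coord i).map_eq_gaussianReal
  rw [h.mean i] at hmap
  have hvar : Var[fun ω => Z ω i; P] = S i i := by
    rw [variance_of_integral_eq_zero (h.coord i).aemeasurable (h.mean i), ← h.cov]
    simp [sq]
  rw [hvar] at hmap
  have hS : 0 ≤ S i i := by rw [← hvar]; exact variance_nonneg _ _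
  have hg : gaussianReal 0 (S i i).toNNReal =
      (gaussianReal 0 1).map (√(S i i) * ·) := by
    rw [gaussianReal_map_const_mul]
    congr 1
    · simp
    · ext; simp [Real.sq_sqrt hS, hS]
  have hk : ∀ ν : Measure ℝ, AEStronglyMeasurable (fun x : ℝ => x ^ k) ν := fun ν =>
    (measurable_id.pow_const k).aestronglyMeasurable
  have h1 : ∫ ω, Z ω i ^ k ∂P = ∫ x, x ^ k ∂(P.map fun ω => Z ω i) :=
    (integral_map (h.coord i).aemeasurable (hk _)).symm
  rw [h1, hmap, hg, integral_map (by fun_prop) (hk _), ← integral_const_mul]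
  simp [mul_pow]

lemma diag_nonneg (h : IsCenteredGauss P S Z) (i : ι) : 0 ≤ S i i := by
  rw [← h.cov]; exact integral_nonneg fun ω => mul_self_nonneg _

lemma integral_fourth_coord (h : IsCenteredGauss P S Z) (i : ι) :
    ∫ ω, Z ω i ^ 4 ∂P = gaussFourth * S i i ^ 2 := by
  rw [h.integral_pow_coord, gaussFourth, mul_comm]
  congr 1
  rw [show (4 : ℕ) = 2 * 2 by norm_num, pow_mul, Real.sq_sqrt (h.diag_nonneg i)]

lemma integrable_dotProduct_sq (h : IsCenteredGauss P S Z) (x : ι → ℝ) :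
    Integrable (fun ω => (x ⬝ᵥ Z ω) ^ 2) P := by
  have := (h.map (κ := Unit) (Matrix.of fun _ j => x j)).memLp_coord () 2 (by simp)
  exact this.integrable_sq

/-- The second moment of a linear form. -/
lemma integral_dotProduct_sq (h : IsCenteredGauss P S Z) (x : ι → ℝ) :
    ∫ ω, (x ⬝ᵥ Z ω) ^ 2 ∂P = x ⬝ᵥ S *ᵥ x := by
  have := (h.map (κ := Unit) (Matrix.of fun _ j => x j)).cov () ()
  simp only [← sq] at this
  refine Eq.trans this ?_
  simp only [Matrix.mul_apply, Matrix.of_apply, Matrix.transpose_apply, Finset.sum_mul]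
  rw [quadForm_eq_sum, Finset.sum_comm]
  exact Finset.sum_congr rfl fun i _ => Finset.sum_congr rfl fun j _ => by ring

lemma posSemidef (h : IsCenteredGauss P S Z) : S.PosSemidef := by
  rw [posSemidef_iff_real]
  refine ⟨h.cov_symm, fun v => ?_⟩
  rw [← h.integral_dotProduct_sq]
  exact integral_nonneg fun ω => sq_nonneg _

lemma integrable_quad (h : IsCenteredGauss P S Z) (M : Matrix ι ι ℝ) :
    Integrable (fun ω => Z ω ⬝ᵥ M *ᵥ Z ω) P := by
  simp_rw [quadForm_eq_sum]
  exact integrable_finsetSum _ fun a _ => integrable_finsetSum _ fun b _ =>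
      (h.integrable_mul_coord a b).mul_const _

/-- The expectation of a quadratic form. -/
lemma integral_quad (h : IsCenteredGauss P S Z) (M : Matrix ι ι ℝ) :
    ∫ ω, Z ω ⬝ᵥ M *ᵥ Z ω ∂P = (M * S).trace := by
  simp_rw [quadForm_eq_sum]
  refine (integral_finsetSum _ fun a _ => integrable_finsetSum _ fun b _ =>
      (h.integrable_mul_coord a b).mul_const (M a b)).trans ?_
  simp only [Matrix.trace, Matrix.diag, Matrix.mul_apply]
  refine Finset.sum_congr rfl fun a _ => ?_
  refine (integral_finsetSum _ fun b _ =>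
    (h.integrable_mul_coord a b).mul_const (M a b)).trans ?_
  refine Finset.sum_congr rfl fun b _ => ?_
  rw [integral_mul_const, h.cov, h.cov_symm.apply, mul_comm]

/-- The variance of a weighted sum of squares of independent standard normal variables. -/
lemma sum_sq_variance [DecidableEq ι] (h : IsCenteredGauss P (1 : Matrix ι ι ℝ) Z) (D : ι → ℝ) :
    Integrable (fun ω => (∑ i, D i * Z ω i ^ 2 - ∑ i, D i) ^ 2) P ∧
      ∫ ω, (∑ i, D i * Z ω i ^ 2 - ∑ i, D i) ^ 2 ∂P ≤ gaussFourth * ∑ i, D i ^ 2 := by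
  have hP := h.isProbabilityMeasure
  have hind : iIndepFun (fun i ω => Z ω i) P := by
    refine HasGaussianLaw.iIndepFun_of_covariance_eq_zero (X := fun i ω => Z ω i) h.gauss ?_
    intro i j hij
    rw [covariance_eq_sub (h.memLp_coord i 2 (by simp)) (h.memLp_coord j 2 (by simp))]
    simp [h.mean, h.cov, hij]
  have hind2 : iIndepFun (fun i ω => D i * Z ω i ^ 2) P :=
    hind.comp (fun i x => D i * x ^ 2) (fun i => by fun_prop)
  have hL4 : ∀ i, MemLp (fun ω => Z ω i ^ 2) 2 P := fun i => by
    have h4 := h.memLp_coord i 4 (by simp)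
    have := h4.mul (r := 2) (p := 4) (q := 4) h4 (hpqr := ⟨by
      rw [show (4 : ENNReal) = 2 * 2 by norm_num, ENNReal.mul_inv (by simp) (by simp), ← two_mul,
        ← mul_assoc, ENNReal.mul_inv_cancel (by simp) (by simp), one_mul]⟩)
    simpa [sq] using! this
  have hL : ∀ i, MemLp (fun ω => D i * Z ω i ^ 2) 2 P := fun i => (hL4 i).const_mul (D i)
  have hsum : MemLp (fun ω => ∑ i, D i * Z ω i ^ 2) 2 P := memLp_finsetSum _ fun i _ => hL i
  have hmean : ∫ ω, ∑ i, D i * Z ω i ^ 2 ∂P = ∑ i, D i := by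
    rw [integral_finsetSum _ fun i _ => (hL i).integrable (by norm_num)]
    refine Finset.sum_congr rfl fun i _ => ?_
    rw [integral_const_mul]
    have := h.cov i i
    simp only [← sq, Matrix.one_apply_eq] at this
    rw [this, mul_one]
  refine ⟨(hsum.sub (memLp_const _)).integrable_sq, ?_⟩
  have hv : ∫ ω, (∑ i, D i * Z ω i ^ 2 - ∑ i, D i) ^ 2 ∂P =
      Var[fun ω => ∑ i, D i * Z ω i ^ 2; P] := by
    rw [variance_eq_integral hsum.1.aemeasurable, hmean]
  have hvs : Var[fun ω => ∑ i, D i * Z ω i ^ 2; P] = ∑ i, Var[fun ω => D i * Z ω i ^ 2; P] := by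
    have := IndepFun.variance_sum (s := Finset.univ) (X := fun i ω => D i * Z ω i ^ 2)
      (μ := P) (fun i _ => hL i) (fun i _ j _ hij => hind2.indepFun hij)
    rw [← this]
    congr 1
    ext ω; simp
  rw [hv, hvs, Finset.mul_sum]
  refine Finset.sum_le_sum fun i _ => ?_
  rw [variance_const_mul, mul_comm]
  refine mul_le_mul_of_nonneg_right ?_ (sq_nonneg _)
  refine (variance_le_expectation_sq (hL4 i).1).trans (le_of_eq ?_)
  have := h.integral_fourth_coord i
  simp only [Matrix.one_apply_eq, one_pow, mul_one] at this
  rw [← this]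
  exact integral_congr_ae (Eventually.of_forall fun ω => by simp only [Pi.pow_apply]; ring)

/-- Concentration of a quadratic form: its variance is of the order of the dimension. -/
lemma quad_variance [DecidableEq ι] (h : IsCenteredGauss P S Z) (hS : S.PosDef) {K : ℝ}
    (hK : 0 ≤ K) (hSK : QUpper S K) {M : Matrix ι ι ℝ} (hM : M.PosSemidef) {b : ℝ} (hb : 0 ≤ b)
    (hMb : QUpper M b) :
    Integrable (fun ω => (Z ω ⬝ᵥ M *ᵥ Z ω - (M * S).trace) ^ 2) P ∧
      ∫ ω, (Z ω ⬝ᵥ M *ᵥ Z ω - (M * S).trace) ^ 2 ∂P ≤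
        gaussFourth * (Fintype.card ι * (K * b) ^ 2) := by
  obtain ⟨V, hV⟩ := hS.posSemidef.exists_transpose_mul_self
  have hVu : IsUnit V := by
    have := hS.isUnit
    rw [Matrix.isUnit_iff_isUnit_det] at this ⊢
    rw [hV, Matrix.det_mul, Matrix.det_transpose] at this
    exact isUnit_of_mul_isUnit_left this
  have h1 : V * V⁻¹ = 1 := Matrix.mul_nonsing_inv _ ((Matrix.isUnit_iff_isUnit_det _).1 hVu)
  have h1' : V⁻¹ * V = 1 := mul_eq_one_comm.1 h1
  have h2 : (V⁻¹)ᵀ * Vᵀ = 1 := by rw [← Matrix.transpose_mul, h1, Matrix.transpose_one]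
  have h2' : Vᵀ * (V⁻¹)ᵀ = 1 := mul_eq_one_comm.1 h2
  have hHp : (V * M * Vᵀ).PosSemidef := by
    simpa using hM.mul_mul_conjTranspose_same V
  obtain ⟨U, hUU, hUU', hdiag⟩ := exists_orthogonal_diag hHp.isHermitian
  set D := hHp.isHermitian.eigenvalues with hD
  set R := Uᵀ * (V⁻¹)ᵀ with hR
  have hRt : Rᵀ = V⁻¹ * U := by rw [hR, Matrix.transpose_mul]; simp
  have hRS : R * S * Rᵀ = 1 := by
    calc R * S * Rᵀ = Uᵀ * ((V⁻¹)ᵀ * Vᵀ) * (V * V⁻¹) * U := by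
          rw [hRt, hR, hV]; simp only [mul_assoc]
      _ = 1 := by rw [h2, h1, mul_one, mul_one, hUU']
  have hMR : M = Rᵀ * Matrix.diagonal D * R := by
    calc M = (V⁻¹ * V) * M * (Vᵀ * (V⁻¹)ᵀ) := by rw [h1', h2', one_mul, mul_one]
      _ = V⁻¹ * (V * M * Vᵀ) * (V⁻¹)ᵀ := by simp only [mul_assoc]
      _ = V⁻¹ * (U * Matrix.diagonal D * Uᵀ) * (V⁻¹)ᵀ := by rw [← hdiag]
      _ = _ := by rw [hRt, hR]; simp only [mul_assoc]
  have hD0 : ∀ i, 0 ≤ D i := fun i => hHp.eigenvalues_nonneg i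
  have hDle : ∀ i, D i ≤ K * b := fun i => by
    set y := Rᵀ *ᵥ Pi.single i 1 with hy
    set w := S *ᵥ y with hw
    have hRw : R *ᵥ w = Pi.single i 1 := by
      rw [hw, hy, Matrix.mulVec_mulVec, Matrix.mulVec_mulVec, hRS, Matrix.one_mulVec]
    have e1 : w ⬝ᵥ M *ᵥ w = D i := by
      rw [hMR, quad_transpose_diagonal, hRw]
      simp [Pi.single_apply]
    have e2 : y ⬝ᵥ S *ᵥ y = 1 := by
      rw [← hw, hy, Matrix.mulVec_transpose, ← Matrix.dotProduct_mulVec, hRw]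
      simp
    have e3 := hS.posSemidef.cauchy w y
    have e4 : y ⬝ᵥ w = 1 := e2
    rw [← hw, e4, mul_one] at e3
    have e5 := hSK w
    have e6 := dotProduct_self_nonneg' w
    have e7 : w ⬝ᵥ w ≤ K := by
      by_contra hcon
      nlinarith [not_le.1 hcon]
    rw [← e1]
    calc w ⬝ᵥ M *ᵥ w ≤ b * (w ⬝ᵥ w) := hMb w
      _ ≤ b * K := by gcongr
      _ = K * b := mul_comm _ _
  have hg := (h.map R)
  rw [hRS] at hg
  obtain ⟨hi, hb2⟩ := hg.sum_sq_variance D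
  have e1 : ∀ ω, Z ω ⬝ᵥ M *ᵥ Z ω = ∑ i, D i * (R *ᵥ Z ω) i ^ 2 := fun ω => by
    rw [hMR, quad_transpose_diagonal]
  have e2 : (M * S).trace = ∑ i, D i := by
    rw [hMR, mul_assoc, mul_assoc, Matrix.trace_mul_comm, mul_assoc, mul_assoc, ← mul_assoc R,
      hRS, mul_one, Matrix.trace_diagonal]
  simp_rw [e1, e2]
  refine ⟨hi, hb2.trans (mul_le_mul_of_nonneg_left ?_ gaussFourth_nonneg)⟩
  calc ∑ i, D i ^ 2 ≤ ∑ _i : ι, (K * b) ^ 2 :=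
        Finset.sum_le_sum fun i _ => pow_le_pow_left₀ (hD0 i) (hDle i) 2
    _ = _ := by simp

end IsCenteredGauss

/-- Restriction of a Gaussian process to finitely many sites, centered. -/
lemma IsCenteredGauss.of_process {T : Type*} {Y : T → Ω → ℝ} (hY : IsGaussianProcess Y P)
    (μ : T → ℝ) (hμ : ∀ t, ∫ ω, Y t ω ∂P = μ t) (s : ι → T) :
    IsCenteredGauss P (Matrix.of fun i j => cov[Y (s i), Y (s j); P])
      (fun ω i => Y (s i) ω - μ (s i)) where
  gauss := by
    have h1 := ((hY.comp_right s).hasGaussianLaw Finset.univ).map_fun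
      (ContinuousLinearMap.pi fun i : ι =>
        ContinuousLinearMap.proj (R := ℝ) (φ := fun _ : (Finset.univ : Finset ι) => ℝ)
          ⟨i, Finset.mem_univ i⟩)
    have h2 : HasGaussianLaw (fun ω i => Y (s i) ω) P := h1
    have h3 := h2.isGaussian_map
    constructor
    have : P.map (fun ω i => Y (s i) ω - μ (s i)) =
        (P.map (fun ω i => Y (s i) ω)).map (fun x => x - fun i => μ (s i)) := by
      rw [AEMeasurable.map_map_of_aemeasurable (by fun_prop) h2.aemeasurable]
      rfl
    rw [this]
    infer_instance
  mean i := by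
    have hP := hY.isProbabilityMeasure
    rw [integral_sub (hY.hasGaussianLaw_eval _).integrable (integrable_const _), hμ]
    simp
  cov i j := by
    simp [covariance, hμ]

end

section

/-! ### Covariance matrices as mixtures of Gaussian kernel matrices -/

variable {d n : ℕ} {C : ℝ≥0 → ℝ} {f : ℝ → ℝ}

lemma covMatrix_apply (x : Fin n → EuclideanSpace ℝ (Fin d)) (C : ℝ≥0 → ℝ) (i j : Fin n) :
    covMatrix x C i j = C (nndist (x i) (x j)) := rfl

lemma covMatrix_isSymm (x : Fin n → EuclideanSpace ℝ (Fin d)) (C : ℝ≥0 → ℝ) :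
    (covMatrix x C).IsSymm :=
  Matrix.IsSymm.ext fun i j => by rw [covMatrix_apply, covMatrix_apply, nndist_comm]

lemma abs_gaussMat_apply_le_one (x : Fin n → EuclideanSpace ℝ (Fin d)) (r : ℝ) (i j : Fin n) :
    |gaussMat x (r ^ 2) i j| ≤ 1 := by
  rw [gaussMat_apply, abs_of_pos (Real.exp_pos _), Real.exp_le_one_iff, neg_nonpos]
  positivity

lemma measurable_quad_gaussMat (x : Fin n → EuclideanSpace ℝ (Fin d)) (v : Fin n → ℝ) :
    Measurable fun r : ℝ => v ⬝ᵥ gaussMat x (r ^ 2) *ᵥ v := by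
  simp_rw [quadForm_eq_sum, gaussMat_apply]
  fun_prop

lemma abs_quad_gaussMat_le (x : Fin n → EuclideanSpace ℝ (Fin d)) (v : Fin n → ℝ) (r : ℝ) :
    |v ⬝ᵥ gaussMat x (r ^ 2) *ᵥ v| ≤ ∑ i, ∑ j, |v i| * |v j| := by
  rw [quadForm_eq_sum]
  refine (Finset.abs_sum_le_sum_abs _ _).trans (Finset.sum_le_sum fun i _ => ?_)
  refine (Finset.abs_sum_le_sum_abs _ _).trans (Finset.sum_le_sum fun j _ => ?_)
  rw [abs_mul, abs_mul]
  exact mul_le_of_le_one_right (by positivity) (abs_gaussMat_apply_le_one x r i j)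

lemma IsDensity.integrable_quad (hf : IsDensity C f) (x : Fin n → EuclideanSpace ℝ (Fin d))
    (v : Fin n → ℝ) :
    IntegrableOn (fun r => (v ⬝ᵥ gaussMat x (r ^ 2) *ᵥ v) * f r) (Set.Ioi 0) :=
  hf.integrable_mul (measurable_quad_gaussMat x v) fun r _ => abs_quad_gaussMat_le x v r

/-- The quadratic form of a covariance matrix is the mixture of the Gaussian kernel forms. -/
lemma IsDensity.quad_covMatrix (hf : IsDensity C f) (x : Fin n → EuclideanSpace ℝ (Fin d))
    (v : Fin n → ℝ) :
    v ⬝ᵥ covMatrix x C *ᵥ v =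
      ∫ r in Set.Ioi (0 : ℝ), (v ⬝ᵥ gaussMat x (r ^ 2) *ᵥ v) * f r := by
  simp_rw [quadForm_eq_sum, covMatrix_apply, hf.eq, gaussMat_apply, Finset.sum_mul]
  have hi : ∀ i j, IntegrableOn (fun r => v i * v j *
      Real.exp (-(r ^ 2 * dist (x i) (x j) ^ 2)) * f r) (Set.Ioi 0) := fun i j => by
    have := (hf.integrable_exp_mul (nndist (x i) (x j))).const_mul (v i * v j)
    simpa only [coe_nndist, mul_assoc, IntegrableOn] using this
  rw [integral_finsetSum _ fun i _ => integrable_finsetSum _ fun j _ => hi i j]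
  refine Finset.sum_congr rfl fun i _ => ?_
  rw [integral_finsetSum _ fun j _ => hi i j]
  refine Finset.sum_congr rfl fun j _ => ?_
  rw [← integral_const_mul]
  simp only [coe_nndist, mul_assoc]

lemma covMatrix_posSemidef (x : Fin n → EuclideanSpace ℝ (Fin d)) (hC : C ∈ classA) :
    (covMatrix x C).PosSemidef := by
  obtain ⟨f, hf⟩ := exists_density hC
  rw [posSemidef_iff_real]
  refine ⟨covMatrix_isSymm x C, fun v => ?_⟩
  rw [hf.quad_covMatrix]
  exact setIntegral_nonneg measurableSet_Ioi fun r hr =>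
    mul_nonneg ((gaussMat_posSemidef x (sq_nonneg r)).quad_nonneg v) (hf.nonneg r hr)

/-- A lower bound of the Gaussian kernel forms at high frequencies gives a lower bound of the
covariance matrix, in proportion to the spectral mass there. -/
lemma IsDensity.qLower_covMatrix (hf : IsDensity C f) (x : Fin n → EuclideanSpace ℝ (Fin d))
    {r₀ a : ℝ} (hr₀ : 0 ≤ r₀) (h : ∀ r, r₀ < r → QLower a (gaussMat x (r ^ 2))) :
    QLower ((∫ r in Set.Ioi r₀, f r) * a) (covMatrix x C) := by
  intro v
  have hsub : Set.Ioi r₀ ⊆ Set.Ioi 0 := Set.Ioi_subset_Ioi hr₀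
  rw [hf.quad_covMatrix]
  calc (∫ r in Set.Ioi r₀, f r) * a * (v ⬝ᵥ v) = ∫ r in Set.Ioi r₀, (a * (v ⬝ᵥ v)) * f r := by
        rw [integral_const_mul]; ring
    _ ≤ ∫ r in Set.Ioi r₀, (v ⬝ᵥ gaussMat x (r ^ 2) *ᵥ v) * f r := by
        refine setIntegral_mono_on ((hf.integrable.mono_set hsub).const_mul _)
          ((hf.integrable_quad x v).mono_set hsub) measurableSet_Ioi fun r hr => ?_
        exact mul_le_mul_of_nonneg_right (h r hr v) (hf.nonneg r (hsub hr))
    _ ≤ _ := by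
        refine setIntegral_mono_set (hf.integrable_quad x v) ?_ (ae_of_all _ hsub)
        refine (ae_restrict_iff' measurableSet_Ioi).2 (Eventually.of_forall fun r hr => ?_)
        exact mul_nonneg ((gaussMat_posSemidef x (sq_nonneg r)).quad_nonneg v) (hf.nonneg r hr)

lemma basisFn_self_isDensity {m : ℕ} (hm : 1 ≤ m) :
    IsDensity (basisFn m m) fun r => 2 * m * (r * Real.exp (-(m : ℝ) * r ^ 2)) := by
  have hm0 : (0 : ℝ) < m := by exact_mod_cast hm
  refine ⟨Continuous.continuousOn (by fun_prop), fun r hr => ?_, ?_, fun h => ?_⟩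
  · have hr' : 0 < r := hr
    positivity
  · have := (integral_beta_weight 0 hm0).1.const_mul (2 * m)
    simpa using! this
  · have hb : 0 < (m : ℝ) + (h : ℝ) ^ 2 := by positivity
    have h1 := (integral_beta_weight 0 hb).2
    simp only [pow_zero, mul_one, Nat.factorial_zero, Nat.cast_one, zero_add, Finset.prod_range_one,
      Nat.cast_zero, add_zero] at h1
    have h2 : ∀ r : ℝ, Real.exp (-(r ^ 2 * (h : ℝ) ^ 2)) *
        (2 * m * (r * Real.exp (-(m : ℝ) * r ^ 2))) =
        2 * m * (r * Real.exp (-((m : ℝ) + (h : ℝ) ^ 2) * r ^ 2)) := by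
      intro r
      rw [show -((m : ℝ) + (h : ℝ) ^ 2) * r ^ 2 = -(r ^ 2 * (h : ℝ) ^ 2) + -(m : ℝ) * r ^ 2 by ring,
        Real.exp_add]
      ring
    simp_rw [h2]
    rw [integral_const_mul, h1, basisFn_self]
    field_simp

/-- The spectral mass of `(1 + h² / m)⁻¹` above the frequency `r₀`. -/
lemma basisFn_self_mass {m : ℕ} (hm : 1 ≤ m) {r₀ : ℝ} (hr₀ : 0 ≤ r₀) :
    ∫ r in Set.Ioi r₀, 2 * (m : ℝ) * (r * Real.exp (-(m : ℝ) * r ^ 2)) =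
      Real.exp (-((m : ℝ) * r₀ ^ 2)) := by
  have hm0 : (0 : ℝ) < m := by exact_mod_cast hm
  have hd : ∀ r ∈ Set.Ici r₀, HasDerivAt (fun r : ℝ => -Real.exp (-((m : ℝ) * r ^ 2)))
      (2 * (m : ℝ) * (r * Real.exp (-(m : ℝ) * r ^ 2))) r := fun r _ => by
    have := (((hasDerivAt_pow 2 r).const_mul (m : ℝ)).neg.exp).neg
    refine this.congr_deriv ?_
    simp only [Pi.neg_apply, neg_mul (m : ℝ)]; push_cast; ring
  have hlim : Tendsto (fun r : ℝ => -Real.exp (-((m : ℝ) * r ^ 2))) atTop (𝓝 0) := by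
    have h1 : Tendsto (fun r : ℝ => (m : ℝ) * r ^ 2) atTop atTop :=
      Tendsto.const_mul_atTop hm0 (tendsto_pow_atTop two_ne_zero)
    simpa using (Real.tendsto_exp_neg_atTop_nhds_zero.comp h1).neg
  have := integral_Ioi_of_hasDerivAt_of_tendsto' hd
    ((basisFn_self_isDensity hm).integrable.mono_set (Set.Ioi_subset_Ioi hr₀)) hlim
  rw [this]; ring

/-- The degeneracy `∫ min(1, r) f r dr` of a spectral density: it is small when the mass
concentrates at the frequency zero, where all kernel matrices degenerate to rank one. -/
noncomputable def degen (f : ℝ → ℝ) : ℝ := ∫ r in Set.Ioi (0 : ℝ), min 1 r * f r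

lemma IsDensity.integrable_degen (hf : IsDensity C f) :
    IntegrableOn (fun r => min 1 r * f r) (Set.Ioi 0) :=
  hf.integrable_mul (by fun_prop) (B := 1) fun r hr => by
    have hr' : 0 < r := hr
    rw [abs_of_nonneg (le_min zero_le_one hr'.le)]
    exact min_le_left _ _

lemma IsDensity.sub_le_degen (hf : IsDensity C f) {h : ℝ≥0} (hh : 1 ≤ h) :
    C 0 - C h ≤ h * degen f := by
  have hh' : (1 : ℝ) ≤ h := hh
  rw [hf.apply_zero, hf.eq h, degen, ← integral_sub hf.integrable (hf.integrable_exp_mul h),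
    ← integral_const_mul]
  refine setIntegral_mono_on (hf.integrable.sub (hf.integrable_exp_mul h))
    (hf.integrable_degen.const_mul _) measurableSet_Ioi fun r hr => ?_
  have hr' : 0 < r := hr
  have hfr := hf.nonneg r hr
  have key : 1 - Real.exp (-(r ^ 2 * (h : ℝ) ^ 2)) ≤ h * min 1 r := by
    have e1 := Real.exp_pos (-(r ^ 2 * (h : ℝ) ^ 2))
    have e2 := Real.add_one_le_exp (-(r ^ 2 * (h : ℝ) ^ 2))
    rcases le_total (1 : ℝ) r with h1 | h1
    · rw [min_eq_left h1]; linarith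
    · rw [min_eq_right h1]
      rcases le_total (1 : ℝ) (h * r) with h2 | h2
      · linarith
      · nlinarith [mul_nonneg hr'.le (zero_le_one.trans hh')]
  calc f r - Real.exp (-(r ^ 2 * (h : ℝ) ^ 2)) * f r
      = (1 - Real.exp (-(r ^ 2 * (h : ℝ) ^ 2))) * f r := by ring
    _ ≤ (h * min 1 r) * f r := mul_le_mul_of_nonneg_right key hfr
    _ = _ := by ring

lemma IsDensity.degen_pos (hf : IsDensity C f) (h0 : 0 < C 0) : 0 < degen f := by
  obtain ⟨h, hlt, hh⟩ := ((hf.tendsto_atTop.eventually (gt_mem_nhds h0)).and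
    (eventually_ge_atTop 1)).exists
  have h1 := hf.sub_le_degen hh
  have hh' : (1 : ℝ) ≤ h := hh
  by_contra hcon
  nlinarith [not_lt.1 hcon]

lemma IsDensity.degen_le (hf : IsDensity C f) : degen f ≤ C 0 := by
  rw [hf.apply_zero, degen]
  refine setIntegral_mono_on hf.integrable_degen hf.integrable measurableSet_Ioi fun r hr => ?_
  exact mul_le_of_le_one_left (hf.nonneg r hr) (min_le_left _ _)

/-- At least half of the degeneracy is mass above the frequency `degen f / (2 U)`. -/
lemma IsDensity.half_degen_le_mass (hf : IsDensity C f) {U : ℝ} (hU : 0 < U) (hCU : C 0 ≤ U) :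
    degen f / 2 ≤ ∫ r in Set.Ioi (degen f / (2 * U)), f r := by
  set τ := degen f with hτ
  have hτ0 : 0 ≤ τ := setIntegral_nonneg measurableSet_Ioi fun r hr =>
    mul_nonneg (le_min zero_le_one (le_of_lt hr)) (hf.nonneg r hr)
  set r₀ := τ / (2 * U) with hr₀
  have hr₀0 : 0 ≤ r₀ := by positivity
  have hsub : Set.Ioi r₀ ⊆ Set.Ioi 0 := Set.Ioi_subset_Ioi hr₀0
  have hind : IntegrableOn ((Set.Ioi r₀).indicator f) (Set.Ioi 0) :=
    hf.integrable.indicator measurableSet_Ioi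
  have h1 : τ ≤ ∫ r in Set.Ioi (0 : ℝ), (r₀ * f r + (Set.Ioi r₀).indicator f r) := by
    refine setIntegral_mono_on hf.integrable_degen ((hf.integrable.const_mul _).add hind)
      measurableSet_Ioi fun r hr => ?_
    have hfr := hf.nonneg r hr
    by_cases hrr : r ∈ Set.Ioi r₀
    · rw [Set.indicator_of_mem hrr]
      have := mul_le_of_le_one_left hfr (min_le_left 1 r)
      nlinarith [mul_nonneg hr₀0 hfr]
    · rw [Set.indicator_of_notMem hrr, add_zero]
      exact mul_le_mul_of_nonneg_right ((min_le_right _ _).trans (not_lt.1 hrr)) hfr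
  rw [integral_add (hf.integrable.const_mul _) hind, integral_const_mul, ← hf.apply_zero,
    integral_indicator measurableSet_Ioi, Measure.restrict_restrict measurableSet_Ioi,
    Set.inter_eq_left.2 hsub] at h1
  have h2 : r₀ * C 0 ≤ τ / 2 := by
    calc r₀ * C 0 ≤ r₀ * U := by gcongr
      _ = τ / 2 := by rw [hr₀]; field_simp
  linarith

/-! ### Geometry of the design -/

lemma qUpper_gaussMat {x : Fin n → EuclideanSpace ℝ (Fin d)} {m : ℕ} (hm : 1 ≤ m) {K : ℝ}
    (h : QUpper (covMatrix x (basisFn m m)) K) {t : ℝ} (ht : 1 / (m : ℝ) ≤ t) :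
    QUpper (gaussMat x t) K := by
  have hm0 : (0 : ℝ) < m := by exact_mod_cast hm
  refine h.of_entry_le fun i j => ?_
  rw [gaussMat_apply, abs_of_pos (Real.exp_pos _), covMatrix_apply, basisFn_self, coe_nndist,
    Real.exp_neg]
  refine inv_anti₀ (by positivity) ?_
  have h1 := Real.add_one_le_exp (t * dist (x i) (x j) ^ 2)
  have h2 : dist (x i) (x j) ^ 2 / m ≤ t * dist (x i) (x j) ^ 2 := by
    rw [div_eq_mul_one_div, mul_comm]
    exact mul_le_mul_of_nonneg_right ht (by positivity)
  linarith

/-- Well-conditioned kernel matrices force the sites apart. -/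
lemma sep_of_qLower {x : Fin n → EuclideanSpace ℝ (Fin d)} {c : ℝ} (hc : 0 < c)
    (h : QLower c (covMatrix x (basisFn 1 1))) (i j : Fin n) (hij : i ≠ j) :
    √c ≤ dist (x i) (x j) := by
  have h1 := h (Pi.single i 1 - Pi.single j 1)
  rw [sub_eq_add_neg, quad_add (covMatrix_isSymm _ _)] at h1
  simp only [Matrix.mulVec_neg, dotProduct_neg, neg_dotProduct, Matrix.mulVec_single_one,
    single_one_dotProduct, add_dotProduct, dotProduct_add, Matrix.col_apply, covMatrix_apply,
    nndist_self, basisFn_zero, Pi.single_eq_same, Pi.single_eq_of_ne hij,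
    Pi.single_eq_of_ne hij.symm] at h1
  rw [basisFn_self, coe_nndist] at h1
  set D := dist (x i) (x j) with hD
  have hD0 : 0 ≤ D := dist_nonneg
  have h2 : c ≤ 1 - (1 + D ^ 2 / (1 : ℕ))⁻¹ := by linarith
  have h3 : 1 - (1 + D ^ 2 / (1 : ℕ))⁻¹ = D ^ 2 / (1 + D ^ 2) := by
    push_cast; field_simp; ring
  rw [h3, le_div_iff₀ (by positivity)] at h2
  exact Real.sqrt_le_iff.2 ⟨hD0, by nlinarith⟩

lemma count_le_of_qUpper {x : Fin n → EuclideanSpace ℝ (Fin d)} {m : ℕ} (hm : 1 ≤ m) {K : ℝ}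
    (hK : 0 ≤ K) (h : QUpper (covMatrix x (basisFn m m)) K) (R : ℝ) (i : Fin n) :
    ((Finset.univ.filter fun j => dist (x i) (x j) ≤ R).card : ℝ) ≤
      (K * (1 + R ^ 2 / m)) ^ 2 := by
  have hm0 : (0 : ℝ) < m := by exact_mod_cast hm
  have h1 := (covMatrix_posSemidef x (basisFn_mem_classA hm le_rfl)).row_sq_sum_le hK h i
  set b := (1 + R ^ 2 / m) with hb
  have hb0 : 0 < b := by positivity
  have h2 : ((Finset.univ.filter fun j => dist (x i) (x j) ≤ R).card : ℝ) * (b⁻¹) ^ 2 ≤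
      ∑ j, covMatrix x (basisFn m m) i j ^ 2 := by
    rw [← nsmul_eq_mul, ← Finset.sum_const]
    refine (Finset.sum_le_sum fun j hj => ?_).trans (Finset.sum_le_sum_of_subset_of_nonneg
      (Finset.filter_subset _ _) fun j _ _ => sq_nonneg _)
    rw [covMatrix_apply, basisFn_self, coe_nndist]
    have hj' := (Finset.mem_filter.1 hj).2
    refine pow_le_pow_left₀ (by positivity) (inv_anti₀ (by positivity) ?_) 2
    rw [hb]
    gcongr
  have h3 := h2.trans h1
  rw [inv_pow, ← div_eq_mul_inv, div_le_iff₀ (by positivity)] at h3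
  rw [mul_pow]; exact h3

end

section

/-! ### Lower bounds for covariance matrices in the sieve -/

variable {d n : ℕ} {C : ℝ≥0 → ℝ} {f : ℝ → ℝ}

/-- The kernel matrices have a lower bound that is polynomial in the frequency, down to frequencies
slightly above the resolution of the sieve. Here `q ^ 8 = m`. -/
lemma exists_gaussMat_lower (d : ℕ) {c K : ℝ} (hc : 0 < c) (hc1 : c ≤ 1) (hK : 1 ≤ K) :
    ∃ a : ℝ, 0 < a ∧ ∃ N : ℕ, ∃ Q : ℝ, 2 ≤ Q ∧ ∀ (q : ℝ) (m : ℕ), Q ≤ q → q ^ 8 = m →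
      ∀ (n : ℕ) (x : Fin n → EuclideanSpace ℝ (Fin d)), QLower c (covMatrix x (basisFn 1 1)) →
        QUpper (covMatrix x (basisFn m m)) K → ∀ r₀ r : ℝ, 0 < r₀ → (q ^ 3)⁻¹ ≤ r₀ → r₀ ≤ 1 →
          r₀ ≤ r → QLower (a * r₀ ^ N) (gaussMat x (r ^ 2)) := by
  set N : ℕ := ⌈(K * 2) ^ 2⌉₊ with hN
  have hN0 : 0 < N := Nat.ceil_pos.2 (by positivity)
  have hN1 : (1 : ℝ) ≤ N := by exact_mod_cast hN0
  set a₀ : ℝ := (c / (2 * N)) ^ N / N / 2 with ha₀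
  have ha0 : 0 < a₀ := by positivity
  -- the exponential error is absorbed by half of the polynomial main term
  have hlim : Tendsto (fun q : ℝ => (K + 1) * 2 ^ d * ((q ^ 3) ^ (2 * N) * Real.exp (-(q ^ 2 / 4))))
      atTop (𝓝 0) := by
    have h1 := Real.tendsto_pow_mul_exp_neg_atTop_nhds_zero (3 * N)
    have h2 : Tendsto (fun q : ℝ => q ^ 2 / 4) atTop atTop :=
      (tendsto_pow_atTop two_ne_zero).atTop_div_const (by norm_num)
    have h3 := ((h1.comp h2).const_mul (4 ^ (3 * N))).const_mul ((K + 1) * 2 ^ d)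
    simp only [mul_zero] at h3
    refine h3.congr fun q => ?_
    simp only [Function.comp]
    rw [div_pow, ← pow_mul, ← pow_mul, show 2 * (3 * N) = 3 * (2 * N) by ring]
    field_simp
  obtain ⟨Q, hQ⟩ := ((hlim.eventually (gt_mem_nhds (half_pos ha0))).and
    (eventually_ge_atTop 2)).exists_forall_of_atTop
  refine ⟨a₀ / 2, by positivity, 2 * N, Q, (hQ Q le_rfl).2, ?_⟩
  intro q m hq hqm n x hlow hup r₀ r hr₀ hqr hr₀1 hr
  obtain ⟨herr, hq2⟩ := hQ q hq
  have hq0 : 0 < q := by linarith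
  have hm0 : (0 : ℝ) < m := by rw [← hqm]; positivity
  have hm : 1 ≤ m := Nat.one_le_iff_ne_zero.2 fun h => by simp [h] at hm0
  have hr0 : 0 < r := hr₀.trans_le hr
  have hrq : (q ^ 6)⁻¹ ≤ r ^ 2 := by
    calc (q ^ 6)⁻¹ = ((q ^ 3)⁻¹) ^ 2 := by rw [inv_pow, ← pow_mul]
      _ ≤ r ^ 2 := pow_le_pow_left₀ (by positivity) (hqr.trans hr) 2
  have hcount : ∀ i, (Finset.univ.filter fun j => dist (x i) (x j) ≤ 2 * (q ^ 4 / 2)).card ≤ N := by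
    intro i
    have h1 := count_le_of_qUpper hm (by linarith : 0 ≤ K) hup (2 * (q ^ 4 / 2)) i
    have h2 : K * (1 + (2 * (q ^ 4 / 2)) ^ 2 / (m : ℝ)) = K * 2 := by
      rw [← hqm]; field_simp; ring
    rw [h2] at h1
    exact_mod_cast h1.trans (Nat.le_ceil _)
  have hs : 1 / (m : ℝ) ≤ r ^ 2 / 2 := by
    have h1 : 1 / (m : ℝ) ≤ (q ^ 6)⁻¹ / 2 := by
      rw [← hqm, ← one_div, div_div]
      refine one_div_le_one_div_of_le (by positivity) ?_
      have : q ^ 8 = q ^ 6 * q ^ 2 := by ring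
      rw [this]
      exact mul_le_mul_of_nonneg_left (by nlinarith) (by positivity)
    linarith
  have h := gaussMat_lower x (s := r ^ 2 / 2) (ρ := √c) (r := q ^ 4 / 2) (by positivity)
    (Real.sqrt_pos.2 hc) (sep_of_qLower hc hlow) hN0 (by positivity) hcount
    (by linarith : 0 ≤ K) (qUpper_gaussMat hm hup hs)
  rw [show 2 * (r ^ 2 / 2) = r ^ 2 by ring, Real.sq_sqrt hc.le] at h
  refine h.mono ?_
  -- the polynomial main term, from `1 - exp (-y) ≥ y / 2` for `y ≤ 1`
  have hmain : a₀ * r₀ ^ (2 * N) ≤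
      (1 - Real.exp (-(2 * (r ^ 2 / 2 / N) * c))) ^ N / N / 2 := by
    have h1 : c / (2 * N) * r₀ ^ 2 ≤ 1 - Real.exp (-(2 * (r ^ 2 / 2 / N) * c)) := by
      set y := r₀ ^ 2 * c / N with hy
      have hy0 : 0 < y := by positivity
      have hy1 : y ≤ 1 := by
        rw [hy, div_le_one (by positivity)]
        have : r₀ ^ 2 ≤ 1 := pow_le_one₀ hr₀.le hr₀1
        nlinarith
      have hyr : y ≤ 2 * (r ^ 2 / 2 / N) * c := by
        have : r₀ ^ 2 ≤ r ^ 2 := pow_le_pow_left₀ hr₀.le hr 2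
        calc y ≤ r ^ 2 * c / N := by rw [hy]; gcongr
          _ = _ := by ring
      have e1 : Real.exp (-(2 * (r ^ 2 / 2 / N) * c)) ≤ (1 + y)⁻¹ := by
        calc Real.exp (-(2 * (r ^ 2 / 2 / N) * c)) ≤ Real.exp (-y) :=
              Real.exp_le_exp.2 (by linarith)
          _ ≤ (1 + y)⁻¹ := by
              rw [Real.exp_neg]
              exact inv_anti₀ (by positivity) (by linarith [Real.add_one_le_exp y])
      have e2 : (1 + y)⁻¹ ≤ 1 - y / 2 := by
        rw [inv_le_iff_one_le_mul₀ (by positivity)]; nlinarith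
      have e3 : c / (2 * N) * r₀ ^ 2 = y / 2 := by rw [hy]; field_simp
      linarith
    calc a₀ * r₀ ^ (2 * N) = (c / (2 * N) * r₀ ^ 2) ^ N / N / 2 := by
          rw [ha₀, mul_pow, ← pow_mul]; ring
      _ ≤ _ := by gcongr
  have herr2 : (K + 1) * 2 ^ d * Real.exp (-(r ^ 2 * (q ^ 4 / 2) ^ 2)) ≤
      a₀ / 2 * r₀ ^ (2 * N) := by
    have e1 : Real.exp (-(r ^ 2 * (q ^ 4 / 2) ^ 2)) ≤ Real.exp (-(q ^ 2 / 4)) := by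
      refine Real.exp_le_exp.2 (neg_le_neg ?_)
      calc q ^ 2 / 4 = (q ^ 6)⁻¹ * (q ^ 4 / 2) ^ 2 := by field_simp; ring
        _ ≤ r ^ 2 * (q ^ 4 / 2) ^ 2 := by gcongr
    have e2 : (K + 1) * 2 ^ d * Real.exp (-(q ^ 2 / 4)) ≤ a₀ / 2 * ((q ^ 3)⁻¹) ^ (2 * N) := by
      rw [inv_pow, ← div_eq_mul_inv, le_div_iff₀ (by positivity)]
      calc _ = (K + 1) * 2 ^ d * ((q ^ 3) ^ (2 * N) * Real.exp (-(q ^ 2 / 4))) := by ring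
        _ ≤ _ := herr.le
    calc _ ≤ (K + 1) * 2 ^ d * Real.exp (-(q ^ 2 / 4)) := by gcongr
      _ ≤ _ := e2
      _ ≤ _ := by gcongr
  linarith

/-- A member of the sieve inherits the lower bound of its last basis function. -/
lemma qLower_of_mem_sieveA {x : Fin n → EuclideanSpace ℝ (Fin d)} {m : ℕ}
    (hC : C ∈ sieveA m) {a : ℝ} (h : QLower a (covMatrix x (basisFn m m))) :
    QLower (C 0 * a) (covMatrix x C) := by
  obtain ⟨w, hw, hCw⟩ := hC
  have hk : ∀ k ∈ Finset.Icc 1 m, QLower a (covMatrix x (basisFn k m)) := by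
    intro k hk
    obtain ⟨hk1, hkm⟩ := Finset.mem_Icc.1 hk
    rcases hkm.eq_or_lt with rfl | hlt
    · exact h
    · obtain ⟨m', rfl⟩ : ∃ m', m = m' + 1 := ⟨m - 1, by omega⟩
      have h1 : covMatrix x (basisFn k (m' + 1)) = Matrix.hadamard
          (covMatrix x (basisFn (m' + 1) (m' + 1))) (covMatrix x (basisFn k m')) := by
        ext i j
        rw [Matrix.hadamard_apply, covMatrix_apply, covMatrix_apply, covMatrix_apply,
          basisFn_mul k m' (by omega)]
      rw [h1]
      exact h.hadamard (covMatrix_isSymm _ _)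
        (covMatrix_posSemidef x (basisFn_mem_classA hk1 (by omega)))
        fun i => by rw [covMatrix_apply, nndist_self, basisFn_zero]
  intro v
  have h0 : C 0 = ∑ k ∈ Finset.Icc 1 m, w k := by rw [hCw]; simp [basisFn_zero]
  have h2 : v ⬝ᵥ covMatrix x C *ᵥ v =
      ∑ k ∈ Finset.Icc 1 m, w k * (v ⬝ᵥ covMatrix x (basisFn k m) *ᵥ v) := by
    simp_rw [quadForm_eq_sum, covMatrix_apply, hCw, Finset.mul_sum]
    rw [Finset.sum_comm' (t' := Finset.univ) (s' := fun _ => Finset.Icc 1 m) (by simp)]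
    refine Finset.sum_congr rfl fun i _ => ?_
    rw [Finset.sum_comm]
    exact Finset.sum_congr rfl fun k _ => Finset.sum_congr rfl fun j _ => by ring
  rw [h2, h0, Finset.sum_mul, Finset.sum_mul]
  refine Finset.sum_le_sum fun k hk' => ?_
  rw [mul_assoc]
  exact mul_le_mul_of_nonneg_left (hk k hk' v) (hw k hk')

/-- The smallest eigenvalue of a covariance matrix in the sieve is at least
`exp (-(η / τ + D))`, where `τ` is the degeneracy of the spectral density. If `τ` is not small
compared to the resolution of the sieve, then a polynomial bound holds for every density of this
degeneracy; otherwise `τ` is so small that the bound for the last basis function suffices. -/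
lemma exists_sieve_lower (d : ℕ) {c K L U η : ℝ} (hc : 0 < c) (hc1 : c ≤ 1) (hK : 1 ≤ K)
    (hL : 0 < L) (hη : 0 < η) :
    ∃ D : ℝ, ∃ m₀ : ℕ, ∀ m ≥ m₀, ∀ (n : ℕ) (x : Fin n → EuclideanSpace ℝ (Fin d)),
      QLower c (covMatrix x (basisFn 1 1)) → QUpper (covMatrix x (basisFn m m)) K →
        ∀ (C : ℝ≥0 → ℝ) (f : ℝ → ℝ), IsDensity C f → C ∈ sieveA m → L ≤ C 0 → C 0 ≤ U →
          QLower (Real.exp (-(η / degen f + D))) (covMatrix x C) := by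
  obtain ⟨a, ha, N, Q, hQ2, hlow⟩ := exists_gaussMat_lower d hc hc1 hK
  rcases lt_or_ge U L with hUL | hLU
  · exact ⟨0, 0, fun m _ n x _ _ C f _ _ h1 h2 => absurd (h1.trans h2) (not_le.2 hUL)⟩
  have hU : 0 < U := hL.trans_le hLU
  set κ₁ : ℝ := η / (2 * U * (N + 1)) with hκ₁
  have hκ₁0 : 0 < κ₁ := by positivity
  set κ₂ : ℝ := η / (2 * U) with hκ₂
  have hκ₂0 : 0 < κ₂ := by positivity
  set M : ℝ := 1 + 3 * N with hM
  have hM0 : 0 < M := by positivity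
  set D₁ : ℝ := -Real.log (a * U) - (N + 1) * Real.log κ₁ with hD₁
  set D₂ : ℝ := -Real.log (L * a) + M * (M / κ₂) ^ 2 with hD₂
  refine ⟨max D₁ D₂, ⌈Q ^ 8⌉₊, fun m hm n x hx1 hxm C f hf hC hCL hCU => ?_⟩
  have hmQ : Q ^ 8 ≤ (m : ℝ) := (Nat.le_ceil _).trans (by exact_mod_cast hm)
  have hQ0 : 0 ≤ Q := by linarith
  have hm0 : (0 : ℝ) ≤ m := Nat.cast_nonneg m
  set q : ℝ := (m : ℝ) ^ ((8 : ℕ) : ℝ)⁻¹ with hq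
  have hqm : q ^ 8 = m := Real.rpow_inv_natCast_pow hm0 (by norm_num)
  have hqQ : Q ≤ q := by
    have hq0 : 0 ≤ q := Real.rpow_nonneg hm0 _
    exact (pow_le_pow_iff_left₀ hQ0 hq0 (by norm_num : (8 : ℕ) ≠ 0)).1 (by rwa [hqm])
  have hq2 : 2 ≤ q := hQ2.trans hqQ
  have hq0 : 0 < q := by linarith
  have hτ : 0 < degen f := hf.degen_pos (hL.trans_le hCL)
  have hτU : degen f ≤ U := hf.degen_le.trans hCU
  have hlow' := hlow q m hqQ hqm n x hx1 hxm
  set τ := degen f with hτd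
  rcases le_or_gt ((q ^ 3)⁻¹) (τ / (2 * U)) with hcase | hcase
  · set r₀ := τ / (2 * U) with hr₀
    have hr₀0 : 0 < r₀ := by positivity
    have hr₀1 : r₀ ≤ 1 := by rw [hr₀, div_le_one (by positivity)]; linarith
    have h1 := hf.qLower_covMatrix x hr₀0.le fun r hr =>
      hlow' r₀ r hr₀0 hcase hr₀1 (le_of_lt hr)
    refine h1.mono ?_
    have h2 := hf.half_degen_le_mass hU hCU
    rw [← hτd, ← hr₀] at h2
    have h3 : τ / 2 = U * r₀ := by rw [hr₀]; field_simp
    have h4 : Real.exp (-(η / τ + max D₁ D₂)) ≤ a * U * r₀ ^ (N + 1) := by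
      rw [← Real.exp_log (show 0 < a * U * r₀ ^ (N + 1) by positivity), Real.exp_le_exp,
        Real.log_mul (by positivity) (by positivity), Real.log_pow]
      have e1 := Real.log_le_sub_one_of_pos (show 0 < κ₁ * r₀⁻¹ by positivity)
      rw [Real.log_mul (by positivity) (by positivity), Real.log_inv] at e1
      have e2 : (N + 1) * (κ₁ * r₀⁻¹) = η / τ := by
        rw [hκ₁, hr₀]; field_simp
      have e3 := le_max_left D₁ D₂
      have e4 : (0 : ℝ) < N + 1 := by positivity
      have e5 := mul_le_mul_of_nonneg_left e1 e4.le
      have e6 : ((N : ℝ) + 1) * (κ₁ * r₀⁻¹ - 1) = η / τ - (N + 1) := by rw [mul_sub, e2, mul_one]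
      rw [e6] at e5
      push_cast
      linarith
    calc _ ≤ a * U * r₀ ^ (N + 1) := h4
      _ = (U * r₀) * (a * r₀ ^ N) := by ring
      _ ≤ _ := mul_le_mul_of_nonneg_right (by rw [← h3]; exact h2) (by positivity)
  · have hm1 : 1 ≤ m := Nat.one_le_iff_ne_zero.2 fun h => by
      rw [h, Nat.cast_zero] at hqm; exact absurd hqm (by positivity)
    have hq31 : (q ^ 3)⁻¹ ≤ 1 := inv_le_one_of_one_le₀ (one_le_pow₀ (by linarith))
    have h1 := (basisFn_self_isDensity hm1).qLower_covMatrix x (r₀ := (q ^ 3)⁻¹) (by positivity)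
      fun r hr => hlow' (q ^ 3)⁻¹ r (by positivity) le_rfl hq31 (le_of_lt hr)
    rw [basisFn_self_mass hm1 (by positivity)] at h1
    refine (qLower_of_mem_sieveA hC h1).mono ?_
    have h2 : (m : ℝ) * ((q ^ 3)⁻¹) ^ 2 = q ^ 2 := by
      rw [← hqm]; field_simp
    rw [h2]
    have h4 : Real.exp (-(η / τ + max D₁ D₂)) ≤
        L * a * (Real.exp (-q ^ 2) * ((q ^ 3)⁻¹) ^ N) := by
      rw [← Real.exp_log (show 0 < L * a * (Real.exp (-q ^ 2) * ((q ^ 3)⁻¹) ^ N) by positivity),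
        Real.exp_le_exp, Real.log_mul (by positivity) (by positivity),
        Real.log_mul (Real.exp_pos _).ne' (by positivity), Real.log_exp, Real.log_pow, Real.log_inv,
        Real.log_pow]
      have e1 := Real.log_le_sub_one_of_pos hq0
      have e3 := le_max_right D₁ D₂
      have e4 : Real.log q ≤ q ^ 2 := by nlinarith
      have e5 : M * q ^ 2 ≤ κ₂ * q ^ 3 + M * (M / κ₂) ^ 2 := by
        rcases le_total (M / κ₂) q with hh | hh
        · rw [div_le_iff₀ hκ₂0] at hh
          have : M * q ^ 2 ≤ (q * κ₂) * q ^ 2 := mul_le_mul_of_nonneg_right hh (sq_nonneg _)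
          have : 0 ≤ M * (M / κ₂) ^ 2 := by positivity
          nlinarith
        · have : M * q ^ 2 ≤ M * (M / κ₂) ^ 2 := by gcongr
          have : 0 ≤ κ₂ * q ^ 3 := by positivity
          linarith
      have e6 : κ₂ * q ^ 3 ≤ η / τ := by
        have hh : q ^ 3 ≤ 2 * U / τ := by
          rw [lt_inv_comm₀ (by positivity) (by positivity), inv_div] at hcase
          exact hcase.le
        calc κ₂ * q ^ 3 ≤ κ₂ * (2 * U / τ) := by gcongr
          _ = η / τ := by rw [hκ₂]; field_simp
      have e7 : (N : ℝ) * (3 * Real.log q) ≤ 3 * N * q ^ 2 := by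
        have := mul_le_mul_of_nonneg_left e4 (show (0 : ℝ) ≤ 3 * N by positivity)
        linarith
      push_cast
      have e8 : M * q ^ 2 = q ^ 2 + 3 * N * q ^ 2 := by rw [hM]; ring
      linarith
    calc _ ≤ L * a * (Real.exp (-q ^ 2) * ((q ^ 3)⁻¹) ^ N) := h4
      _ = L * (Real.exp (-q ^ 2) * (a * ((q ^ 3)⁻¹) ^ N)) := by ring
      _ ≤ _ := mul_le_mul_of_nonneg_right hCL (by positivity)

end

section

/-! ### Tail bounds -/

section Tail

variable {Ω : Type*} [MeasurableSpace Ω] {P : Measure Ω}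

lemma markov_le [IsFiniteMeasure P] {f : Ω → ℝ} (hf : ∀ ω, 0 ≤ f ω) (hi : Integrable f P)
    {ε b : ℝ} (hε : 0 < ε) (hb : ∫ ω, f ω ∂P ≤ b) :
    P {ω | ε ≤ f ω} ≤ ENNReal.ofReal (b / ε) := by
  have h1 := mul_meas_ge_le_integral_of_nonneg (ae_of_all P hf) hi ε
  have h2 : P.real {ω | ε ≤ f ω} ≤ b / ε := by
    rw [le_div_iff₀ hε, mul_comm]; exact h1.trans hb
  rw [← ENNReal.ofReal_toReal (measure_ne_top P _)]
  exact ENNReal.ofReal_le_ofReal h2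

lemma chebyshev_le [IsFiniteMeasure P] {f : Ω → ℝ} (hi : Integrable (fun ω => f ω ^ 2) P)
    {ε b : ℝ} (hε : 0 < ε) (hb : ∫ ω, f ω ^ 2 ∂P ≤ b) :
    P {ω | ε ≤ |f ω|} ≤ ENNReal.ofReal (b / ε ^ 2) := by
  refine le_trans (measure_mono fun ω hω => ?_)
    (markov_le (fun ω => sq_nonneg _) hi (sq_pos_of_pos hε) hb)
  have : ε ≤ |f ω| := hω
  change ε ^ 2 ≤ f ω ^ 2
  rw [← sq_abs (f ω)]
  exact pow_le_pow_left₀ hε.le this 2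

end Tail

/-! ### The Laplacian of the neighbourhood graph -/

variable {d n : ℕ}

/-- Adjacency matrix of the graph that joins sites at distance at most `R`; loops are included,
they do not affect the Laplacian. -/
noncomputable def nbrMat (x : Fin n → EuclideanSpace ℝ (Fin d)) (R : ℝ) :
    Matrix (Fin n) (Fin n) ℝ :=
  Matrix.of fun i j => if dist (x i) (x j) ≤ R then 1 else 0

/-- Laplacian of the graph that joins sites at distance at most `R`. -/
noncomputable def nbrLap (x : Fin n → EuclideanSpace ℝ (Fin d)) (R : ℝ) :
    Matrix (Fin n) (Fin n) ℝ :=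
  Matrix.diagonal (fun i => ∑ j, nbrMat x R i j) - nbrMat x R

section Laplacian

variable (x : Fin n → EuclideanSpace ℝ (Fin d)) (R : ℝ)

lemma nbrMat_nonneg (i j : Fin n) : 0 ≤ nbrMat x R i j := by
  simp only [nbrMat, Matrix.of_apply]; split_ifs <;> norm_num

lemma nbrMat_symm (i j : Fin n) : nbrMat x R i j = nbrMat x R j i := by
  simp only [nbrMat, Matrix.of_apply, dist_comm]

lemma quad_nbrLap (v : Fin n → ℝ) :
    v ⬝ᵥ nbrLap x R *ᵥ v = 1 / 2 * ∑ i, ∑ j, nbrMat x R i j * (v i - v j) ^ 2 := by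
  have h1 : v ⬝ᵥ nbrLap x R *ᵥ v =
      ∑ i, ∑ j, nbrMat x R i j * v i ^ 2 - ∑ i, ∑ j, v i * v j * nbrMat x R i j := by
    rw [nbrLap, Matrix.sub_mulVec, dotProduct_sub, quadForm_eq_sum (nbrMat x R)]
    congr 1
    simp only [dotProduct, Matrix.mulVec_diagonal, Finset.sum_mul, Finset.mul_sum]
    exact Finset.sum_congr rfl fun i _ => Finset.sum_congr rfl fun j _ => by ring
  have h2 : ∑ i, ∑ j, nbrMat x R i j * v j ^ 2 = ∑ i, ∑ j, nbrMat x R i j * v i ^ 2 := by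
    rw [Finset.sum_comm]
    exact Finset.sum_congr rfl fun i _ => Finset.sum_congr rfl fun j _ => by
      rw [nbrMat_symm]
  have h3 : ∑ i, ∑ j, nbrMat x R i j * (v i - v j) ^ 2 =
      ∑ i, ∑ j, nbrMat x R i j * v i ^ 2 + ∑ i, ∑ j, nbrMat x R i j * v j ^ 2 -
        2 * ∑ i, ∑ j, v i * v j * nbrMat x R i j := by
    simp only [Finset.mul_sum, ← Finset.sum_add_distrib, ← Finset.sum_sub_distrib]
    exact Finset.sum_congr rfl fun i _ => Finset.sum_congr rfl fun j _ => by ring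
  rw [h1, h3, h2]; ring

lemma nbrLap_isSymm : (nbrLap x R).IsSymm := by
  refine Matrix.IsSymm.ext fun i j => ?_
  simp only [nbrLap, Matrix.sub_apply, nbrMat_symm x R j i]
  congr 1
  rcases eq_or_ne i j with rfl | h
  · rfl
  · rw [Matrix.diagonal_apply_ne _ h, Matrix.diagonal_apply_ne _ h.symm]

lemma nbrLap_posSemidef : (nbrLap x R).PosSemidef := by
  rw [posSemidef_iff_real]
  refine ⟨nbrLap_isSymm x R, fun v => ?_⟩
  rw [quad_nbrLap]
  have := Finset.sum_nonneg fun i (_ : i ∈ Finset.univ) => Finset.sum_nonneg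
    fun j (_ : j ∈ Finset.univ) => mul_nonneg (nbrMat_nonneg x R i j) (sq_nonneg (v i - v j))
  positivity

variable {x R}

lemma nbrLap_qUpper {N : ℝ} (hN : ∀ i, ∑ j, nbrMat x R i j ≤ N) : QUpper (nbrLap x R) (2 * N) := by
  intro v
  have hp := (nbrLap_posSemidef x R).quad_nonneg v
  have h1 : v ⬝ᵥ nbrLap x R *ᵥ v ≤ 2 * ∑ i, ∑ j, nbrMat x R i j * v i ^ 2 := by
    rw [quad_nbrLap]
    have h2 : ∑ i, ∑ j, nbrMat x R i j * v j ^ 2 = ∑ i, ∑ j, nbrMat x R i j * v i ^ 2 := by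
      rw [Finset.sum_comm]
      exact Finset.sum_congr rfl fun i _ => Finset.sum_congr rfl fun j _ => by
        rw [nbrMat_symm]
    have h3 : ∑ i, ∑ j, nbrMat x R i j * (v i - v j) ^ 2 ≤
        2 * (∑ i, ∑ j, nbrMat x R i j * v i ^ 2 + ∑ i, ∑ j, nbrMat x R i j * v j ^ 2) := by
      simp only [Finset.mul_sum, ← Finset.sum_add_distrib]
      refine Finset.sum_le_sum fun i _ => Finset.sum_le_sum fun j _ => ?_
      nlinarith [nbrMat_nonneg x R i j, mul_nonneg (nbrMat_nonneg x R i j) (sq_nonneg (v i + v j))]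
    rw [h2] at h3
    linarith
  refine h1.trans ?_
  rw [mul_assoc]
  refine mul_le_mul_of_nonneg_left ?_ zero_le_two
  rw [dotProduct, Finset.mul_sum]
  refine Finset.sum_le_sum fun i _ => ?_
  rw [← Finset.sum_mul, ← sq]
  exact mul_le_mul_of_nonneg_right (hN i) (sq_nonneg _)

lemma trace_nbrLap : (nbrLap x R).trace =
    ∑ i, ∑ j, (if i = j then 0 else nbrMat x R i j) := by
  simp only [Matrix.trace, Matrix.diag, nbrLap, Matrix.sub_apply, Matrix.diagonal_apply_eq]
  refine Finset.sum_congr rfl fun i _ => ?_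
  rw [← Finset.add_sum_erase _ _ (Finset.mem_univ i),
    ← Finset.add_sum_erase _ (fun j => if i = j then 0 else nbrMat x R i j) (Finset.mem_univ i)]
  simp only [if_true, zero_add, add_sub_cancel_left]
  exact Finset.sum_congr rfl fun j hj => by rw [if_neg (Finset.ne_of_mem_erase hj).symm]

/-- The columns of the Laplacian are almost null vectors of the kernel matrices at low
frequencies. -/
lemma nbrLap_col_quad_le {N : ℝ} (hN : ∀ i, ∑ j, nbrMat x R i j ≤ N) {t : ℝ}
    (ht : 0 ≤ t) (i : Fin n) :
    (nbrLap x R *ᵥ Pi.single i 1) ⬝ᵥ gaussMat x t *ᵥ (nbrLap x R *ᵥ Pi.single i 1) ≤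
      N * (N * (2 * (t * R ^ 2))) := by
  classical
  set J := Finset.univ.filter fun j => dist (x i) (x j) ≤ R with hJ
  have hcard : (J.card : ℝ) ≤ N := by
    refine le_trans (le_of_eq ?_) (hN i)
    simp only [nbrMat, Matrix.of_apply]
    rw [hJ, Finset.sum_boole]
  have hcol : nbrLap x R *ᵥ Pi.single i 1 =
      ∑ j ∈ J, (Pi.single i (1 : ℝ) - Pi.single j 1) := by
    ext k
    rw [Matrix.mulVec_single_one, Matrix.col_apply, nbrLap, Matrix.sub_apply, Finset.sum_apply]
    simp only [Pi.sub_apply, Finset.sum_sub_distrib, Matrix.diagonal_apply]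
    congr 1
    · rcases eq_or_ne k i with rfl | hki
      · simp [nbrMat, hJ]
      · simp [hki]
    · simp [nbrMat, hJ, Pi.single_apply, dist_comm]
  rw [hcol]
  have hG := gaussMat_posSemidef x ht
  have hN0 : 0 ≤ N := (Nat.cast_nonneg _).trans hcard
  refine (hG.quad_sum_le J _).trans ?_
  have hterm : ∀ j ∈ J, (Pi.single i (1 : ℝ) - Pi.single j 1) ⬝ᵥ gaussMat x t *ᵥ
      (Pi.single i (1 : ℝ) - Pi.single j 1) ≤ 2 * (t * R ^ 2) := by
    intro j hj
    have hd : dist (x i) (x j) ≤ R := (Finset.mem_filter.1 hj).2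
    rw [sub_eq_add_neg, quad_add (gaussMat_isSymm _ _)]
    simp only [Matrix.mulVec_neg, dotProduct_neg, neg_dotProduct, Matrix.mulVec_single_one,
      single_one_dotProduct, Matrix.col_apply, gaussMat_diag, neg_neg]
    rw [gaussMat_apply]
    have h1 := Real.add_one_le_exp (-(t * dist (x i) (x j) ^ 2))
    have h2 : t * dist (x i) (x j) ^ 2 ≤ t * R ^ 2 := by
      have := dist_nonneg (x := x i) (y := x j)
      gcongr
    linarith
  have hsum : ∑ j ∈ J, (Pi.single i (1 : ℝ) - Pi.single j 1) ⬝ᵥ gaussMat x t *ᵥ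
      (Pi.single i (1 : ℝ) - Pi.single j 1) ≤ N * (2 * (t * R ^ 2)) := by
    refine (Finset.sum_le_card_nsmul _ _ _ hterm).trans ?_
    rw [nsmul_eq_mul]
    exact mul_le_mul_of_nonneg_right hcard (by positivity)
  calc _ ≤ (J.card : ℝ) * (N * (2 * (t * R ^ 2))) :=
        mul_le_mul_of_nonneg_left hsum (Nat.cast_nonneg _)
    _ ≤ _ := mul_le_mul_of_nonneg_right hcard (by positivity)

lemma trace_eq_sum_single {ι : Type*} [Fintype ι] [DecidableEq ι] (A : Matrix ι ι ℝ) :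
    A.trace = ∑ i, Pi.single i (1 : ℝ) ⬝ᵥ A *ᵥ Pi.single i 1 := by
  simp [Matrix.trace]

variable {Ω : Type*} [MeasurableSpace Ω] {P : Measure Ω} {S : Matrix (Fin n) (Fin n) ℝ}
  {Z : Ω → Fin n → ℝ}

lemma integral_nbrLap_quad_le (hZ : IsCenteredGauss P S Z) {K : ℝ} (hK : 0 ≤ K)
    (hS : QUpper S K) {N : ℝ} (hN : ∀ i, ∑ j, nbrMat x R i j ≤ N) {t : ℝ}
    (ht : 0 ≤ t) :
    ∫ ω, (nbrLap x R *ᵥ Z ω) ⬝ᵥ gaussMat x t *ᵥ (nbrLap x R *ᵥ Z ω) ∂P ≤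
      K * (n * (N * (N * (2 * (t * R ^ 2))))) := by
  have hL := nbrLap_isSymm x R
  have h1 : ∀ ω, (nbrLap x R *ᵥ Z ω) ⬝ᵥ gaussMat x t *ᵥ (nbrLap x R *ᵥ Z ω) =
      Z ω ⬝ᵥ (nbrLap x R * gaussMat x t * nbrLap x R) *ᵥ Z ω := fun ω =>
    (quad_conj _ hL _).symm
  simp_rw [h1]
  rw [hZ.integral_quad, Matrix.trace_mul_comm]
  refine (trace_mul_le hZ.cov_symm hS ((gaussMat_posSemidef x ht).conj hL)).trans
    (mul_le_mul_of_nonneg_left ?_ hK)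
  rw [trace_eq_sum_single]
  calc _ ≤ ∑ _i : Fin n, N * (N * (2 * (t * R ^ 2))) := Finset.sum_le_sum fun i _ => by
        rw [quad_conj _ hL]; exact nbrLap_col_quad_le hN ht i
    _ = _ := by simp

end Laplacian

end

section

/-! ### Nearly degenerate covariance functions have a large residual form -/

variable {d n p : ℕ}

lemma sum_covMatrix_le {x : Fin n → EuclideanSpace ℝ (Fin d)} {C : ℝ≥0 → ℝ} {K : ℝ}
    (h : QUpper (covMatrix x C) K) : ∑ i, ∑ j, C (nndist (x i) (x j)) ≤ K * n := by
  have := h 1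
  rw [quadForm_eq_sum] at this
  simpa [covMatrix_apply, dotProduct] using this

/-- If two covariance functions with the same value at the origin are separated by the design, then
a positive proportion of the sites has a close neighbour. -/
lemma exists_nbr_lower {C₀ C₁ : ℝ≥0 → ℝ} (h₀ : C₀ ∈ classA) (h₁ : C₁ ∈ classA) (h01 : C₁ 0 = C₀ 0)
    {K K₁ b : ℝ} (hK : 0 ≤ K) (hK₁ : 0 ≤ K₁) (hb : 0 < b) :
    ∃ R : ℝ, ∃ e : ℝ, 0 < e ∧ ∀ (n : ℕ) (x : Fin n → EuclideanSpace ℝ (Fin d)),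
      QUpper (covMatrix x C₀) K → QUpper (covMatrix x C₁) K₁ → b ≤ covDiscrepancy x C₁ C₀ →
        e * n ≤ (nbrLap x R).trace := by
  obtain ⟨f, hf⟩ := exists_density h₀
  obtain ⟨g, hg⟩ := exists_density h₁
  set η : ℝ := b / (2 * (K + K₁ + 1)) with hη
  have hη0 : 0 < η := by positivity
  have hlim : Tendsto (fun h => C₀ h + C₁ h) atTop (𝓝 0) := by
    simpa using hf.tendsto_atTop.add hg.tendsto_atTop
  obtain ⟨R, hR⟩ := (hlim.eventually (gt_mem_nhds hη0)).exists
  set B := C₀ 0 with hB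
  have hB0 : 0 ≤ B := hf.apply_nonneg 0
  refine ⟨R, b / (2 * (B ^ 2 + 1)), by positivity, fun n x hu0 hu1 hdisc => ?_⟩
  rcases Nat.eq_zero_or_pos n with rfl | hn
  · simp [Matrix.trace]
  have hn0 : (0 : ℝ) < n := by exact_mod_cast hn
  have hpt : ∀ i j, (C₁ (nndist (x i) (x j)) - C₀ (nndist (x i) (x j))) ^ 2 ≤
      B ^ 2 * (if i = j then 0 else nbrMat x R i j) +
        η * (C₀ (nndist (x i) (x j)) + C₁ (nndist (x i) (x j))) := by
    intro i j
    set h := nndist (x i) (x j) with hh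
    have a0 := hf.apply_nonneg h
    have a1 := hg.apply_nonneg h
    have b0 : C₀ h ≤ B := hf.antitone zero_le
    have b1 : C₁ h ≤ B := h01 ▸ hg.antitone zero_le
    rcases eq_or_ne i j with rfl | hij
    · rw [hh, nndist_self, h01, sub_self]
      simp only [if_true, mul_zero, zero_add]
      have : 0 ≤ η * (C₀ 0 + C₀ 0) := by positivity
      simpa [hB] using this
    · rw [if_neg hij]
      have c0 : 0 ≤ η * (C₀ h + C₁ h) := by positivity
      by_cases hle : dist (x i) (x j) ≤ R
      · have : nbrMat x R i j = 1 := by rw [nbrMat, Matrix.of_apply, if_pos hle]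
        rw [this]
        nlinarith
      · have : nbrMat x R i j = 0 := by rw [nbrMat, Matrix.of_apply, if_neg hle]
        rw [this]
        have hRh : R ≤ h := by
          rw [← NNReal.coe_le_coe, hh, coe_nndist]; exact (not_le.1 hle).le
        have d0 := hf.antitone hRh
        have d1 := hg.antitone hRh
        have e1 : C₀ h + C₁ h ≤ η := by linarith
        nlinarith
  have hsum : ∑ i, ∑ j, (C₁ (nndist (x i) (x j)) - C₀ (nndist (x i) (x j))) ^ 2 ≤
      B ^ 2 * (nbrLap x R).trace + η * (K * n + K₁ * n) := by
    have e0 := sum_covMatrix_le hu0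
    have e1 := sum_covMatrix_le hu1
    calc _ ≤ ∑ i, ∑ j, (B ^ 2 * (if i = j then 0 else nbrMat x R i j) +
          η * (C₀ (nndist (x i) (x j)) + C₁ (nndist (x i) (x j)))) :=
          Finset.sum_le_sum fun i _ => Finset.sum_le_sum fun j _ => hpt i j
      _ = B ^ 2 * (nbrLap x R).trace + η * (∑ i, ∑ j, C₀ (nndist (x i) (x j)) +
          ∑ i, ∑ j, C₁ (nndist (x i) (x j))) := by
          simp only [Finset.sum_add_distrib, ← Finset.mul_sum, trace_nbrLap]
      _ ≤ _ := by gcongr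
  have htr : 0 ≤ (nbrLap x R).trace := (nbrLap_posSemidef x R).trace_nonneg
  rw [covDiscrepancy, one_div, ← div_eq_inv_mul, le_div_iff₀ hn0] at hdisc
  have h5 : η * (K * n + K₁ * n) ≤ b / 2 * n := by
    have : η * (K + K₁) ≤ b / 2 := by
      rw [hη, div_mul_eq_mul_div, div_le_div_iff₀ (by positivity) (by norm_num)]
      nlinarith
    nlinarith
  have h6 : b / 2 * n ≤ (B ^ 2 + 1) * (nbrLap x R).trace := by nlinarith
  rw [div_mul_eq_mul_div, div_le_iff₀ (by positivity)]
  linarith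

lemma trace_mul_ge {A B : Matrix (Fin n) (Fin n) ℝ} (hA : A.IsSymm) {c : ℝ} (h : QLower c A)
    (hB : B.PosSemidef) : c * B.trace ≤ (A * B).trace := by
  have h1 : QUpper (-A) (-c) := fun v => by
    rw [Matrix.neg_mulVec, dotProduct_neg]; linarith [h v]
  have h2 := trace_mul_le hA.neg h1 hB
  rw [Matrix.neg_mul, Matrix.trace_neg] at h2
  linarith

/-- A bound for the kernel forms at dyadic frequencies extends to all frequencies. -/
lemma quad_gaussMat_le_of_dyadic {x : Fin n → EuclideanSpace ℝ (Fin d)} {v : Fin n → ℝ} {H : ℝ}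
    (hH : 0 ≤ H)
    (hv : ∀ l : ℕ, v ⬝ᵥ gaussMat x ((1 / 4) ^ l) *ᵥ v ≤ H * (1 / 2) ^ l) {r : ℝ} (hr : 0 < r)
    (hr1 : r ≤ 1) : v ⬝ᵥ gaussMat x (r ^ 2) *ᵥ v ≤ 2 ^ d * (2 * H) * r := by
  obtain ⟨l, hl1, hl2⟩ := exists_nat_pow_near_of_lt_one hr hr1
    (by norm_num : (0 : ℝ) < 1 / 2) (by norm_num : (1 / 2 : ℝ) < 1)
  have e : ((1 / 4 : ℝ)) ^ l = ((1 / 2) ^ l) ^ 2 := by rw [← pow_mul, mul_comm l, pow_mul]; norm_num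
  have hp : (0 : ℝ) < (1 / 2) ^ l := by positivity
  have h1 := gaussMat_quad_le x (s := r ^ 2) (t := (1 / 4) ^ l) (by positivity)
    (by rw [e]; gcongr) (by rw [e]; rw [pow_succ] at hl1; nlinarith) v
  refine h1.trans ?_
  rw [mul_assoc]
  refine mul_le_mul_of_nonneg_left ((hv l).trans ?_) (by positivity)
  rw [pow_succ] at hl1
  nlinarith

variable {Ω : Type*} [MeasurableSpace Ω] {P : Measure Ω}

set_option maxHeartbeats 1000000 in
/-- With high probability, the residual quadratic form at a covariance function is at least of the
order `n / τ` in terms of the degeneracy `τ`. The witness is the vector `L Z`, where `L` is the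
Laplacian of the neighbourhood graph: it correlates with `Z` but is nearly orthogonal to the
eigenvectors of the kernel matrices at low frequencies. -/
lemma exists_degenerate_bound (d p : ℕ) {c K B e R ζ : ℝ} (hc : 0 < c) (hK : 1 ≤ K) (hB : 0 ≤ B)
    (he : 0 < e) (hζ : 0 < ζ) :
    ∃ a : ℝ, 0 < a ∧ ∃ n₀ : ℕ, ∀ n ≥ n₀, ∀ (x : Fin n → EuclideanSpace ℝ (Fin d))
      (X : Matrix (Fin n) (Fin p) ℝ) (C₀ : ℝ≥0 → ℝ) (Z : Ω → Fin n → ℝ),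
      QLower c (covMatrix x C₀) → QUpper (covMatrix x C₀) K → QUpper (covMatrix x (basisFn 1 1)) K →
      QUpper (Xᵀ * X) (n * K) → e * n ≤ (nbrLap x R).trace →
      IsCenteredGauss P (covMatrix x C₀) Z →
      ∃ bad : Set Ω, P bad ≤ ENNReal.ofReal ζ ∧ ∀ ω ∉ bad, ∀ (C : ℝ≥0 → ℝ) (f : ℝ → ℝ),
        IsDensity C f → 0 < C 0 → (covMatrix x C).PosDef → ∀ δ : Fin p → ℝ, (∀ k, |δ k| ≤ B) →
          a * n / degen f ≤ (Z ω + X *ᵥ δ) ⬝ᵥ (covMatrix x C)⁻¹ *ᵥ (Z ω + X *ᵥ δ) := by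
  set N : ℝ := (K * (1 + R ^ 2)) ^ 2 with hN
  have hN0 : 0 < N := by positivity
  set V : ℝ := K * (N * (N * (2 * R ^ 2))) + 1 with hV
  have hV0 : 0 < V := by positivity
  set H : ℝ := 8 * V / ζ with hH
  have hH0 : 0 < H := by positivity
  set Hz : ℝ := 4 * K / ζ with hHz
  have hHz0 : 0 < Hz := by positivity
  set H' : ℝ := 2 ^ d * (2 * H) + K * ((2 * N) ^ 2 * Hz) with hH'
  have hH'0 : 0 < H' := by positivity
  set ε₁ : ℝ := c * e / 2 with hε₁
  have hε₁0 : 0 < ε₁ := by positivity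
  set ε₂ : ℝ := ε₁ / (2 * (p + 1) * (B + 1)) with hε₂
  have hε₂0 : 0 < ε₂ := by positivity
  set V₁ : ℝ := gaussFourth * (K * (2 * N)) ^ 2 / ε₁ ^ 2 with hV₁
  have hV₁0 : 0 ≤ V₁ := by have := gaussFourth_nonneg; positivity
  set V₂ : ℝ := (p + 1) * (K * ((2 * N) ^ 2 * K)) / ε₂ ^ 2 with hV₂
  have hV₂0 : 0 ≤ V₂ := by positivity
  refine ⟨(ε₁ / 2) ^ 2 / H', by positivity, ⌈4 * (V₁ + V₂) / ζ⌉₊ + 1, ?_⟩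
  intro n hn x X C₀ Z hlow hup hbase hX htr hZ
  have hP := hZ.isProbabilityMeasure
  have hn1 : 1 ≤ n := by omega
  have hn0 : (0 : ℝ) < n := by exact_mod_cast hn1
  have hnV : 4 * (V₁ + V₂) ≤ ζ * n := by
    have h1 : (⌈4 * (V₁ + V₂) / ζ⌉₊ : ℝ) ≤ n := by exact_mod_cast (by omega)
    have h2 := (Nat.le_ceil (4 * (V₁ + V₂) / ζ)).trans h1
    rw [div_le_iff₀ hζ] at h2
    linarith
  have hK0 : 0 ≤ K := by linarith
  set S := covMatrix x C₀ with hS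
  have hSP : S.PosDef := hlow.posDef hc (covMatrix_isSymm _ _)
  set Lp := nbrLap x R with hLp
  have hLsymm : Lp.IsSymm := nbrLap_isSymm x R
  have hLpsd : Lp.PosSemidef := nbrLap_posSemidef x R
  have hNi : ∀ i, ∑ j, nbrMat x R i j ≤ N := fun i => by
    have h1 := count_le_of_qUpper le_rfl hK0 hbase R i
    simp only [nbrMat, Matrix.of_apply]
    rw [Finset.sum_boole]
    simpa using h1
  have hLu : QUpper Lp (2 * N) := nbrLap_qUpper hNi
  have hLsq : ∀ v, (Lp *ᵥ v) ⬝ᵥ (Lp *ᵥ v) ≤ (2 * N) ^ 2 * (v ⬝ᵥ v) := fun v =>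
    hLpsd.mulVec_sq_le (by positivity) hLu v
  -- the exceptional events
  set A₁ : ℕ → Set Ω := fun l => {ω | H * n * (1 / 2) ^ l ≤
    (Lp *ᵥ Z ω) ⬝ᵥ gaussMat x ((1 / 4) ^ l) *ᵥ (Lp *ᵥ Z ω)} with hA₁
  set A₂ : Set Ω := {ω | Hz * n ≤ Z ω ⬝ᵥ Z ω} with hA₂
  set A₃ : Set Ω := {ω | ε₁ * n ≤ |Z ω ⬝ᵥ Lp *ᵥ Z ω - (Lp * S).trace|} with hA₃
  set A₄ : Fin p → Set Ω := fun k => {ω | ε₂ * n ≤ |(Lp *ᵥ Xᵀ k) ⬝ᵥ Z ω|} with hA₄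
  have hP₁ : P (⋃ l, A₁ l) ≤ ENNReal.ofReal (ζ / 4) := by
    have hl : ∀ l, P (A₁ l) ≤ ENNReal.ofReal (ζ / 8 * (1 / 2) ^ l) := fun l => by
      have h1 := integral_nbrLap_quad_le hZ hK0 hup hNi (t := (1 / 4) ^ l) (by positivity)
      have hi : Integrable (fun ω => (Lp *ᵥ Z ω) ⬝ᵥ gaussMat x ((1 / 4) ^ l) *ᵥ (Lp *ᵥ Z ω)) P := by
        have h2 := hZ.integrable_quad (Lp * gaussMat x ((1 / 4) ^ l) * Lp)
        simpa only [quad_conj _ hLsymm] using h2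
      refine (markov_le (fun ω => (gaussMat_posSemidef x (by positivity)).quad_nonneg _) hi
        (by positivity) h1).trans (ENNReal.ofReal_le_ofReal ?_)
      rw [div_le_iff₀ (by positivity)]
      have e4 : ((1 / 4 : ℝ)) ^ l = (1 / 2) ^ l * (1 / 2) ^ l := by rw [← mul_pow]; norm_num
      have e5 : ζ / 8 * (1 / 2) ^ l * (H * n * (1 / 2) ^ l) = V * n * (1 / 4) ^ l := by
        rw [hH, e4]; field_simp
      rw [e5]
      have e6 : K * (n * (N * (N * (2 * ((1 / 4) ^ l * R ^ 2))))) =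
          (V - 1) * n * (1 / 4) ^ l := by rw [hV]; ring
      rw [e6]
      gcongr
      linarith
    refine (measure_iUnion_le A₁).trans ((ENNReal.tsum_le_tsum hl).trans (le_of_eq ?_))
    rw [← ENNReal.ofReal_tsum_of_nonneg (fun l => by positivity)
      (summable_geometric_two.mul_left _), tsum_mul_left, tsum_geometric_two]
    congr 1; ring
  have hP₂ : P A₂ ≤ ENNReal.ofReal (ζ / 4) := by
    have hi : Integrable (fun ω => Z ω ⬝ᵥ Z ω) P := by
      simpa using hZ.integrable_quad 1
    have hI : ∫ ω, Z ω ⬝ᵥ Z ω ∂P ≤ K * n := by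
      have h1 := hZ.integral_quad 1
      simp only [Matrix.one_mulVec, one_mul] at h1
      rw [h1, Matrix.trace]
      calc _ ≤ ∑ _i : Fin n, K := Finset.sum_le_sum fun i _ => diag_le_of_qUpper hup i
        _ = K * n := by simp [mul_comm]
    refine (markov_le (fun ω => dotProduct_self_nonneg' _) hi (by positivity) hI).trans
      (ENNReal.ofReal_le_ofReal (le_of_eq ?_))
    rw [hHz]; field_simp
  have hP₃ : P A₃ ≤ ENNReal.ofReal (V₁ / n) := by
    obtain ⟨hi, hI⟩ := hZ.quad_variance hSP hK0 hup hLpsd (by positivity) hLu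
    refine (chebyshev_le hi (by positivity) hI).trans (ENNReal.ofReal_le_ofReal (le_of_eq ?_))
    rw [hV₁, Fintype.card_fin]; field_simp
  have hP₄ : P (⋃ k, A₄ k) ≤ ENNReal.ofReal (V₂ / n) := by
    have hl : ∀ k, P (A₄ k) ≤ ENNReal.ofReal ((K * ((2 * N) ^ 2 * K)) / ε₂ ^ 2 / n) := fun k => by
      have hI : ∫ ω, ((Lp *ᵥ Xᵀ k) ⬝ᵥ Z ω) ^ 2 ∂P ≤ K * ((2 * N) ^ 2 * (n * K)) := by
        rw [hZ.integral_dotProduct_sq]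
        refine (hup _).trans (mul_le_mul_of_nonneg_left ((hLsq _).trans
          (mul_le_mul_of_nonneg_left ?_ (by positivity))) hK0)
        have := diag_le_of_qUpper hX k
        simpa [Matrix.mul_apply, dotProduct] using this
      refine (chebyshev_le (hZ.integrable_dotProduct_sq _) (by positivity) hI).trans
        (ENNReal.ofReal_le_ofReal (le_of_eq ?_))
      field_simp
    refine (measure_iUnion_le A₄).trans ((ENNReal.tsum_le_tsum hl).trans ?_)
    rw [tsum_fintype, Finset.sum_const, nsmul_eq_mul, Finset.card_univ, Fintype.card_fin,
      ← ENNReal.ofReal_natCast, ← ENNReal.ofReal_mul (by positivity)]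
    refine ENNReal.ofReal_le_ofReal ?_
    have e : V₂ / n = (p + 1) * (K * ((2 * N) ^ 2 * K) / ε₂ ^ 2 / n) := by rw [hV₂]; ring
    rw [e]
    gcongr
    linarith
  refine ⟨(⋃ l, A₁ l) ∪ A₂ ∪ A₃ ∪ ⋃ k, A₄ k, ?_, ?_⟩
  · calc _ ≤ ENNReal.ofReal (ζ / 4) + ENNReal.ofReal (ζ / 4) + ENNReal.ofReal (V₁ / n) +
          ENNReal.ofReal (V₂ / n) := by
          refine (measure_union_le _ _).trans (add_le_add ((measure_union_le _ _).trans
            (add_le_add ((measure_union_le _ _).trans (add_le_add hP₁ hP₂)) hP₃)) hP₄)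
      _ = ENNReal.ofReal (ζ / 4 + ζ / 4 + V₁ / n + V₂ / n) := by
          rw [← ENNReal.ofReal_add (by positivity) (by positivity),
            ← ENNReal.ofReal_add (by positivity) (by positivity),
            ← ENNReal.ofReal_add (by positivity) (by positivity)]
      _ ≤ _ := by
          refine ENNReal.ofReal_le_ofReal ?_
          have : V₁ / n + V₂ / n ≤ ζ / 4 := by
            rw [← add_div, div_le_iff₀ hn0]; linarith
          linarith
  intro ω hω C f hf hC0 hCP δ hδ
  simp only [Set.mem_union, Set.mem_iUnion, not_or, not_exists] at hω
  obtain ⟨⟨⟨h1, h2⟩, h3⟩, h4⟩ := hω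
  have h1' : ∀ l, (Lp *ᵥ Z ω) ⬝ᵥ gaussMat x ((1 / 4) ^ l) *ᵥ (Lp *ᵥ Z ω) ≤ H * n * (1 / 2) ^ l :=
    fun l => (not_le.1 (h1 l)).le
  have h2' : Z ω ⬝ᵥ Z ω < Hz * n := not_le.1 h2
  have h3' : |Z ω ⬝ᵥ Lp *ᵥ Z ω - (Lp * S).trace| < ε₁ * n := not_le.1 h3
  have h4' : ∀ k, |(Lp *ᵥ Xᵀ k) ⬝ᵥ Z ω| < ε₂ * n := fun k => not_le.1 (h4 k)
  set v := Lp *ᵥ Z ω with hv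
  have hvr : ∀ r ∈ Set.Ioi (0 : ℝ), v ⬝ᵥ gaussMat x (r ^ 2) *ᵥ v ≤ H' * n * min 1 r := by
    intro r hr
    have hr0 : 0 < r := hr
    rcases le_total r 1 with hr1 | hr1
    · rw [min_eq_right hr1]
      refine (quad_gaussMat_le_of_dyadic (by positivity) h1' hr0 hr1).trans ?_
      have : 2 ^ d * (2 * (H * n)) = 2 ^ d * (2 * H) * n := by ring
      rw [this, hH']
      gcongr
      have : 0 ≤ K * ((2 * N) ^ 2 * Hz) := by positivity
      linarith
    · rw [min_eq_left hr1, mul_one]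
      have e1 := qUpper_gaussMat le_rfl hbase (t := r ^ 2) (by rw [Nat.cast_one, div_one]; exact one_le_pow₀ hr1) v
      have e2 := hLsq (Z ω)
      rw [← hv] at e2
      have e3 : (2 * N) ^ 2 * (Z ω ⬝ᵥ Z ω) ≤ (2 * N) ^ 2 * (Hz * n) := by gcongr
      calc _ ≤ K * (v ⬝ᵥ v) := e1
        _ ≤ K * ((2 * N) ^ 2 * (Hz * n)) := by gcongr; exact e2.trans e3
        _ = K * ((2 * N) ^ 2 * Hz) * n := by ring
        _ ≤ H' * n := by
          gcongr
          rw [hH']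
          have : 0 ≤ 2 ^ d * (2 * H) := by positivity
          linarith
  have hvS : v ⬝ᵥ covMatrix x C *ᵥ v ≤ H' * n * degen f := by
    rw [hf.quad_covMatrix, degen, ← integral_const_mul]
    refine setIntegral_mono_on (hf.integrable_quad x v) (hf.integrable_degen.const_mul _)
      measurableSet_Ioi fun r hr => ?_
    rw [← mul_assoc]
    exact mul_le_mul_of_nonneg_right (hvr r hr) (hf.nonneg r hr)
  have hve : ε₁ / 2 * n ≤ v ⬝ᵥ (Z ω + X *ᵥ δ) := by
    rw [dotProduct_add]
    have e1 : ε₁ * n ≤ v ⬝ᵥ Z ω := by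
      have f1 := trace_mul_ge (covMatrix_isSymm x C₀) hlow hLpsd
      rw [Matrix.trace_mul_comm] at f1
      have f2 := abs_lt.1 h3'
      have f3 : v ⬝ᵥ Z ω = Z ω ⬝ᵥ Lp *ᵥ Z ω := dotProduct_comm _ _
      have f4 : c * (e * n) ≤ c * Lp.trace := by gcongr
      have f5 : c * (e * n) = 2 * (ε₁ * n) := by rw [hε₁]; ring
      rw [f3]
      linarith [f2.1]
    have e2 : |v ⬝ᵥ X *ᵥ δ| ≤ ε₁ / 2 * n := by
      have f1 : v ⬝ᵥ X *ᵥ δ = ∑ k, δ k * ((Lp *ᵥ Xᵀ k) ⬝ᵥ Z ω) := by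
        have g1 : ∀ k, (Lp *ᵥ Xᵀ k) ⬝ᵥ Z ω = Xᵀ k ⬝ᵥ v := fun k => by
          rw [hv, dotProduct_comm, dotProduct_mulVec_comm hLsymm]
        simp_rw [g1]
        rw [Matrix.dotProduct_mulVec, dotProduct_comm]
        simp only [dotProduct, Matrix.vecMul, Matrix.transpose_apply]
        exact Finset.sum_congr rfl fun k _ => by
          congr 1; exact Finset.sum_congr rfl fun i _ => mul_comm _ _
      rw [f1]
      refine (Finset.abs_sum_le_sum_abs _ _).trans ?_
      calc ∑ k, |δ k * ((Lp *ᵥ Xᵀ k) ⬝ᵥ Z ω)| ≤ ∑ _k : Fin p, B * (ε₂ * n) :=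
            Finset.sum_le_sum fun k _ => by
              rw [abs_mul]
              exact mul_le_mul (hδ k) (h4' k).le (abs_nonneg _) hB
        _ = p * B * ε₂ * n := by simp; ring
        _ ≤ (p + 1) * (B + 1) * ε₂ * n := by gcongr <;> linarith
        _ = ε₁ / 2 * n := by rw [hε₂]; field_simp
    linarith [abs_le.1 e2]
  have hτ : 0 < degen f := hf.degen_pos hC0
  set Q := (Z ω + X *ᵥ δ) ⬝ᵥ (covMatrix x C)⁻¹ *ᵥ (Z ω + X *ᵥ δ) with hQ
  have hQ0 : 0 ≤ Q := hCP.inv.posSemidef.quad_nonneg _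
  have hfin := sq_dotProduct_le_mul_inv hCP v (Z ω + X *ᵥ δ)
  rw [← hQ] at hfin
  have g1 : (ε₁ / 2 * n) ^ 2 ≤ H' * n * degen f * Q :=
    (pow_le_pow_left₀ (by positivity) hve 2).trans
      (hfin.trans (mul_le_mul_of_nonneg_right hvS hQ0))
  rw [div_le_iff₀ hτ, div_mul_eq_mul_div, div_le_iff₀ hH'0]
  have g2 : (ε₁ / 2) ^ 2 * n * n ≤ (Q * degen f * H') * n :=
    calc (ε₁ / 2) ^ 2 * n * n = (ε₁ / 2 * n) ^ 2 := by ring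
      _ ≤ H' * n * degen f * Q := g1
      _ = _ := by ring
  exact le_of_mul_le_mul_right g2 hn0

end

section

/-! ### A uniform law over the basis of the sieve -/

/-- A bounded monotone sequence of arbitrary finite length can be covered by boundedly many order
intervals on which it increases by at most `ε`. -/
lemma exists_brackets {Fb ε : ℝ} (hFb : 0 ≤ Fb) (hε : 0 < ε) :
    ∃ M : ℕ, (M : ℝ) ≤ Fb / ε + 1 ∧ ∀ (m : ℕ) (F : ℕ → ℝ), 1 ≤ m →
      (∀ k k', 1 ≤ k → k ≤ k' → k' ≤ m → F k ≤ F k') →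
      (∀ k ∈ Finset.Icc 1 m, 0 ≤ F k ∧ F k ≤ Fb) →
      ∃ (lo hi : Fin M → ℕ) (cell : ℕ → Fin M),
        (∀ c, 1 ≤ lo c ∧ lo c ≤ hi c ∧ hi c ≤ m ∧ F (hi c) - F (lo c) ≤ ε) ∧
        ∀ k ∈ Finset.Icc 1 m, lo (cell k) ≤ k ∧ k ≤ hi (cell k) := by
  classical
  refine ⟨⌊Fb / ε⌋₊ + 1, ?_, fun m F hm hmono hF => ?_⟩
  · push_cast
    linarith [Nat.floor_le (div_nonneg hFb hε.le)]
  set M := ⌊Fb / ε⌋₊ with hM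
  set cell : ℕ → Fin (M + 1) := fun k => ⟨min ⌊F k / ε⌋₊ M, by omega⟩ with hcell
  set T : Fin (M + 1) → Finset ℕ := fun c => (Finset.Icc 1 m).filter fun k => cell k = c with hT
  have hcellval : ∀ k ∈ Finset.Icc 1 m, (cell k : ℕ) = ⌊F k / ε⌋₊ := fun k hk => by
    simp only [hcell]
    exact min_eq_left (Nat.floor_le_floor (by have := (hF k hk).2; gcongr))
  have key : ∀ c, ∃ lo hi : ℕ, (1 ≤ lo ∧ lo ≤ hi ∧ hi ≤ m ∧ F hi - F lo ≤ ε) ∧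
      ∀ k ∈ T c, lo ≤ k ∧ k ≤ hi := by
    intro c
    rcases (T c).eq_empty_or_nonempty with he | hne
    · exact ⟨1, 1, ⟨le_rfl, le_rfl, hm, by simpa using hε.le⟩, by simp [he]⟩
    · have h1 := (T c).min'_mem hne
      have h2 := (T c).max'_mem hne
      refine ⟨(T c).min' hne, (T c).max' hne, ⟨?_, Finset.min'_le_max' _ _, ?_, ?_⟩,
        fun k hk => ⟨Finset.min'_le _ _ hk, Finset.le_max' _ _ hk⟩⟩
      · exact (Finset.mem_Icc.1 (Finset.mem_filter.1 h1).1).1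
      · exact (Finset.mem_Icc.1 (Finset.mem_filter.1 h2).1).2
      · set a := (T c).min' hne
        set b := (T c).max' hne
        have ha := (Finset.mem_filter.1 h1).1
        have hb := (Finset.mem_filter.1 h2).1
        have e : ⌊F a / ε⌋₊ = ⌊F b / ε⌋₊ := by
          rw [← hcellval a ha, ← hcellval b hb, (Finset.mem_filter.1 h1).2,
            (Finset.mem_filter.1 h2).2]
        have f1 := Nat.floor_le (div_nonneg (hF a ha).1 hε.le)
        have f2 := Nat.lt_floor_add_one (F b / ε)
        rw [e] at f1
        have f3 : (F b - F a) / ε ≤ 1 := by rw [sub_div]; linarith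
        rwa [div_le_one hε] at f3
  choose lo hi h1 h2 using key
  exact ⟨lo, hi, cell, h1, fun k hk => h2 (cell k) k (Finset.mem_filter.2 ⟨hk, rfl⟩)⟩

variable {d n p : ℕ}

section Basis

variable {x : Fin n → EuclideanSpace ℝ (Fin d)} {m k k' : ℕ}

lemma basisMat_nonneg (hk : 1 ≤ k) (i j : Fin n) : 0 ≤ covMatrix x (basisFn k m) i j :=
  (basisFn_pos hk _).le

lemma basisMat_le_one (hk : 1 ≤ k) (i j : Fin n) : covMatrix x (basisFn k m) i j ≤ 1 :=
  basisFn_le_one hk _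

lemma basisMat_mono (hk : 1 ≤ k) (hkk : k ≤ k') (i j : Fin n) :
    covMatrix x (basisFn k m) i j ≤ covMatrix x (basisFn k' m) i j :=
  basisFn_mono_left hk hkk _

lemma basisMat_posSemidef (hk : 1 ≤ k) (hkm : k ≤ m) : (covMatrix x (basisFn k m)).PosSemidef :=
  covMatrix_posSemidef x (basisFn_mem_classA hk hkm)

lemma basisMat_qUpper {K : ℝ} (h : QUpper (covMatrix x (basisFn m m)) K) (hk : 1 ≤ k)
    (hkm : k ≤ m) : QUpper (covMatrix x (basisFn k m)) K :=
  h.of_entry_le fun i j => by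
    rw [abs_of_nonneg (basisMat_nonneg hk i j)]; exact basisMat_mono hk hkm i j

lemma basisMat_quad_mono (hk : 1 ≤ k) (hkk : k ≤ k') {v : Fin n → ℝ} (hv : ∀ i, 0 ≤ v i) :
    v ⬝ᵥ covMatrix x (basisFn k m) *ᵥ v ≤ v ⬝ᵥ covMatrix x (basisFn k' m) *ᵥ v := by
  rw [quadForm_eq_sum, quadForm_eq_sum]
  exact Finset.sum_le_sum fun i _ => Finset.sum_le_sum fun j _ =>
    mul_le_mul_of_nonneg_left (basisMat_mono hk hkk i j) (mul_nonneg (hv i) (hv j))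

/-- The basis matrices can be covered by boundedly many brackets, small in the form of a fixed
nonnegative vector. -/
lemma exists_basis_brackets {K G ε : ℝ} (hK : 0 ≤ K) (hG : 0 ≤ G) (hε : 0 < ε) :
    ∃ M : ℕ, (M : ℝ) ≤ K * G / ε + 1 ∧ ∀ (n d m : ℕ) (x : Fin n → EuclideanSpace ℝ (Fin d))
      (v : Fin n → ℝ), 1 ≤ n → 1 ≤ m → QUpper (covMatrix x (basisFn m m)) K → (∀ i, 0 ≤ v i) →
      v ⬝ᵥ v ≤ G * n →
      ∃ (lo hi : Fin M → ℕ) (cell : ℕ → Fin M),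
        (∀ c, 1 ≤ lo c ∧ lo c ≤ hi c ∧ hi c ≤ m ∧
          v ⬝ᵥ (covMatrix x (basisFn (hi c) m) - covMatrix x (basisFn (lo c) m)) *ᵥ v ≤ ε * n) ∧
        ∀ k ∈ Finset.Icc 1 m, lo (cell k) ≤ k ∧ k ≤ hi (cell k) := by
  obtain ⟨M, hM, h⟩ := exists_brackets (mul_nonneg hK hG) hε
  refine ⟨M, hM, fun n d m x v hn hm hA hv hvG => ?_⟩
  have hn0 : (0 : ℝ) < n := by exact_mod_cast hn
  obtain ⟨lo, hi, cell, h1, h2⟩ := h m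
    (fun k => (v ⬝ᵥ covMatrix x (basisFn k m) *ᵥ v) / n) hm
    (fun k k' hk hkk _ => div_le_div_of_nonneg_right (basisMat_quad_mono hk hkk hv) hn0.le)
    (fun k hk => by
      obtain ⟨hk1, hkm⟩ := Finset.mem_Icc.1 hk
      refine ⟨div_nonneg ((basisMat_posSemidef hk1 hkm).quad_nonneg v) hn0.le, ?_⟩
      rw [div_le_iff₀ hn0]
      calc _ ≤ K * (v ⬝ᵥ v) := basisMat_qUpper hA hk1 hkm v
        _ ≤ K * (G * n) := by gcongr
        _ = _ := by ring)
  refine ⟨lo, hi, cell, fun c => ⟨(h1 c).1, (h1 c).2.1, (h1 c).2.2.1, ?_⟩, h2⟩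
  have := (h1 c).2.2.2
  rw [← sub_div, div_le_iff₀ hn0] at this
  rwa [Matrix.sub_mulVec, dotProduct_sub]

end Basis

lemma abs_apply_le_of_qUpper {A : Matrix (Fin n) (Fin n) ℝ} (hA : A.PosSemidef) {K : ℝ}
    (hK : 0 ≤ K) (h : QUpper A K) (i j : Fin n) : |A i j| ≤ K := by
  have h1 := hA.cauchy (Pi.single i 1) (Pi.single j 1)
  simp only [Matrix.mulVec_single_one, single_one_dotProduct, Matrix.col_apply] at h1
  have h2 := diag_le_of_qUpper h i
  have h3 := diag_le_of_qUpper h j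
  have h4 := hA.diag_nonneg (i := i)
  have h5 := hA.diag_nonneg (i := j)
  refine abs_le_of_sq_le_sq ?_ hK
  calc A i j ^ 2 ≤ A i i * A j j := h1
    _ ≤ K * K := mul_le_mul h2 h3 h5 hK
    _ = K ^ 2 := by ring

/-- The second moment of a nonnegative form at the vector `|u| + w`, pointwise in terms of fourth
powers of the coordinates. -/
lemma sq_quad_abs_add_le {D : Matrix (Fin n) (Fin n) ℝ} (hD : ∀ i j, 0 ≤ D i j) {w : Fin n → ℝ}
    (hw : ∀ i, 1 ≤ w i) (u : Fin n → ℝ) :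
    ((fun i => |u i| + w i) ⬝ᵥ D *ᵥ (fun i => |u i| + w i)) ^ 2 ≤
      (w ⬝ᵥ D *ᵥ w) * ∑ i, ∑ j, (w i * w j * D i j) * (4 * (u i ^ 4 + u j ^ 4 + 2)) := by
  have hq : ∀ i j, 0 ≤ w i * w j * D i j := fun i j =>
    mul_nonneg (mul_nonneg (by linarith [hw i]) (by linarith [hw j])) (hD i j)
  have h1 : (fun i => |u i| + w i) ⬝ᵥ D *ᵥ (fun i => |u i| + w i) ≤
      ∑ z : Fin n × Fin n, (w z.1 * w z.2 * D z.1 z.2) * ((|u z.1| + 1) * (|u z.2| + 1)) := by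
    rw [quadForm_eq_sum, Fintype.sum_prod_type]
    refine Finset.sum_le_sum fun i _ => Finset.sum_le_sum fun j _ => ?_
    have e : ∀ i, |u i| + w i ≤ w i * (|u i| + 1) := fun i => by
      nlinarith [hw i, abs_nonneg (u i)]
    have e0 : ∀ i, 0 ≤ |u i| + w i := fun i => by linarith [hw i, abs_nonneg (u i)]
    calc (|u i| + w i) * (|u j| + w j) * D i j
        ≤ (w i * (|u i| + 1)) * (w j * (|u j| + 1)) * D i j :=
          mul_le_mul_of_nonneg_right (mul_le_mul (e i) (e j) (e0 j) ((e0 i).trans (e i))) (hD i j)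
      _ = _ := by ring
  have h0 : 0 ≤ (fun i => |u i| + w i) ⬝ᵥ D *ᵥ (fun i => |u i| + w i) := by
    rw [quadForm_eq_sum]
    exact Finset.sum_nonneg fun i _ => Finset.sum_nonneg fun j _ => mul_nonneg
      (mul_nonneg (by linarith [hw i, abs_nonneg (u i)]) (by linarith [hw j, abs_nonneg (u j)]))
      (hD i j)
  refine (pow_le_pow_left₀ h0 h1 2).trans ?_
  have h2 := Finset.sum_sq_le_sum_mul_sum_of_sq_le_mul Finset.univ
    (r := fun z : Fin n × Fin n => (w z.1 * w z.2 * D z.1 z.2) * ((|u z.1| + 1) * (|u z.2| + 1)))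
    (f := fun z => w z.1 * w z.2 * D z.1 z.2)
    (g := fun z => (w z.1 * w z.2 * D z.1 z.2) * ((|u z.1| + 1) * (|u z.2| + 1)) ^ 2)
    (fun z _ => hq _ _) (fun z _ => mul_nonneg (hq _ _) (sq_nonneg _)) (fun z _ => le_of_eq (by ring))
  refine h2.trans (le_of_le_of_eq (mul_le_mul_of_nonneg_left (Finset.sum_le_sum fun z _ =>
    mul_le_mul_of_nonneg_left (?_ : _ ≤ 4 * (u z.1 ^ 4 + u z.2 ^ 4 + 2)) (hq _ _)) ?_) ?_)
  · have e : ∀ a : ℝ, (|a| + 1) ^ 4 ≤ 8 * (a ^ 4 + 1) := fun a => by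
      have h4 : a ^ 4 = |a| ^ 4 := by
        rw [show (4 : ℕ) = 2 * 2 by norm_num, pow_mul, pow_mul, sq_abs]
      rw [h4]
      have e1 : (|a| + 1) ^ 2 ≤ 2 * (|a| ^ 2 + 1) := by nlinarith [sq_nonneg (|a| - 1)]
      have e2 : (|a| + 1) ^ 4 = ((|a| + 1) ^ 2) ^ 2 := by ring
      have e3 : ((|a| + 1) ^ 2) ^ 2 ≤ (2 * (|a| ^ 2 + 1)) ^ 2 :=
        pow_le_pow_left₀ (sq_nonneg _) e1 2
      nlinarith [sq_nonneg (|a| ^ 2 - 1)]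
    have e1 := e (u z.1)
    have e2 := e (u z.2)
    nlinarith [sq_nonneg ((|u z.1| + 1) ^ 2 - (|u z.2| + 1) ^ 2)]
  · exact Finset.sum_nonneg fun z _ => hq _ _
  · rw [quadForm_eq_sum, Fintype.sum_prod_type, Fintype.sum_prod_type]

end

section

variable {d n p : ℕ} {Ω : Type*} [MeasurableSpace Ω] {P : Measure Ω}

lemma measure_iUnion_fin_le {M : ℕ} {A : Fin M → Set Ω} {t : ℝ}
    (h : ∀ c, P (A c) ≤ ENNReal.ofReal t) : P (⋃ c, A c) ≤ ENNReal.ofReal (M * t) := by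
  refine (measure_iUnion_le A).trans ((ENNReal.tsum_le_tsum h).trans (le_of_eq ?_))
  rw [tsum_fintype, Finset.sum_const, nsmul_eq_mul, Finset.card_univ, Fintype.card_fin,
    ENNReal.ofReal_mul (Nat.cast_nonneg _), ENNReal.ofReal_natCast]

lemma IsCenteredGauss.integrable_fourth_coord {S : Matrix (Fin n) (Fin n) ℝ} {Z : Ω → Fin n → ℝ}
    (h : IsCenteredGauss P S Z) (i : Fin n) : Integrable (fun ω => Z ω i ^ 4) P := by
  have h1 := (h.memLp_coord i 4 (by simp)).integrable_norm_pow (p := 4) (by norm_num)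
  refine h1.congr (Eventually.of_forall fun ω => ?_)
  change ‖Z ω i‖ ^ 4 = Z ω i ^ 4
  rw [Real.norm_eq_abs, show (4 : ℕ) = 2 * 2 by norm_num, pow_mul, pow_mul, sq_abs]

lemma QUpper.conj {A B : Matrix (Fin n) (Fin n) ℝ} {K b : ℝ} (hK : 0 ≤ K) (hA : QUpper A K)
    (hB : B.PosSemidef) (hb : 0 ≤ b) (hBb : QUpper B b) : QUpper (B * A * B) (K * b ^ 2) := by
  intro v
  rw [quad_conj _ hB.isSymm, mul_assoc]
  exact (hA _).trans (mul_le_mul_of_nonneg_left (hB.mulVec_sq_le hb hBb v) hK)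

/-- Second moment bound behind the maximal inequality on a bracket. -/
lemma measure_quad_abs_add_le {S : Matrix (Fin n) (Fin n) ℝ} {Z : Ω → Fin n → ℝ}
    (hZ : IsCenteredGauss P S Z) {κ : ℝ} (hS : QUpper S κ)
    {D : Matrix (Fin n) (Fin n) ℝ}
    (hD : ∀ i j, 0 ≤ D i j) {w : Fin n → ℝ} (hw : ∀ i, 1 ≤ w i) {q t : ℝ}
    (hq : w ⬝ᵥ D *ᵥ w ≤ q) (ht : 0 < t) :
    P {ω | t ≤ (fun i => |Z ω i| + w i) ⬝ᵥ D *ᵥ (fun i => |Z ω i| + w i)} ≤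
      ENNReal.ofReal (q ^ 2 * (8 * (gaussFourth * κ ^ 2 + 1)) / t ^ 2) := by
  have hP := hZ.isProbabilityMeasure
  have hq' : ∀ i j, 0 ≤ w i * w j * D i j := fun i j =>
    mul_nonneg (mul_nonneg (by linarith [hw i]) (by linarith [hw j])) (hD i j)
  have hq0 : 0 ≤ w ⬝ᵥ D *ᵥ w := by
    rw [quadForm_eq_sum]
    exact Finset.sum_nonneg fun i _ => Finset.sum_nonneg fun j _ => hq' i j
  have hterm : ∀ i j, Integrable (fun ω => (w i * w j * D i j) *
      (4 * (Z ω i ^ 4 + Z ω j ^ 4 + 2))) P := fun i j =>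
    ((((hZ.integrable_fourth_coord i).add (hZ.integrable_fourth_coord j)).add
      (integrable_const 2)).const_mul 4).const_mul _
  have hi : Integrable (fun ω => (w ⬝ᵥ D *ᵥ w) * ∑ i, ∑ j, (w i * w j * D i j) *
      (4 * (Z ω i ^ 4 + Z ω j ^ 4 + 2))) P :=
    (integrable_finsetSum _ fun i _ => integrable_finsetSum _ fun j _ => hterm i j).const_mul _
  have hfour : ∀ i, ∫ ω, Z ω i ^ 4 ∂P ≤ gaussFourth * κ ^ 2 := fun i => by
    rw [hZ.integral_fourth_coord]
    exact mul_le_mul_of_nonneg_left (pow_le_pow_left₀ (hZ.diag_nonneg i) (diag_le_of_qUpper hS i) 2)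
      gaussFourth_nonneg
  have hI : ∫ ω, (w ⬝ᵥ D *ᵥ w) * ∑ i, ∑ j, (w i * w j * D i j) *
      (4 * (Z ω i ^ 4 + Z ω j ^ 4 + 2)) ∂P ≤ q ^ 2 * (8 * (gaussFourth * κ ^ 2 + 1)) := by
    rw [integral_const_mul, integral_finsetSum _ fun i _ => integrable_finsetSum _ fun j _ =>
      hterm i j]
    have h8 : 0 ≤ 8 * (gaussFourth * κ ^ 2 + 1) := by have := gaussFourth_nonneg; positivity
    have h1 : ∑ i, ∫ ω, ∑ j, (w i * w j * D i j) * (4 * (Z ω i ^ 4 + Z ω j ^ 4 + 2)) ∂P ≤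
        (w ⬝ᵥ D *ᵥ w) * (8 * (gaussFourth * κ ^ 2 + 1)) := by
      rw [quadForm_eq_sum, Finset.sum_mul]
      refine Finset.sum_le_sum fun i _ => ?_
      rw [integral_finsetSum _ fun j _ => hterm i j, Finset.sum_mul]
      refine Finset.sum_le_sum fun j _ => ?_
      rw [integral_const_mul]
      refine mul_le_mul_of_nonneg_left ?_ (hq' i j)
      have i1 := hZ.integrable_fourth_coord i
      have i2 := hZ.integrable_fourth_coord j
      have e : ∫ ω, 4 * (Z ω i ^ 4 + Z ω j ^ 4 + 2) ∂P =
          4 * (∫ ω, Z ω i ^ 4 ∂P + ∫ ω, Z ω j ^ 4 ∂P + 2) := by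
        rw [integral_const_mul]
        congr 1
        refine (integral_add (i1.add i2) (integrable_const 2)).trans ?_
        rw [integral_add' i1 i2]
        simp
      rw [e]
      linarith [hfour i, hfour j]
    calc _ ≤ (w ⬝ᵥ D *ᵥ w) * ((w ⬝ᵥ D *ᵥ w) * (8 * (gaussFourth * κ ^ 2 + 1))) :=
          mul_le_mul_of_nonneg_left h1 hq0
      _ = (w ⬝ᵥ D *ᵥ w) ^ 2 * (8 * (gaussFourth * κ ^ 2 + 1)) := by ring
      _ ≤ _ := mul_le_mul_of_nonneg_right (pow_le_pow_left₀ hq0 hq 2) h8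
  refine le_trans (measure_mono fun ω hω => ?_) (markov_le (fun ω => mul_nonneg hq0
    (Finset.sum_nonneg fun i _ => Finset.sum_nonneg fun j _ => mul_nonneg (hq' i j)
      (by positivity))) hi (by positivity) hI)
  have hω' : t ≤ (fun i => |Z ω i| + w i) ⬝ᵥ D *ᵥ (fun i => |Z ω i| + w i) := hω
  exact (pow_le_pow_left₀ ht.le hω' 2).trans (sq_quad_abs_add_le hD hw (Z ω))

/-- The weight `1 + ∑ |X_ia|` of the design. -/
lemma weight_sq_le {X : Matrix (Fin n) (Fin p) ℝ} {K : ℝ} (hX : QUpper (Xᵀ * X) (n * K)) :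
    (fun i => 1 + ∑ a, |X i a|) ⬝ᵥ (fun i => 1 + ∑ a, |X i a|) ≤ (p + 1) * (1 + p * K) * n := by
  have h1 : ∀ i, (1 + ∑ a, |X i a|) * (1 + ∑ a, |X i a|) ≤ (p + 1) * (1 + ∑ a, X i a ^ 2) := by
    intro i
    have := sq_sum_le_card_mul_sum_sq (s := (Finset.univ : Finset (Option (Fin p))))
      (f := fun o => Option.elim o 1 fun a => |X i a|)
    simp only [Fintype.sum_option, Option.elim, Finset.card_univ, Fintype.card_option,
      Fintype.card_fin, sq_abs, one_pow] at this
    push_cast at this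
    rw [← sq]; exact this
  have h2 : ∀ a, ∑ i, X i a ^ 2 ≤ n * K := fun a => by
    have := diag_le_of_qUpper hX a
    simpa [Matrix.mul_apply, sq] using this
  calc _ ≤ ∑ i, ((p : ℝ) + 1) * (1 + ∑ a, X i a ^ 2) := Finset.sum_le_sum fun i _ => h1 i
    _ = (p + 1) * (n + ∑ a, ∑ i, X i a ^ 2) := by
        rw [← Finset.mul_sum, Finset.sum_add_distrib, Finset.sum_comm]; simp
    _ ≤ (p + 1) * (n + ∑ _a : Fin p, n * K) := by
        gcongr with a _
        exact h2 a
    _ = _ := by simp; ring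

set_option maxHeartbeats 1000000 in
/-- For a fixed bounded matrix `B` and `u = B Z`, the forms `uᵀ A u` of all basis matrices `A`
concentrate simultaneously, and so do the bilinear forms with the columns of the design. Within a
bracket the forms are controlled by their second moments, at the finitely many brackets by
Chebyshev's inequality. -/
lemma exists_uniform_basis (p : ℕ) {c K b ε ζ : ℝ} (hc : 0 < c) (hK : 1 ≤ K) (hb : 0 < b)
    (hε : 0 < ε) (hζ : 0 < ζ) :
    ∃ n₀ : ℕ, ∀ n ≥ n₀, ∀ (d m : ℕ) (x : Fin n → EuclideanSpace ℝ (Fin d))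
      (X : Matrix (Fin n) (Fin p) ℝ) (S B : Matrix (Fin n) (Fin n) ℝ) (Z : Ω → Fin n → ℝ),
      1 ≤ m → QLower c S → QUpper S K → QUpper (covMatrix x (basisFn m m)) K →
      QUpper (Xᵀ * X) (n * K) → B.PosSemidef → QUpper B b → IsCenteredGauss P S Z →
      ∃ bad : Set Ω, P bad ≤ ENNReal.ofReal ζ ∧ ∀ ω ∉ bad, ∀ k ∈ Finset.Icc 1 m,
        |(B *ᵥ Z ω) ⬝ᵥ covMatrix x (basisFn k m) *ᵥ (B *ᵥ Z ω) -
            (covMatrix x (basisFn k m) * (B * S * B)).trace| ≤ ε * n ∧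
          ∀ a, |Xᵀ a ⬝ᵥ covMatrix x (basisFn k m) *ᵥ (B *ᵥ Z ω)| ≤ ε * n := by
  have hK0 : 0 ≤ K := by linarith
  have hg := gaussFourth_nonneg
  set κ : ℝ := K * b ^ 2 with hκ
  have hκ0 : 0 < κ := by positivity
  set G : ℝ := (p + 1) * (1 + p * K) with hG
  have hG0 : 0 ≤ G := by positivity
  set C4 : ℝ := 8 * (gaussFourth * κ ^ 2 + 1) with hC4
  have hC40 : 0 < C4 := by positivity
  set ε₀ : ℝ := min 1 (min (ζ * ε ^ 2 / (8 * C4 * (K * G + 1))) (ε / (4 * κ))) with hε₀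
  have hε₀0 : 0 < ε₀ := lt_min one_pos (lt_min (by positivity) (by positivity))
  have hε₀1 : ε₀ ≤ 1 := min_le_left _ _
  have hε₀2 : ε₀ ≤ ζ * ε ^ 2 / (8 * C4 * (K * G + 1)) :=
    (min_le_right _ _).trans (min_le_left _ _)
  have hε₀3 : ε₀ ≤ ε / (4 * κ) := (min_le_right _ _).trans (min_le_right _ _)
  obtain ⟨M, hM, hbr⟩ := exists_basis_brackets hK0 hG0 hε₀0
  set V₁ : ℝ := gaussFourth * (K * κ) ^ 2 * 16 / ε ^ 2 with hV₁
  set V₂ : ℝ := p * (K * (b ^ 2 * (K ^ 2 * K)) * 16 / ε ^ 2) with hV₂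
  have hV₁0 : 0 ≤ V₁ := by positivity
  have hV₂0 : 0 ≤ V₂ := by positivity
  refine ⟨⌈2 * (M * (V₁ + V₂)) / ζ⌉₊ + 1, ?_⟩
  intro n hn d m x X S B Z hm hlow hup htop hX hB hBb hZ
  have hP := hZ.isProbabilityMeasure
  have hn1 : 1 ≤ n := by omega
  have hn0 : (0 : ℝ) < n := by exact_mod_cast hn1
  have hnV : 2 * (M * (V₁ + V₂)) ≤ ζ * n := by
    have h1 : (⌈2 * (M * (V₁ + V₂)) / ζ⌉₊ : ℝ) ≤ n := by exact_mod_cast (by omega)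
    have h2 := (Nat.le_ceil (2 * (M * (V₁ + V₂)) / ζ)).trans h1
    rw [div_le_iff₀ hζ] at h2
    linarith
  have hSP : S.PosDef := hlow.posDef hc hZ.cov_symm
  set w : Fin n → ℝ := fun i => 1 + ∑ a, |X i a| with hw
  have hw1 : ∀ i, 1 ≤ w i := fun i => by
    have : 0 ≤ ∑ a, |X i a| := Finset.sum_nonneg fun a _ => abs_nonneg _
    simp only [hw]; linarith
  have hXw : ∀ i a, |X i a| ≤ w i := fun i a => by
    have := Finset.single_le_sum (f := fun a => |X i a|) (fun a _ => abs_nonneg _)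
      (Finset.mem_univ a)
    simp only [hw]; linarith
  obtain ⟨lo, hi, cell, hbra, hcell⟩ := hbr n d m x w hn1 hm htop
    (fun i => by linarith [hw1 i]) (weight_sq_le hX)
  set A : ℕ → Matrix (Fin n) (Fin n) ℝ := fun k => covMatrix x (basisFn k m) with hA
  have hAsymm : ∀ k, (A k).IsSymm := fun k => covMatrix_isSymm _ _
  have hApsd : ∀ k, 1 ≤ k → k ≤ m → (A k).PosSemidef := fun k h1 h2 => basisMat_posSemidef h1 h2
  have hAu : ∀ k, 1 ≤ k → k ≤ m → QUpper (A k) K := fun k h1 h2 => basisMat_qUpper htop h1 h2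
  have hlom : ∀ c, lo c ≤ m := fun c => (hbra c).2.1.trans (hbra c).2.2.1
  have hU := hZ.map B
  rw [hB.isSymm.eq] at hU
  have hBSB : (B * S * B).PosSemidef := hZ.posSemidef.conj hB.isSymm
  have hBSBu : QUpper (B * S * B) κ := QUpper.conj hK0 hup hB hb.le hBb
  set D : Fin M → Matrix (Fin n) (Fin n) ℝ := fun c => A (hi c) - A (lo c) with hD
  have hD0 : ∀ c i j, 0 ≤ D c i j := fun c i j =>
    sub_nonneg.2 (basisMat_mono (hbra c).1 (hbra c).2.1 i j)
  -- the exceptional events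
  set E₁ : Fin M → Set Ω := fun c => {ω | ε / 2 * n ≤ (fun i => |(B *ᵥ Z ω) i| + w i) ⬝ᵥ
    D c *ᵥ (fun i => |(B *ᵥ Z ω) i| + w i)} with hE₁
  set E₂ : Fin M → Set Ω := fun c => {ω | ε / 4 * n ≤
    |Z ω ⬝ᵥ (B * A (lo c) * B) *ᵥ Z ω - (B * A (lo c) * B * S).trace|} with hE₂
  set E₃ : Fin M → Fin p → Set Ω := fun c a => {ω | ε / 4 * n ≤
    |(B *ᵥ (A (lo c) *ᵥ Xᵀ a)) ⬝ᵥ Z ω|} with hE₃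
  have hP₁ : P (⋃ c, E₁ c) ≤ ENNReal.ofReal (ζ / 2) := by
    have h1 : ∀ c, P (E₁ c) ≤ ENNReal.ofReal (4 * C4 * ε₀ ^ 2 / ε ^ 2) := fun c => by
      refine (measure_quad_abs_add_le hU hBSBu (hD0 c) hw1 (hbra c).2.2.2
        (t := ε / 2 * n) (by positivity)).trans (ENNReal.ofReal_le_ofReal (le_of_eq ?_))
      rw [← hC4]; field_simp; ring
    refine (measure_iUnion_fin_le h1).trans (ENNReal.ofReal_le_ofReal ?_)
    have h2 : (M : ℝ) * ε₀ ≤ K * G + 1 := by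
      calc (M : ℝ) * ε₀ ≤ (K * G / ε₀ + 1) * ε₀ := by gcongr
        _ = K * G + ε₀ := by field_simp
        _ ≤ _ := by linarith
    rw [le_div_iff₀ (by positivity)] at hε₀2
    calc (M : ℝ) * (4 * C4 * ε₀ ^ 2 / ε ^ 2) = (M * ε₀) * (4 * C4 * ε₀ / ε ^ 2) := by ring
      _ ≤ (K * G + 1) * (4 * C4 * ε₀ / ε ^ 2) := by gcongr
      _ = (ε₀ * (8 * C4 * (K * G + 1))) / (2 * ε ^ 2) := by ring
      _ ≤ (ζ * ε ^ 2) / (2 * ε ^ 2) := by gcongr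
      _ = ζ / 2 := by field_simp
  have hP₂ : P (⋃ c, E₂ c) ≤ ENNReal.ofReal (M * (V₁ / n)) := by
    refine measure_iUnion_fin_le fun c => ?_
    obtain ⟨hi2, hI2⟩ := hZ.quad_variance hSP hK0 hup
      ((hApsd (lo c) (hbra c).1 (hlom c)).conj hB.isSymm) hκ0.le
      (QUpper.conj hK0 (hAu (lo c) (hbra c).1 (hlom c)) hB hb.le hBb)
    refine (chebyshev_le hi2 (by positivity) hI2).trans (ENNReal.ofReal_le_ofReal (le_of_eq ?_))
    rw [hV₁, Fintype.card_fin]; field_simp; ring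
  have hP₃ : P (⋃ c, ⋃ a, E₃ c a) ≤ ENNReal.ofReal (M * (V₂ / n)) := by
    refine measure_iUnion_fin_le fun c => ?_
    have h1 : ∀ a, P (E₃ c a) ≤ ENNReal.ofReal (K * (b ^ 2 * (K ^ 2 * K)) * 16 / ε ^ 2 / n) :=
      fun a => by
      have hI : ∫ ω, ((B *ᵥ (A (lo c) *ᵥ Xᵀ a)) ⬝ᵥ Z ω) ^ 2 ∂P ≤
          K * (b ^ 2 * (K ^ 2 * (n * K))) := by
        rw [hZ.integral_dotProduct_sq]
        refine (hup _).trans (mul_le_mul_of_nonneg_left ((hB.mulVec_sq_le hb.le hBb _).trans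
          (mul_le_mul_of_nonneg_left (((hApsd (lo c) (hbra c).1 (hlom c)).mulVec_sq_le hK0
            (hAu (lo c) (hbra c).1 (hlom c)) _).trans (mul_le_mul_of_nonneg_left ?_
              (by positivity))) (by positivity))) hK0)
        have := diag_le_of_qUpper hX a
        simpa [Matrix.mul_apply, dotProduct] using this
      refine (chebyshev_le (hZ.integrable_dotProduct_sq _) (by positivity) hI).trans
        (ENNReal.ofReal_le_ofReal (le_of_eq ?_))
      field_simp; ring
    refine (measure_iUnion_fin_le h1).trans (ENNReal.ofReal_le_ofReal (le_of_eq ?_))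
    rw [hV₂]; ring
  refine ⟨(⋃ c, E₁ c) ∪ (⋃ c, E₂ c) ∪ ⋃ c, ⋃ a, E₃ c a, ?_, ?_⟩
  · calc _ ≤ ENNReal.ofReal (ζ / 2) + ENNReal.ofReal (M * (V₁ / n)) +
          ENNReal.ofReal (M * (V₂ / n)) :=
          (measure_union_le _ _).trans (add_le_add ((measure_union_le _ _).trans
            (add_le_add hP₁ hP₂)) hP₃)
      _ = ENNReal.ofReal (ζ / 2 + M * (V₁ / n) + M * (V₂ / n)) := by
          rw [← ENNReal.ofReal_add (by positivity) (by positivity),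
            ← ENNReal.ofReal_add (by positivity) (by positivity)]
      _ ≤ _ := by
          refine ENNReal.ofReal_le_ofReal ?_
          have : M * (V₁ / n) + M * (V₂ / n) ≤ ζ / 2 := by
            have e : M * (V₁ / n) + M * (V₂ / n) = M * (V₁ + V₂) / n := by ring
            rw [e, div_le_iff₀ hn0]; linarith
          linarith
  intro ω hω k hk
  simp only [Set.mem_union, Set.mem_iUnion, not_or, not_exists] at hω
  obtain ⟨⟨h1, h2⟩, h3⟩ := hω
  obtain ⟨hk1, hkm⟩ := Finset.mem_Icc.1 hk
  set c₀ := cell k with hc₀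
  obtain ⟨hlok, hkhi⟩ := hcell k hk
  rw [← hc₀] at hlok hkhi
  have h1' : (fun i => |(B *ᵥ Z ω) i| + w i) ⬝ᵥ D c₀ *ᵥ (fun i => |(B *ᵥ Z ω) i| + w i) <
      ε / 2 * n := not_le.1 (h1 c₀)
  have h2' : |Z ω ⬝ᵥ (B * A (lo c₀) * B) *ᵥ Z ω - (B * A (lo c₀) * B * S).trace| < ε / 4 * n :=
    not_le.1 (h2 c₀)
  have h3' : ∀ a, |(B *ᵥ (A (lo c₀) *ᵥ Xᵀ a)) ⬝ᵥ Z ω| < ε / 4 * n := fun a => not_le.1 (h3 c₀ a)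
  set u := B *ᵥ Z ω with hu
  have hEnt : ∀ i j, |(A k - A (lo c₀)) i j| ≤ D c₀ i j := fun i j => by
    have e1 : A (lo c₀) i j ≤ A k i j := basisMat_mono (hbra c₀).1 hlok i j
    have e2 : A k i j ≤ A (hi c₀) i j := basisMat_mono hk1 hkhi i j
    rw [Matrix.sub_apply, abs_of_nonneg (sub_nonneg.2 e1)]
    simp only [hD, Matrix.sub_apply]
    linarith
  have hmonoD : ∀ y z : Fin n → ℝ, (∀ i, |y i| ≤ |u i| + w i) → (∀ i, |z i| ≤ |u i| + w i) →
      |y ⬝ᵥ (A k - A (lo c₀)) *ᵥ z| ≤ ε / 2 * n := fun y z hy hz => by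
    refine (abs_quad_le_of_entry_le hEnt y z).trans (le_trans ?_ h1'.le)
    rw [quadForm_eq_sum, quadForm_eq_sum]
    refine Finset.sum_le_sum fun i _ => Finset.sum_le_sum fun j _ =>
      mul_le_mul_of_nonneg_right (mul_le_mul (hy i) (hz j) (abs_nonneg _) ?_) (hD0 c₀ i j)
    exact (abs_nonneg _).trans (hy i)
  have hu_le : ∀ i, |u i| ≤ |u i| + w i := fun i => by linarith [hw1 i]
  refine ⟨?_, fun a => ?_⟩
  · have e1 := hmonoD u u hu_le hu_le
    rw [Matrix.sub_mulVec, dotProduct_sub] at e1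
    have e2 : |(A k * (B * S * B)).trace - (A (lo c₀) * (B * S * B)).trace| ≤ ε / 4 * n := by
      rw [← Matrix.trace_sub, ← Matrix.sub_mul]
      have f1 : |((A k - A (lo c₀)) * (B * S * B)).trace| ≤ ∑ i, ∑ j, κ * D c₀ i j := by
        simp only [Matrix.trace, Matrix.diag, Matrix.mul_apply (M := A k - A (lo c₀))]
        refine (Finset.abs_sum_le_sum_abs _ _).trans (Finset.sum_le_sum fun i _ => ?_)
        refine (Finset.abs_sum_le_sum_abs _ _).trans (Finset.sum_le_sum fun j _ => ?_)
        rw [abs_mul, mul_comm]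
        exact mul_le_mul (abs_apply_le_of_qUpper hBSB hκ0.le hBSBu j i) (hEnt i j)
          (abs_nonneg _) hκ0.le
      have f2 : ∑ i, ∑ j, D c₀ i j ≤ ε₀ * n := by
        refine le_trans ?_ (hbra c₀).2.2.2
        rw [quadForm_eq_sum]
        refine Finset.sum_le_sum fun i _ => Finset.sum_le_sum fun j _ => ?_
        refine le_mul_of_one_le_left (hD0 c₀ i j) ?_
        nlinarith [hw1 i, hw1 j]
      simp only [← Finset.mul_sum] at f1
      refine f1.trans ((mul_le_mul_of_nonneg_left f2 hκ0.le).trans ?_)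
      rw [le_div_iff₀ (by positivity)] at hε₀3
      nlinarith
    have e3 : Z ω ⬝ᵥ (B * A (lo c₀) * B) *ᵥ Z ω = u ⬝ᵥ A (lo c₀) *ᵥ u := quad_conj _ hB.isSymm _
    have e4 : (B * A (lo c₀) * B * S).trace = (A (lo c₀) * (B * S * B)).trace := by
      rw [mul_assoc, mul_assoc, Matrix.trace_mul_comm]
      simp only [mul_assoc]
    rw [e3, e4] at h2'
    have := abs_lt.1 h2'
    have := abs_le.1 e1
    have := abs_le.1 e2
    have : 0 < ε * n := by positivity
    rw [abs_le]
    constructor <;> linarith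
  · have e1 := hmonoD (Xᵀ a) u (fun i => (hXw i a).trans (by linarith [abs_nonneg (u i)])) hu_le
    rw [Matrix.sub_mulVec, dotProduct_sub] at e1
    have e2 : Xᵀ a ⬝ᵥ A (lo c₀) *ᵥ u = (B *ᵥ (A (lo c₀) *ᵥ Xᵀ a)) ⬝ᵥ Z ω := by
      rw [dotProduct_mulVec_comm (hAsymm _), hu, dotProduct_comm, dotProduct_mulVec_comm hB.isSymm,
        dotProduct_comm]
    have e3 := h3' a
    rw [← e2] at e3
    have := abs_lt.1 e3
    have := abs_le.1 e1
    have : 0 < ε * n := by positivity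
    rw [abs_le]
    constructor <;> linarith

end

section

/-! ### A finite net of the sieve in the Frobenius norm -/

variable {d n p : ℕ} {Ω : Type*} [MeasurableSpace Ω] {P : Measure Ω}

/-- The covariance matrices of the sieve are covered, up to `ε n` in squared Frobenius norm, by a
number of positive semidefinite matrices that does not depend on `n` or on the sieve order. -/
lemma exists_sieve_net {K U ε : ℝ} (hK : 0 ≤ K) (hU : 0 ≤ U) (hε : 0 < ε) :
    ∃ ν : ℕ, ∀ (n d m : ℕ) (x : Fin n → EuclideanSpace ℝ (Fin d)), 1 ≤ n → 1 ≤ m →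
      QUpper (covMatrix x (basisFn m m)) K →
      ∃ N : Fin ν → Matrix (Fin n) (Fin n) ℝ, (∀ i, (N i).PosSemidef) ∧
        ∀ C ∈ sieveA m, C 0 ≤ U → ∃ i, ∑ a, ∑ b, (covMatrix x C a b - N i a b) ^ 2 ≤ ε * n := by
  classical
  set ε₁ : ℝ := ε / (4 * (U ^ 2 + 1)) with hε₁
  have hε₁0 : 0 < ε₁ := by positivity
  obtain ⟨M, -, hbr⟩ := exists_basis_brackets hK zero_le_one hε₁0
  set ε₂ : ℝ := min 1 (ε / (4 * (M ^ 2 * K + 1))) with hε₂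
  have hε₂0 : 0 < ε₂ := lt_min one_pos (by positivity)
  have hε₂1 : ε₂ ≤ 1 := min_le_left _ _
  have hε₂2 : ε₂ ≤ ε / (4 * (M ^ 2 * K + 1)) := min_le_right _ _
  set T : ℕ := ⌊U / ε₂⌋₊ with hT
  refine ⟨Fintype.card (Fin M → Fin (T + 1)), fun n d m x hn hm htop => ?_⟩
  obtain ⟨lo, hi, cell, hbra, hcell⟩ := hbr n d m x 1 hn hm htop (fun i => zero_le_one)
    (by simp [dotProduct])
  set A : ℕ → Matrix (Fin n) (Fin n) ℝ := fun k => covMatrix x (basisFn k m) with hA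
  have hlom : ∀ c, lo c ≤ m := fun c => (hbra c).2.1.trans (hbra c).2.2.1
  set N₀ : (Fin M → Fin (T + 1)) → Matrix (Fin n) (Fin n) ℝ := fun g =>
    ∑ c, (ε₂ * (g c : ℕ)) • A (lo c) with hN₀
  refine ⟨fun i => N₀ ((Fintype.equivFin _).symm i), fun i => ?_, ?_⟩
  · exact Matrix.posSemidef_sum _ fun c _ =>
      (basisMat_posSemidef (hbra c).1 (hlom c)).smul (by positivity)
  rintro C ⟨w, hw, hCw⟩ hCU
  have h0 : ∑ k ∈ Finset.Icc 1 m, w k ≤ U := by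
    have : C 0 = ∑ k ∈ Finset.Icc 1 m, w k := by rw [hCw]; simp [basisFn_zero]
    linarith
  set a : Fin M → ℝ := fun c => ∑ k ∈ (Finset.Icc 1 m).filter (fun k => cell k = c), w k with ha
  have ha0 : ∀ c, 0 ≤ a c := fun c => Finset.sum_nonneg fun k hk =>
    hw k (Finset.mem_filter.1 hk).1
  have haU : ∀ c, a c ≤ U := fun c => (Finset.sum_le_sum_of_subset_of_nonneg
    (Finset.filter_subset _ _) fun k hk _ => hw k hk).trans h0
  set g : Fin M → Fin (T + 1) := fun c => ⟨⌊a c / ε₂⌋₊, Nat.lt_succ_of_le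
    (Nat.floor_le_floor (by have := haU c; gcongr))⟩ with hg
  refine ⟨Fintype.equivFin _ g, ?_⟩
  simp only [Equiv.symm_apply_apply]
  have hres : ∀ c, 0 ≤ a c - ε₂ * (g c : ℕ) ∧ a c - ε₂ * (g c : ℕ) ≤ ε₂ := fun c => by
    have e1 := Nat.floor_le (div_nonneg (ha0 c) hε₂0.le)
    have e2 := Nat.lt_floor_add_one (a c / ε₂)
    rw [le_div_iff₀ hε₂0] at e1
    rw [div_lt_iff₀ hε₂0] at e2
    simp only [hg]
    constructor <;> nlinarith
  -- error of the brackets and error of the discretized weights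
  set T₁ : Fin n → Fin n → ℝ := fun i j =>
    ∑ k ∈ Finset.Icc 1 m, w k * (A k i j - A (lo (cell k)) i j) with hT₁
  set T₂ : Fin n → Fin n → ℝ := fun i j =>
    ∑ c, (a c - ε₂ * (g c : ℕ)) * A (lo c) i j with hT₂
  have hsplit : ∀ i j, covMatrix x C i j - N₀ g i j = T₁ i j + T₂ i j := by
    intro i j
    have e1 : ∑ k ∈ Finset.Icc 1 m, w k * A (lo (cell k)) i j = ∑ c, a c * A (lo c) i j := by
      rw [← Finset.sum_fiberwise (Finset.Icc 1 m) cell]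
      refine Finset.sum_congr rfl fun c _ => ?_
      rw [ha, Finset.sum_mul]
      exact Finset.sum_congr rfl fun k hk => by rw [(Finset.mem_filter.1 hk).2]
    have e2 : N₀ g i j = ∑ c, ε₂ * (g c : ℕ) * A (lo c) i j := by
      simp only [hN₀, Matrix.sum_apply, Matrix.smul_apply, smul_eq_mul]
    have e3 : covMatrix x C i j = ∑ k ∈ Finset.Icc 1 m, w k * A k i j := by
      rw [covMatrix_apply, hCw]; rfl
    rw [hT₁, hT₂, e2, e3]
    simp only [mul_sub, sub_mul, Finset.sum_sub_distrib, e1]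
    ring
  have hk1 : ∀ k ∈ Finset.Icc 1 m, ∀ i j, 0 ≤ A k i j - A (lo (cell k)) i j ∧
      A k i j - A (lo (cell k)) i j ≤ A (hi (cell k)) i j - A (lo (cell k)) i j ∧
      A k i j - A (lo (cell k)) i j ≤ 1 := by
    intro k hk i j
    obtain ⟨hlk, hkh⟩ := hcell k hk
    have f1 : A (lo (cell k)) i j ≤ A k i j := basisMat_mono (hbra _).1 hlk i j
    have f2 : A k i j ≤ A (hi (cell k)) i j := basisMat_mono (Finset.mem_Icc.1 hk).1 hkh i j
    have f3 : A k i j ≤ 1 := basisMat_le_one (Finset.mem_Icc.1 hk).1 i j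
    have f4 : 0 ≤ A (lo (cell k)) i j := basisMat_nonneg (hbra _).1 i j
    refine ⟨?_, ?_, ?_⟩ <;> linarith
  have hS₁ : ∑ i, ∑ j, T₁ i j ^ 2 ≤ U * (U * (ε₁ * n)) := by
    have e1 : ∀ i j, T₁ i j ^ 2 ≤
        U * ∑ k ∈ Finset.Icc 1 m, w k * (A (hi (cell k)) i j - A (lo (cell k)) i j) := by
      intro i j
      have f0 : 0 ≤ T₁ i j := Finset.sum_nonneg fun k hk => mul_nonneg (hw k hk) (hk1 k hk i j).1
      have f1 : T₁ i j ≤ U := (Finset.sum_le_sum fun k hk =>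
        mul_le_of_le_one_right (hw k hk) (hk1 k hk i j).2.2).trans h0
      have f2 : T₁ i j ≤ ∑ k ∈ Finset.Icc 1 m, w k *
          (A (hi (cell k)) i j - A (lo (cell k)) i j) :=
        Finset.sum_le_sum fun k hk => mul_le_mul_of_nonneg_left (hk1 k hk i j).2.1 (hw k hk)
      rw [sq]
      exact mul_le_mul f1 f2 f0 hU
    have e2 : ∀ c, ∑ i, ∑ j, (A (hi c) i j - A (lo c) i j) ≤ ε₁ * n := fun c => by
      have := (hbra c).2.2.2
      rw [quadForm_eq_sum] at this
      simpa using! this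
    calc _ ≤ ∑ i, ∑ j, U * ∑ k ∈ Finset.Icc 1 m, w k *
          (A (hi (cell k)) i j - A (lo (cell k)) i j) :=
          Finset.sum_le_sum fun i _ => Finset.sum_le_sum fun j _ => e1 i j
      _ = U * ∑ k ∈ Finset.Icc 1 m, w k *
          ∑ i, ∑ j, (A (hi (cell k)) i j - A (lo (cell k)) i j) := by
          simp only [← Finset.mul_sum]
          congr 1
          simp only [Finset.mul_sum]
          exact (Finset.sum_congr rfl fun i _ => Finset.sum_comm).trans Finset.sum_comm
      _ ≤ U * ∑ k ∈ Finset.Icc 1 m, w k * (ε₁ * n) := mul_le_mul_of_nonneg_left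
          (Finset.sum_le_sum fun k hk => mul_le_mul_of_nonneg_left (e2 _) (hw k hk)) hU
      _ ≤ _ := by rw [← Finset.sum_mul]; gcongr
  have hS₂ : ∑ i, ∑ j, T₂ i j ^ 2 ≤ ε₂ * M * (ε₂ * (M * (K * n))) := by
    have e1 : ∀ i j, T₂ i j ^ 2 ≤ (ε₂ * M) * (ε₂ * ∑ c, A (lo c) i j) := by
      intro i j
      have f0 : 0 ≤ T₂ i j := Finset.sum_nonneg fun c _ =>
        mul_nonneg (hres c).1 (basisMat_nonneg (hbra c).1 i j)
      have f2 : T₂ i j ≤ ε₂ * ∑ c, A (lo c) i j := by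
        rw [Finset.mul_sum]
        exact Finset.sum_le_sum fun c _ =>
          mul_le_mul_of_nonneg_right (hres c).2 (basisMat_nonneg (hbra c).1 i j)
      have f1 : ε₂ * ∑ c, A (lo c) i j ≤ ε₂ * M := by
        refine mul_le_mul_of_nonneg_left ?_ hε₂0.le
        calc ∑ c, A (lo c) i j ≤ ∑ _c : Fin M, (1 : ℝ) :=
              Finset.sum_le_sum fun c _ => basisMat_le_one (hbra c).1 i j
          _ = M := by simp
      rw [sq]
      exact mul_le_mul (f2.trans f1) f2 f0 (by positivity)
    calc _ ≤ ∑ i, ∑ j, (ε₂ * M) * (ε₂ * ∑ c, A (lo c) i j) :=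
          Finset.sum_le_sum fun i _ => Finset.sum_le_sum fun j _ => e1 i j
      _ = (ε₂ * M) * (ε₂ * ∑ c, ∑ i, ∑ j, A (lo c) i j) := by
          simp only [← Finset.mul_sum]
          rw [Finset.sum_congr rfl fun i _ => Finset.sum_comm, Finset.sum_comm]
      _ ≤ (ε₂ * M) * (ε₂ * ∑ _c : Fin M, K * n) := by
          gcongr with c _
          exact sum_covMatrix_le (basisMat_qUpper htop (hbra c).1 (hlom c))
      _ = _ := by simp
  have hn0 : (0 : ℝ) ≤ n := Nat.cast_nonneg n
  calc ∑ i, ∑ j, (covMatrix x C i j - N₀ g i j) ^ 2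
      ≤ ∑ i, ∑ j, (2 * T₁ i j ^ 2 + 2 * T₂ i j ^ 2) :=
        Finset.sum_le_sum fun i _ => Finset.sum_le_sum fun j _ => by
          rw [hsplit]; nlinarith [sq_nonneg (T₁ i j - T₂ i j)]
    _ = 2 * ∑ i, ∑ j, T₁ i j ^ 2 + 2 * ∑ i, ∑ j, T₂ i j ^ 2 := by
        simp only [Finset.sum_add_distrib, Finset.mul_sum]
    _ ≤ 2 * (U * (U * (ε₁ * n))) + 2 * (ε₂ * M * (ε₂ * (M * (K * n)))) := by gcongr
    _ = (2 * (U ^ 2 * ε₁) + 2 * (ε₂ * (ε₂ * (M ^ 2 * K)))) * n := by ring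
    _ ≤ ε * n := by
        refine mul_le_mul_of_nonneg_right ?_ hn0
        have e1 : U ^ 2 * ε₁ ≤ ε / 4 := by
          rw [hε₁, ← mul_div_assoc, div_le_div_iff₀ (by positivity) (by norm_num)]
          nlinarith
        have e2 : ε₂ * (M ^ 2 * K) ≤ ε / 4 := by
          rw [le_div_iff₀ (by positivity)] at hε₂2
          nlinarith
        have e3 : ε₂ * (ε₂ * (M ^ 2 * K)) ≤ ε₂ * (M ^ 2 * K) :=
          mul_le_of_le_one_left (by positivity) hε₂1
        linarith

/-! ### The residual form of the sieve, from below -/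

/-- Perturbation of the trace of an inverse to second order. -/
lemma trace_inv_mul_le {T T₀ S : Matrix (Fin n) (Fin n) ℝ} {η K : ℝ} (hη : 0 < η) (hK : 0 ≤ K)
    (hT : T.IsSymm) (hTl : QLower η T) (hT₀ : T₀.IsSymm) (hT₀l : QLower η T₀)
    (hS : S.PosSemidef) (hSK : QUpper S K) :
    (T⁻¹ * S).trace ≤ 2 * (T₀⁻¹ * S).trace - (T * (T₀⁻¹ * S * T₀⁻¹)).trace +
      K * (1 / η) ^ 2 * (1 / η) * ∑ i, ∑ j, (T i j - T₀ i j) ^ 2 := by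
  have hTp := hTl.posDef hη hT
  have hT₀p := hT₀l.posDef hη hT₀
  set B := T₀⁻¹ with hB
  set E := T - T₀ with hE
  have hBp : B.PosSemidef := hT₀p.inv.posSemidef
  have hBu : QUpper B (1 / η) := qUpper_inv hT₀ hη hT₀l
  have hEs : E.IsSymm := hT.sub hT₀
  have e1 : T₀ * B = 1 := Matrix.mul_nonsing_inv _ ((Matrix.isUnit_iff_isUnit_det _).1 hT₀p.isUnit)
  have e1' : B * T₀ = 1 := mul_eq_one_comm.1 e1
  have e2 : T * T⁻¹ = 1 := Matrix.mul_nonsing_inv _ ((Matrix.isUnit_iff_isUnit_det _).1 hTp.isUnit)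
  have e2' : T⁻¹ * T = 1 := mul_eq_one_comm.1 e2
  have key : B * (E * T⁻¹ * E) * B = B * T * B - B - B + T⁻¹ := by
    have f1 : B * E = B * T - 1 := by rw [hE, mul_sub, e1']
    have f2 : E * B = T * B - 1 := by rw [hE, sub_mul, e1]
    calc B * (E * T⁻¹ * E) * B = (B * E) * T⁻¹ * (E * B) := by simp only [mul_assoc]
      _ = (B * T - 1) * T⁻¹ * (T * B - 1) := by rw [f1, f2]
      _ = (B * (T * T⁻¹) - T⁻¹) * (T * B - 1) := by rw [sub_mul, one_mul, mul_assoc]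
      _ = B * T * B - B - (T⁻¹ * T) * B + T⁻¹ := by
          rw [e2, mul_one, mul_sub, sub_mul, mul_one, mul_assoc, mul_assoc]; abel
      _ = _ := by rw [e2', one_mul]
  have h1 := trace_conj_conj_le (P := B * S * B) (Q := T⁻¹) (E := E) (hS.conj hBp.isSymm)
    hTp.inv.posSemidef hEs (p := K * (1 / η) ^ 2) (q := 1 / η) (by positivity)
    (QUpper.conj hK hSK hBp (by positivity) hBu) (qUpper_inv hT hη hTl)
  have h2 : (B * S * B * (E * T⁻¹ * E)).trace =
      (T * (B * S * B)).trace - 2 * (B * S).trace + (T⁻¹ * S).trace := by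
    have g1 : (B * S * B * (E * T⁻¹ * E)).trace = (B * (E * T⁻¹ * E) * B * S).trace := by
      rw [mul_assoc (B * S), mul_assoc B S, Matrix.trace_mul_comm B, mul_assoc S,
        Matrix.trace_mul_comm S]
    have g2 : (T * (B * S * B)).trace = (B * T * B * S).trace := by
      rw [← mul_assoc, Matrix.trace_mul_comm]; simp only [mul_assoc]
    rw [g1, key, g2, add_mul, sub_mul, sub_mul, Matrix.trace_add, Matrix.trace_sub,
      Matrix.trace_sub]
    ring
  rw [h2] at h1
  simp only [hE, Matrix.sub_apply] at h1
  linarith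

lemma mulVec_dotProduct_eq (X : Matrix (Fin n) (Fin p) ℝ) (δ : Fin p → ℝ) (y : Fin n → ℝ) :
    y ⬝ᵥ X *ᵥ δ = ∑ a, δ a * (Xᵀ a ⬝ᵥ y) := by
  rw [Matrix.dotProduct_mulVec, dotProduct_comm]
  simp only [dotProduct, Matrix.vecMul, Matrix.transpose_apply]
  exact Finset.sum_congr rfl fun k _ => by
    congr 1; exact Finset.sum_congr rfl fun i _ => mul_comm _ _

lemma abs_dotProduct_mulVec_le {X : Matrix (Fin n) (Fin p) ℝ} {δ : Fin p → ℝ} {y : Fin n → ℝ}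
    {b t : ℝ} (hb : 0 ≤ b) (hδ : ∀ a, |δ a| ≤ b) (hy : ∀ a, |Xᵀ a ⬝ᵥ y| ≤ t) :
    |y ⬝ᵥ X *ᵥ δ| ≤ p * b * t := by
  rw [mulVec_dotProduct_eq]
  refine (Finset.abs_sum_le_sum_abs _ _).trans ?_
  calc _ ≤ ∑ _a : Fin p, b * t := Finset.sum_le_sum fun a _ => by
        rw [abs_mul]; exact mul_le_mul (hδ a) (hy a) (abs_nonneg _) hb
    _ = _ := by simp; ring

/-- The variational lower bound for the residual form, at the test vector
`(N + η)⁻¹ z + (K' + η)⁻¹ X δ`, for `N` close to `Sg`. The deviations of the linear and quadratic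
forms in `z` from their expectations enter as hypotheses. -/
lemma residual_lower {Sg N S : Matrix (Fin n) (Fin n) ℝ} {X : Matrix (Fin n) (Fin p) ℝ}
    {z : Fin n → ℝ} {δ : Fin p → ℝ} {η K K' U b t θ : ℝ} (hη : 0 < η) (hK : 0 ≤ K)
    (hK' : 0 ≤ K') (hb : 0 ≤ b)
    (hSg : Sg.PosDef) (hSgu : QUpper Sg K') (hN : N.PosSemidef) (hS : S.PosSemidef)
    (hSK : QUpper S K)
    (h1 : |z ⬝ᵥ (N + η • 1)⁻¹ *ᵥ z - ((N + η • 1)⁻¹ * S).trace| ≤ t)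
    (h2 : |z ⬝ᵥ ((N + η • 1)⁻¹ * (N + η • 1)⁻¹) *ᵥ z -
      ((N + η • 1)⁻¹ * (N + η • 1)⁻¹ * S).trace| ≤ t)
    (h3 : |((N + η • 1)⁻¹ *ᵥ z) ⬝ᵥ Sg *ᵥ ((N + η • 1)⁻¹ *ᵥ z) -
      (Sg * ((N + η • 1)⁻¹ * S * (N + η • 1)⁻¹)).trace| ≤ U * t)
    (h4 : ∀ a, |Xᵀ a ⬝ᵥ z| ≤ t) (h5 : ∀ a, |Xᵀ a ⬝ᵥ (N + η • 1)⁻¹ *ᵥ z| ≤ t)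
    (h6 : ∀ a, |Xᵀ a ⬝ᵥ Sg *ᵥ ((N + η • 1)⁻¹ *ᵥ z)| ≤ U * t) (hδ : ∀ a, |δ a| ≤ b)
    (h7 : ∑ i, ∑ j, (Sg i j - N i j) ^ 2 ≤ θ) :
    ((Sg + η • 1)⁻¹ * S).trace + (K' + η)⁻¹ * ((X *ᵥ δ) ⬝ᵥ (X *ᵥ δ)) -
        (2 + η + U + 2 * (p * b) * (1 + (K' + η)⁻¹ * (1 + U + η))) * t -
        K * (1 / η) ^ 2 * (1 / η) * θ ≤
      (z + X *ᵥ δ) ⬝ᵥ Sg⁻¹ *ᵥ (z + X *ᵥ δ) := by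
  set T₀ := N + η • (1 : Matrix (Fin n) (Fin n) ℝ) with hT₀
  set T := Sg + η • (1 : Matrix (Fin n) (Fin n) ℝ) with hT
  set B := T₀⁻¹ with hB
  set κ := (K' + η)⁻¹ with hκ
  have hκ0 : 0 < κ := by positivity
  set y := X *ᵥ δ with hy
  set u := B *ᵥ z with hu
  have hone : ∀ v : Fin n → ℝ, v ⬝ᵥ (η • (1 : Matrix (Fin n) (Fin n) ℝ)) *ᵥ v = η * (v ⬝ᵥ v) :=
    fun v => by rw [Matrix.smul_mulVec, Matrix.one_mulVec, dotProduct_smul, smul_eq_mul]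
  have hTs : T.IsSymm := hSg.posSemidef.isSymm.add (Matrix.isSymm_one.smul η)
  have hT₀s : T₀.IsSymm := hN.isSymm.add (Matrix.isSymm_one.smul η)
  have hTl : QLower η T := fun v => by
    rw [hT, Matrix.add_mulVec, dotProduct_add, hone]
    linarith [hSg.posSemidef.quad_nonneg v]
  have hT₀l : QLower η T₀ := fun v => by
    rw [hT₀, Matrix.add_mulVec, dotProduct_add, hone]
    linarith [hN.quad_nonneg v]
  have hBs : B.IsSymm := (hT₀l.posDef hη hT₀s).inv.posSemidef.isSymm
  have htr := trace_inv_mul_le hη hK hTs hTl hT₀s hT₀l hS hSK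
  have hTE : ∀ i j, T i j - T₀ i j = Sg i j - N i j := fun i j => by
    simp only [hT, hT₀, Matrix.add_apply]; ring
  simp only [hTE] at htr
  have hpos : 0 ≤ K * (1 / η) ^ 2 * (1 / η) := by positivity
  have htr2 := mul_le_mul_of_nonneg_left h7 hpos
  have htr3 : (T * (B * S * B)).trace = (Sg * (B * S * B)).trace + η * (B * B * S).trace := by
    rw [hT, Matrix.add_mul, Matrix.trace_add, Matrix.smul_mul, Matrix.trace_smul, one_mul,
      smul_eq_mul, Matrix.trace_mul_comm (B * S) B]
    simp only [mul_assoc]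
  have hvar := two_mul_sub_quad_le_inv hSg (u + κ • y) (z + y)
  have hup : (u + κ • y) ⬝ᵥ Sg *ᵥ (u + κ • y) ≤ (u + κ • y) ⬝ᵥ T *ᵥ (u + κ • y) := by
    rw [hT, Matrix.add_mulVec, dotProduct_add, hone]
    have := mul_nonneg hη.le (dotProduct_self_nonneg' (u + κ • y))
    linarith
  have hexp : (u + κ • y) ⬝ᵥ T *ᵥ (u + κ • y) =
      u ⬝ᵥ Sg *ᵥ u + η * (u ⬝ᵥ u) + 2 * (κ * ((Sg *ᵥ u) ⬝ᵥ y + η * (u ⬝ᵥ y))) +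
        κ ^ 2 * (y ⬝ᵥ T *ᵥ y) := by
    rw [quad_add hTs, quad_smul, Matrix.mulVec_smul, dotProduct_smul, smul_eq_mul]
    have f1 : u ⬝ᵥ T *ᵥ u = u ⬝ᵥ Sg *ᵥ u + η * (u ⬝ᵥ u) := by
      rw [hT, Matrix.add_mulVec, dotProduct_add, hone]
    have f2 : u ⬝ᵥ T *ᵥ y = (Sg *ᵥ u) ⬝ᵥ y + η * (u ⬝ᵥ y) := by
      rw [hT, Matrix.add_mulVec, dotProduct_add, dotProduct_mulVec_comm hSg.posSemidef.isSymm,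
        Matrix.smul_mulVec, Matrix.one_mulVec, dotProduct_smul, smul_eq_mul, dotProduct_comm y]
    rw [f1, f2]
  have hTy : κ ^ 2 * (y ⬝ᵥ T *ᵥ y) ≤ κ * (y ⬝ᵥ y) := by
    have f1 : y ⬝ᵥ T *ᵥ y ≤ (K' + η) * (y ⬝ᵥ y) := by
      rw [hT, Matrix.add_mulVec, dotProduct_add, hone]
      linarith [hSgu y]
    calc κ ^ 2 * (y ⬝ᵥ T *ᵥ y) ≤ κ ^ 2 * ((K' + η) * (y ⬝ᵥ y)) := by gcongr
      _ = κ * (y ⬝ᵥ y) := by rw [hκ]; field_simp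
  have hue : (u + κ • y) ⬝ᵥ (z + y) = u ⬝ᵥ z + u ⬝ᵥ y + κ * (z ⬝ᵥ y) + κ * (y ⬝ᵥ y) := by
    rw [add_dotProduct, dotProduct_add, dotProduct_add, smul_dotProduct, smul_dotProduct,
      smul_eq_mul, smul_eq_mul, dotProduct_comm y z]
    ring
  have huz : u ⬝ᵥ z = z ⬝ᵥ B *ᵥ z := dotProduct_comm _ _
  have huu : u ⬝ᵥ u = z ⬝ᵥ (B * B) *ᵥ z := (dotProduct_mulVec_self hBs z).symm
  rw [← huz] at h1
  rw [← huu] at h2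
  have c1 := abs_le.1 (abs_dotProduct_mulVec_le hb hδ h5)
  have c2 := abs_le.1 (abs_dotProduct_mulVec_le hb hδ h4)
  have c3 := abs_le.1 (abs_dotProduct_mulVec_le hb hδ h6)
  rw [← hy] at c1
  rw [← hy] at c2
  rw [← hy] at c3
  have a1 := abs_le.1 h1
  have a2 := abs_le.1 h2
  have a3 := abs_le.1 h3
  rw [htr3] at htr
  rw [hexp] at hup
  rw [hue] at hvar
  have b2 := mul_le_mul_of_nonneg_left a2.2 hη.le
  have b3 := mul_le_mul_of_nonneg_left c2.1 hκ0.le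
  have b4 := mul_le_mul_of_nonneg_left c3.2 hκ0.le
  have b5 := mul_le_mul_of_nonneg_left c1.2 (mul_nonneg hκ0.le hη.le)
  linarith [a1.1, a3.2, c1.1]

end

section

variable {d n p : ℕ} {Ω : Type*} [MeasurableSpace Ω] {P : Measure Ω}

lemma measure_quad_dev_le {S : Matrix (Fin n) (Fin n) ℝ} {Z : Ω → Fin n → ℝ}
    (hZ : IsCenteredGauss P S Z) (hS : S.PosDef) {K b ε : ℝ} (hK : 0 ≤ K) (hSK : QUpper S K)
    {M : Matrix (Fin n) (Fin n) ℝ} (hM : M.PosSemidef) (hb : 0 ≤ b) (hMb : QUpper M b)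
    (hε : 0 < ε) (hn : 1 ≤ n) :
    P {ω | ε * n ≤ |Z ω ⬝ᵥ M *ᵥ Z ω - (M * S).trace|} ≤
      ENNReal.ofReal (gaussFourth * (K * b) ^ 2 / ε ^ 2 / n) := by
  have hP := hZ.isProbabilityMeasure
  have hn0 : (0 : ℝ) < n := by exact_mod_cast hn
  obtain ⟨h1, h2⟩ := hZ.quad_variance hS hK hSK hM hb hMb
  refine (chebyshev_le h1 (by positivity) h2).trans (ENNReal.ofReal_le_ofReal (le_of_eq ?_))
  rw [Fintype.card_fin]; field_simp

lemma measure_lin_dev_le {S : Matrix (Fin n) (Fin n) ℝ} {Z : Ω → Fin n → ℝ}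
    (hZ : IsCenteredGauss P S Z) {K G ε : ℝ} (hK : 0 ≤ K) (hSK : QUpper S K)
    {y : Fin n → ℝ} (hy : y ⬝ᵥ y ≤ G * n) (hε : 0 < ε) (hn : 1 ≤ n) :
    P {ω | ε * n ≤ |y ⬝ᵥ Z ω|} ≤ ENNReal.ofReal (K * G / ε ^ 2 / n) := by
  have hP := hZ.isProbabilityMeasure
  have hn0 : (0 : ℝ) < n := by exact_mod_cast hn
  have hI : ∫ ω, (y ⬝ᵥ Z ω) ^ 2 ∂P ≤ K * (G * n) := by
    rw [hZ.integral_dotProduct_sq]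
    exact (hSK y).trans (mul_le_mul_of_nonneg_left hy hK)
  refine (chebyshev_le (hZ.integrable_dotProduct_sq y) (by positivity) hI).trans
    (ENNReal.ofReal_le_ofReal (le_of_eq ?_))
  field_simp

/-- A linear functional that is small at the basis matrices is small on the sieve. -/
lemma sieve_abs_le {x : Fin n → EuclideanSpace ℝ (Fin d)} {m : ℕ} {C : ℝ≥0 → ℝ}
    (hC : C ∈ sieveA m) {U t : ℝ} (hCU : C 0 ≤ U) (ht : 0 ≤ t)
    {φ : Matrix (Fin n) (Fin n) ℝ → ℝ} (hφ : IsLinearMap ℝ φ)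
    (h : ∀ k ∈ Finset.Icc 1 m, |φ (covMatrix x (basisFn k m))| ≤ t) :
    |φ (covMatrix x C)| ≤ U * t := by
  obtain ⟨w, hw, hCw⟩ := hC
  have h0 : ∑ k ∈ Finset.Icc 1 m, w k ≤ U := by
    have : C 0 = ∑ k ∈ Finset.Icc 1 m, w k := by rw [hCw]; simp [basisFn_zero]
    linarith
  have h1 : covMatrix x C = ∑ k ∈ Finset.Icc 1 m, w k • covMatrix x (basisFn k m) := by
    ext i j
    rw [covMatrix_apply, hCw, Matrix.sum_apply]
    rfl
  have h2 : φ (covMatrix x C) = ∑ k ∈ Finset.Icc 1 m, w k * φ (covMatrix x (basisFn k m)) := by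
    have := map_sum (hφ.mk' φ) (fun k => w k • covMatrix x (basisFn k m)) (Finset.Icc 1 m)
    simp only [IsLinearMap.mk'_apply, hφ.map_smul, smul_eq_mul] at this
    rw [h1, this]
  rw [h2]
  refine (Finset.abs_sum_le_sum_abs _ _).trans ?_
  calc _ ≤ ∑ k ∈ Finset.Icc 1 m, w k * t := Finset.sum_le_sum fun k hk => by
        rw [abs_mul, abs_of_nonneg (hw k hk)]
        exact mul_le_mul_of_nonneg_left (h k hk) (hw k hk)
    _ = (∑ k ∈ Finset.Icc 1 m, w k) * t := by rw [Finset.sum_mul]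
    _ ≤ _ := by gcongr

lemma quad_transpose_mul_self (X : Matrix (Fin n) (Fin p) ℝ) (δ : Fin p → ℝ) :
    δ ⬝ᵥ (Xᵀ * X) *ᵥ δ = (X *ᵥ δ) ⬝ᵥ (X *ᵥ δ) := by
  rw [← Matrix.mulVec_mulVec, Matrix.dotProduct_mulVec, Matrix.vecMul_transpose]

/-- An element of the sieve is dominated by its value at zero times the top basis matrix. -/
lemma qUpper_of_mem_sieveA {x : Fin n → EuclideanSpace ℝ (Fin d)} {m : ℕ} {K U : ℝ}
    {C : ℝ≥0 → ℝ} (hC : C ∈ sieveA m) (hCU : C 0 ≤ U) (hK : 0 ≤ K)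
    (htop : QUpper (covMatrix x (basisFn m m)) K) : QUpper (covMatrix x C) (U * K) := by
  intro v
  have hv := dotProduct_self_nonneg' v
  have hφ : IsLinearMap ℝ (fun A : Matrix (Fin n) (Fin n) ℝ => v ⬝ᵥ A *ᵥ v) :=
    ⟨fun A B => by simp only [Matrix.add_mulVec, dotProduct_add],
      fun a A => by simp only [Matrix.smul_mulVec, dotProduct_smul]⟩
  have := sieve_abs_le (x := x) hC hCU (mul_nonneg hK hv) hφ fun k hk => by
    obtain ⟨h1, h2⟩ := Finset.mem_Icc.1 hk
    rw [abs_of_nonneg ((basisMat_posSemidef h1 h2).quad_nonneg v)]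
    exact basisMat_qUpper htop h1 h2 v
  rw [mul_assoc]
  exact (le_abs_self _).trans this

set_option maxHeartbeats 1000000 in
/-- The residual form, uniformly over the sieve: with probability close to one it is bounded from
below by its expected regularized version and a quadratic term in the error of the mean. The
control of `residual_lower` is needed only for the finitely many elements of a net and for linear
functionals of the covariance matrix, which are determined by their values at the basis. -/
theorem exists_uniform_lower (p : ℕ) {c K U Bd η θ ζ : ℝ} (hc : 0 < c) (hK : 1 ≤ K)
    (hU : 0 < U) (hBd : 0 ≤ Bd) (hη : 0 < η) (hθ : 0 < θ) (hζ : 0 < ζ) :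
    ∃ n₀ : ℕ, ∀ n ≥ n₀, ∀ (d m : ℕ) (x : Fin n → EuclideanSpace ℝ (Fin d))
      (X : Matrix (Fin n) (Fin p) ℝ) (S : Matrix (Fin n) (Fin n) ℝ) (Z : Ω → Fin n → ℝ),
      1 ≤ m → QLower c S → QUpper S K → QUpper (covMatrix x (basisFn m m)) K →
      QUpper (Xᵀ * X) (n * K) → QLower (n * c) (Xᵀ * X) → IsCenteredGauss P S Z →
      ∃ bad : Set Ω, P bad ≤ ENNReal.ofReal ζ ∧ ∀ ω ∉ bad, ∀ C ∈ sieveA m, C 0 ≤ U →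
        (covMatrix x C).PosDef → ∀ δ : Fin p → ℝ, (∀ a, |δ a| ≤ Bd) →
          ((covMatrix x C + η • 1)⁻¹ * S).trace + (U * K + η)⁻¹ * (n * c * (δ ⬝ᵥ δ)) - θ * n ≤
            (Z ω + X *ᵥ δ) ⬝ᵥ (covMatrix x C)⁻¹ *ᵥ (Z ω + X *ᵥ δ) := by
  have hK0 : 0 < K := by linarith
  have hg := gaussFourth_nonneg
  set κ : ℝ := (U * K + η)⁻¹ with hκ
  have hκ0 : 0 < κ := by positivity
  -- half of `θ` covers the stochastic error in `residual_lower`, the other half the error of the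
  -- net
  set R : ℝ := 2 + η + U + 2 * (p * Bd) * (1 + κ * (1 + U + η)) with hR
  have hR0 : 0 < R := by positivity
  set ε : ℝ := θ / (2 * R) with hε
  have hε0 : 0 < ε := by positivity
  set ε₃ : ℝ := θ * η ^ 3 / (2 * K) with hε₃
  have hε₃0 : 0 < ε₃ := by positivity
  obtain ⟨ν, hν⟩ := exists_sieve_net hK0.le hU.le hε₃0
  set ζ' : ℝ := ζ / (2 * (ν + 1)) with hζ'
  have hζ'0 : 0 < ζ' := by positivity
  set b : ℝ := 1 / η with hb
  have hb0 : 0 < b := by positivity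
  obtain ⟨n₁, hn₁⟩ := exists_uniform_basis (P := P) p hc hK hb0 hε0 hζ'0
  set V₁ : ℝ := gaussFourth * (K * b) ^ 2 / ε ^ 2 with hV₁
  set V₂ : ℝ := gaussFourth * (K * b ^ 2) ^ 2 / ε ^ 2 with hV₂
  set V₃ : ℝ := K * K / ε ^ 2 with hV₃
  set V₄ : ℝ := K * (b ^ 2 * K) / ε ^ 2 with hV₄
  have hV₁0 : 0 ≤ V₁ := by positivity
  have hV₂0 : 0 ≤ V₂ := by positivity
  have hV₃0 : 0 ≤ V₃ := by positivity
  have hV₄0 : 0 ≤ V₄ := by positivity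
  set V : ℝ := V₁ + V₂ + p * V₃ + p * V₄ with hV
  refine ⟨max n₁ (⌈2 * (ν * V) / ζ⌉₊ + 1), ?_⟩
  intro n hn d m x X S Z hm hlow hup htop hX hXl hZ
  have hn1 : 1 ≤ n := by have := (le_max_right _ _).trans hn; omega
  have hn0 : (0 : ℝ) < n := by exact_mod_cast hn1
  have hnV : 2 * (ν * V) ≤ ζ * n := by
    have h1 : (⌈2 * (ν * V) / ζ⌉₊ : ℝ) ≤ n := by
      exact_mod_cast (Nat.le_succ _).trans ((le_max_right _ _).trans hn)
    have h2 := (Nat.le_ceil (2 * (ν * V) / ζ)).trans h1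
    rw [div_le_iff₀ hζ] at h2
    linarith
  have hSP : S.PosDef := hlow.posDef hc hZ.cov_symm
  obtain ⟨N, hN, hcov⟩ := hν n d m x hn1 hm htop
  set B : Fin ν → Matrix (Fin n) (Fin n) ℝ := fun i => (N i + η • 1)⁻¹ with hB
  have hTs : ∀ i, (N i + η • (1 : Matrix (Fin n) (Fin n) ℝ)).IsSymm := fun i =>
    (hN i).isSymm.add (Matrix.isSymm_one.smul η)
  have hTl : ∀ i, QLower η (N i + η • 1) := fun i v => by
    rw [Matrix.add_mulVec, dotProduct_add, Matrix.smul_mulVec, Matrix.one_mulVec,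
      dotProduct_smul, smul_eq_mul]
    linarith [(hN i).quad_nonneg v]
  have hBp : ∀ i, (B i).PosSemidef := fun i => ((hTl i).posDef hη (hTs i)).inv.posSemidef
  have hBu : ∀ i, QUpper (B i) b := fun i => qUpper_inv (hTs i) hη (hTl i)
  have hBBp : ∀ i, (B i * B i).PosSemidef := fun i =>
    Matrix.PosSemidef.mul_self_of_symm (hBp i).isSymm
  have hBBu : ∀ i, QUpper (B i * B i) (b ^ 2) := fun i v => by
    rw [dotProduct_mulVec_self (hBp i).isSymm]
    exact (hBp i).mulVec_sq_le hb0.le (hBu i) v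
  have hXa : ∀ a, Xᵀ a ⬝ᵥ Xᵀ a ≤ K * n := fun a => by
    have := diag_le_of_qUpper hX a
    rw [mul_comm]
    simpa [Matrix.mul_apply, dotProduct] using this
  choose F hFP hF using fun i => hn₁ n ((le_max_left _ _).trans hn) d m x X S (B i) Z hm hlow hup
    htop hX (hBp i) (hBu i) hZ
  set E₁ : Fin ν → Set Ω := fun i => {ω | ε * n ≤ |Z ω ⬝ᵥ B i *ᵥ Z ω - (B i * S).trace|} with hE₁
  set E₂ : Fin ν → Set Ω := fun i =>
    {ω | ε * n ≤ |Z ω ⬝ᵥ (B i * B i) *ᵥ Z ω - (B i * B i * S).trace|} with hE₂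
  set E₃ : Fin p → Set Ω := fun a => {ω | ε * n ≤ |Xᵀ a ⬝ᵥ Z ω|} with hE₃
  set E₄ : Fin ν → Fin p → Set Ω := fun i a => {ω | ε * n ≤ |(B i *ᵥ Xᵀ a) ⬝ᵥ Z ω|} with hE₄
  have hP₁ : ∀ i, P (E₁ i) ≤ ENNReal.ofReal (V₁ / n) := fun i =>
    measure_quad_dev_le hZ hSP hK0.le hup (hBp i) hb0.le (hBu i) hε0 hn1
  have hP₂ : ∀ i, P (E₂ i) ≤ ENNReal.ofReal (V₂ / n) := fun i =>
    measure_quad_dev_le hZ hSP hK0.le hup (hBBp i) (by positivity) (hBBu i) hε0 hn1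
  have hP₃ : P (⋃ a, E₃ a) ≤ ENNReal.ofReal (p * (V₃ / n)) :=
    measure_iUnion_fin_le fun a => measure_lin_dev_le hZ hK0.le hup (hXa a) hε0 hn1
  have hP₄ : ∀ i, P (⋃ a, E₄ i a) ≤ ENNReal.ofReal (p * (V₄ / n)) := fun i =>
    measure_iUnion_fin_le fun a => measure_lin_dev_le hZ hK0.le hup (by
      rw [mul_assoc]
      exact ((hBp i).mulVec_sq_le hb0.le (hBu i) _).trans
        (mul_le_mul_of_nonneg_left (hXa a) (by positivity))) hε0 hn1
  refine ⟨⋃ i, (F i ∪ E₁ i ∪ E₂ i ∪ (⋃ a, E₃ a) ∪ ⋃ a, E₄ i a), ?_, ?_⟩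
  · have h1 : ∀ i, P (F i ∪ E₁ i ∪ E₂ i ∪ (⋃ a, E₃ a) ∪ ⋃ a, E₄ i a) ≤
        ENNReal.ofReal (ζ' + V / n) := fun i => by
      calc _ ≤ ENNReal.ofReal ζ' + ENNReal.ofReal (V₁ / n) + ENNReal.ofReal (V₂ / n) +
            ENNReal.ofReal (p * (V₃ / n)) + ENNReal.ofReal (p * (V₄ / n)) :=
            (measure_union_le _ _).trans (add_le_add ((measure_union_le _ _).trans
              (add_le_add ((measure_union_le _ _).trans (add_le_add ((measure_union_le _ _).trans
                (add_le_add (hFP i) (hP₁ i))) (hP₂ i))) hP₃)) (hP₄ i))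
        _ = _ := by
            rw [← ENNReal.ofReal_add (by positivity) (by positivity),
              ← ENNReal.ofReal_add (by positivity) (by positivity),
              ← ENNReal.ofReal_add (by positivity) (by positivity),
              ← ENNReal.ofReal_add (by positivity) (by positivity), hV]
            congr 1
            ring
    refine (measure_iUnion_fin_le h1).trans (ENNReal.ofReal_le_ofReal ?_)
    have e1 : (ν : ℝ) * ζ' ≤ ζ / 2 := by
      rw [hζ', mul_div_assoc', div_le_div_iff₀ (by positivity) (by norm_num)]
      nlinarith
    have e2 : (ν : ℝ) * (V / n) ≤ ζ / 2 := by
      rw [mul_div_assoc', div_le_iff₀ hn0]; linarith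
    rw [mul_add]; linarith
  intro ω hω C hC hCU hCp δ hδ
  simp only [Set.mem_iUnion, Set.mem_union, not_exists, not_or] at hω
  obtain ⟨i, hi⟩ := hcov C hC hCU
  obtain ⟨⟨⟨⟨g0, g1⟩, g2⟩, g3⟩, g4⟩ := hω i
  have ht0 : 0 ≤ ε * n := by positivity
  have hFi := hF i ω g0
  have k3 : |(B i *ᵥ Z ω) ⬝ᵥ covMatrix x C *ᵥ (B i *ᵥ Z ω) -
      (covMatrix x C * (B i * S * B i)).trace| ≤ U * (ε * n) :=
    sieve_abs_le (x := x) hC hCU ht0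
      (φ := fun A => (B i *ᵥ Z ω) ⬝ᵥ A *ᵥ (B i *ᵥ Z ω) - (A * (B i * S * B i)).trace)
      ⟨fun A A' => by
        simp only [Matrix.add_mulVec, dotProduct_add, Matrix.add_mul, Matrix.trace_add]; ring,
      fun r A => by
        simp only [Matrix.smul_mulVec, dotProduct_smul, Matrix.smul_mul, Matrix.trace_smul,
          smul_eq_mul]
        ring⟩ fun k hk => (hFi k hk).1
  have k6 : ∀ a, |Xᵀ a ⬝ᵥ covMatrix x C *ᵥ (B i *ᵥ Z ω)| ≤ U * (ε * n) := fun a =>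
    sieve_abs_le (x := x) hC hCU ht0 (φ := fun A => Xᵀ a ⬝ᵥ A *ᵥ (B i *ᵥ Z ω))
      ⟨fun A A' => by simp only [Matrix.add_mulVec, dotProduct_add],
      fun r A => by simp only [Matrix.smul_mulVec, dotProduct_smul]⟩ fun k hk => (hFi k hk).2 a
  have k5 : ∀ a, |Xᵀ a ⬝ᵥ B i *ᵥ Z ω| ≤ ε * n := fun a => by
    rw [dotProduct_mulVec_comm (hBp i).isSymm, dotProduct_comm]
    exact (not_le.1 (g4 a)).le
  have hres := residual_lower (K' := U * K) hη hK0.le (by positivity) hBd hCp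
    (qUpper_of_mem_sieveA hC hCU hK0.le htop) (hN i) hZ.posSemidef hup
    (not_le.1 g1).le (not_le.1 g2).le k3 (fun a => (not_le.1 (g3 a)).le) k5 k6 hδ hi
  rw [← hκ, ← hR] at hres
  have e1 : R * (ε * n) = θ / 2 * n := by rw [hε]; field_simp
  have e2 : K * (1 / η) ^ 2 * (1 / η) * (ε₃ * n) = θ / 2 * n := by rw [hε₃]; field_simp
  have e3 : κ * (n * c * (δ ⬝ᵥ δ)) ≤ κ * ((X *ᵥ δ) ⬝ᵥ (X *ᵥ δ)) := by
    rw [← quad_transpose_mul_self]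
    exact mul_le_mul_of_nonneg_left (hXl δ) hκ0.le
  rw [e1, e2] at hres
  linarith

end

section

variable {d n p : ℕ} {Ω : Type*} [MeasurableSpace Ω] {P : Measure Ω}

/-! ### The likelihood of a competitor in the sieve -/

/-- The symmetrized entropy of two covariance matrices is of second order in their difference. -/
lemma trace_inv_mul_add_le {A B : Matrix (Fin n) (Fin n) ℝ} {a b : ℝ} (hA : A.IsSymm)
    (hB : B.IsSymm) (ha : 0 < a) (hb : 0 < b) (hAl : QLower a A) (hBl : QLower b B) :
    (B⁻¹ * A).trace + (A⁻¹ * B).trace - 2 * n ≤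
      1 / b * (1 / a) * ∑ i, ∑ j, (A i j - B i j) ^ 2 := by
  have hAp := hAl.posDef ha hA
  have hBp := hBl.posDef hb hB
  have e1 : B⁻¹ * B = 1 :=
    Matrix.nonsing_inv_mul _ ((Matrix.isUnit_iff_isUnit_det _).1 hBp.isUnit)
  have e2 : A * A⁻¹ = 1 :=
    Matrix.mul_nonsing_inv _ ((Matrix.isUnit_iff_isUnit_det _).1 hAp.isUnit)
  have e3 : A⁻¹ * A = 1 := mul_eq_one_comm.1 e2
  have h := trace_conj_conj_le (E := A - B) hBp.inv.posSemidef hAp.inv.posSemidef (hA.sub hB)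
    (p := 1 / b) (q := 1 / a) (by positivity) (qUpper_inv hB hb hBl) (qUpper_inv hA ha hAl)
  have key : B⁻¹ * ((A - B) * A⁻¹ * (A - B)) = B⁻¹ * A - 1 - 1 + A⁻¹ * B := by
    calc B⁻¹ * ((A - B) * A⁻¹ * (A - B)) = (B⁻¹ * A - B⁻¹ * B) * (A⁻¹ * A - A⁻¹ * B) := by
          rw [← mul_sub, ← mul_sub]; simp only [mul_assoc]
      _ = B⁻¹ * A - B⁻¹ * (A * A⁻¹) * B - (1 - A⁻¹ * B) := by
          rw [e1, e3, sub_mul, mul_sub, mul_one, one_mul]; simp only [mul_assoc]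
      _ = _ := by rw [e2, mul_one, e1]; abel
  rw [key, Matrix.trace_add, Matrix.trace_sub, Matrix.trace_sub, Matrix.trace_one,
    Fintype.card_fin] at h
  simp only [Matrix.sub_apply] at h
  linarith

lemma sum_sq_covMatrix_sub_le {x : Fin n → EuclideanSpace ℝ (Fin d)} {C C' : ℝ≥0 → ℝ}
    (hC : C ∈ classA) (hC' : C' ∈ classA) {K K' ε : ℝ} (hε : 0 ≤ ε) (h : ∀ t, |C t - C' t| ≤ ε)
    (hK : QUpper (covMatrix x C) K) (hK' : QUpper (covMatrix x C') K') :
    ∑ i, ∑ j, (covMatrix x C i j - covMatrix x C' i j) ^ 2 ≤ ε * ((K + K') * n) := by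
  obtain ⟨f, hf⟩ := exists_density hC
  obtain ⟨f', hf'⟩ := exists_density hC'
  have h1 := sum_covMatrix_le hK
  have h2 := sum_covMatrix_le hK'
  calc _ ≤ ∑ i, ∑ j, ε * (C (nndist (x i) (x j)) + C' (nndist (x i) (x j))) := by
        refine Finset.sum_le_sum fun i _ => Finset.sum_le_sum fun j _ => ?_
        rw [covMatrix_apply, covMatrix_apply, ← sq_abs, sq]
        refine mul_le_mul (h _) ?_ (abs_nonneg _) hε
        have a1 := hf.apply_nonneg (nndist (x i) (x j))
        have a2 := hf'.apply_nonneg (nndist (x i) (x j))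
        rw [abs_le]; constructor <;> linarith
    _ = ε * (∑ i, ∑ j, C (nndist (x i) (x j)) + ∑ i, ∑ j, C' (nndist (x i) (x j))) := by
        simp only [← Finset.mul_sum, Finset.sum_add_distrib]
    _ ≤ _ := by gcongr; linarith

/-- The sieve contains functions whose log-likelihood at the true mean is within `θ n` of its
expected optimal value. -/
theorem exists_competitor_bound (d : ℕ) {C₀ : ℝ≥0 → ℝ} {f₀ : ℝ → ℝ} (hf₀ : IsDensity C₀ f₀)
    (h0 : 0 < C₀ 0) {c K θ ζ : ℝ} (hc : 0 < c) (hc1 : c ≤ 1) (hK : 1 ≤ K) (hθ : 0 < θ)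
    (hζ : 0 < ζ) :
    ∃ m₀ n₀ : ℕ, ∀ m ≥ m₀, ∀ n ≥ n₀, ∀ (x : Fin n → EuclideanSpace ℝ (Fin d))
      (Z : Ω → Fin n → ℝ), QLower c (covMatrix x C₀) → QUpper (covMatrix x C₀) K →
      QLower c (covMatrix x (basisFn 1 1)) → QUpper (covMatrix x (basisFn m m)) K →
      IsCenteredGauss P (covMatrix x C₀) Z →
      ∃ bad : Set Ω, P bad ≤ ENNReal.ofReal ζ ∧ ∀ ω ∉ bad,
        Real.log (covMatrix x (sieveApprox f₀ m)).det +
            Z ω ⬝ᵥ (covMatrix x (sieveApprox f₀ m))⁻¹ *ᵥ Z ω ≤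
          Real.log (covMatrix x C₀).det + n + θ * n := by
  have hK0 : 0 < K := by linarith
  have hg := gaussFourth_nonneg
  obtain ⟨D, m₁, hD⟩ := exists_sieve_lower (U := C₀ 0) d hc hc1 hK h0 one_pos
  -- a distance at which the covariance has dropped substantially
  obtain ⟨h, hh1, hh⟩ := ((eventually_ge_atTop (1 : ℝ≥0)).and
    (hf₀.tendsto_atTop.eventually_le_const (show (0 : ℝ) < C₀ 0 / 4 by positivity))).exists
  have hh0 : (0 : ℝ) < h := by
    have : (1 : ℝ) ≤ h := hh1
    linarith
  set τ : ℝ := C₀ 0 / (2 * h) with hτ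
  have hτ0 : 0 < τ := by positivity
  set l : ℝ := Real.exp (-(1 / τ + D)) with hl
  have hl0 : 0 < l := Real.exp_pos _
  set ε : ℝ := min (C₀ 0 / 4) (θ * (c * l) / (2 * (C₀ 0 * K + K))) with hε
  have hε0 : 0 < ε := lt_min (by positivity) (by positivity)
  obtain ⟨m₂, hm₂⟩ := eventually_atTop.1 (sieveApprox_uniform hf₀ hε0)
  set V : ℝ := gaussFourth * (K * (1 / l)) ^ 2 / (θ / 2) ^ 2 with hV
  refine ⟨max 1 (max m₁ m₂), ⌈V / ζ⌉₊ + 1, fun m hm n hn x Z hlow hup h11 htop hZ => ?_⟩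
  have hm1 : 1 ≤ m := (le_max_left _ _).trans hm
  have hn1 : 1 ≤ n := by omega
  have hn0 : (0 : ℝ) < n := by exact_mod_cast hn1
  set C := sieveApprox f₀ m with hC
  have hCs : C ∈ sieveA m := sieveApprox_mem_sieveA hf₀ hm1
  have hC0 : C 0 = C₀ 0 := sieveApprox_zero hf₀ m
  have hap := hm₂ m (((le_max_right _ _).trans (le_max_right _ _)).trans hm)
  obtain ⟨f, hf⟩ := exists_density (sieveA_subset_classA m hCs)
  have hdeg : τ ≤ degen f := by
    have h1 := hf.sub_le_degen hh1
    have h2 := (abs_le.1 (hap h)).2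
    have h3 : ε ≤ C₀ 0 / 4 := min_le_left _ _
    rw [hτ, div_le_iff₀ (by positivity)]
    nlinarith
  have hSl : QLower l (covMatrix x C) := by
    refine (hD m (((le_max_left _ _).trans (le_max_right _ _)).trans hm) n x h11 htop C f hf hCs
      hC0.ge hC0.le).mono (Real.exp_le_exp.2 ?_)
    have := one_div_le_one_div_of_le hτ0 hdeg
    linarith
  have hSs := covMatrix_isSymm x C
  have hS₀s := covMatrix_isSymm x C₀
  have hSp := hSl.posDef hl0 hSs
  have hS₀p := hlow.posDef hc hS₀s
  have hSu : QUpper (covMatrix x C) (C₀ 0 * K) := qUpper_of_mem_sieveA hCs hC0.le hK0.le htop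
  refine ⟨_, (measure_quad_dev_le hZ hS₀p hK0.le hup hSp.inv.posSemidef
    (b := 1 / l) (by positivity) (qUpper_inv hSs hl0 hSl) (half_pos hθ) hn1).trans
      (ENNReal.ofReal_le_ofReal ?_), fun ω hω => ?_⟩
  · have h1 : (⌈V / ζ⌉₊ : ℝ) ≤ n := by exact_mod_cast (by omega)
    have h2 := (Nat.le_ceil (V / ζ)).trans h1
    rw [div_le_iff₀ hζ] at h2
    rw [div_le_iff₀ hn0]; linarith
  rw [Set.mem_ofPred_eq, not_le] at hω
  have h1 := (abs_lt.1 hω).2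
  have h2 := logdet_sub_le_trace hSp hS₀p
  rw [Fintype.card_fin] at h2
  have h3 := trace_inv_mul_add_le hSs hS₀s hl0 hc hSl hlow
  have h4 := sum_sq_covMatrix_sub_le (x := x) (sieveA_subset_classA m hCs) hf₀.mem_classA hε0.le hap
    hSu hup
  have h5 : 1 / c * (1 / l) * (ε * ((C₀ 0 * K + K) * n)) ≤ θ / 2 * n := by
    have h6 : ε ≤ θ * (c * l) / (2 * (C₀ 0 * K + K)) := min_le_right _ _
    calc _ ≤ 1 / c * (1 / l) *
          (θ * (c * l) / (2 * (C₀ 0 * K + K)) * ((C₀ 0 * K + K) * n)) := by gcongr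
      _ = θ / 2 * n := by field_simp
  have h6 := mul_le_mul_of_nonneg_left h4 (show 0 ≤ 1 / c * (1 / l) by positivity)
  linarith

/-! ### Likelihood dominance forces proximity -/

/-- The Gaussian relative entropy with the inverse regularized by `η` still dominates the Frobenius
distance, up to an error of order `η n`. -/
lemma discrepancy_le {Sg S : Matrix (Fin n) (Fin n) ℝ} {c K K' l η : ℝ} (hc : 0 < c)
    (hK : 0 < K) (hK' : 0 < K') (hl : 0 < l) (hη : 0 < η) (hη1 : η ≤ 1) (hSg : Sg.IsSymm)
    (hSgl : QLower l Sg) (hSgu : QUpper (Sg + η • 1) K') (hS : S.IsSymm) (hSl : QLower c S)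
    (hSu : QUpper S K) :
    (∑ i, ∑ j, (Sg i j - S i j) ^ 2) / (2 * (K ^ 2 * (K' / c * (1 + √(K' / c)) ^ 2))) -
        (1 / (K ^ 2 * (K' / c * (1 + √(K' / c)) ^ 2)) + 1 / l) * η * n ≤
      Real.log Sg.det + ((Sg + η • 1)⁻¹ * S).trace - Real.log S.det - n := by
  set T := Sg + η • (1 : Matrix (Fin n) (Fin n) ℝ) with hT
  set Q := K ^ 2 * (K' / c * (1 + √(K' / c)) ^ 2) with hQ
  have hQ0 : 0 < Q := by positivity
  have hSgp := hSgl.posDef hl hSg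
  have hTs : T.IsSymm := hSg.add (Matrix.isSymm_one.smul η)
  have hTl : QLower η T := fun v => by
    rw [hT, Matrix.add_mulVec, dotProduct_add, Matrix.smul_mulVec, Matrix.one_mulVec,
      dotProduct_smul, smul_eq_mul]
    linarith [hSgp.posSemidef.quad_nonneg v]
  have hTp := hTl.posDef hη hTs
  have h1 := frobenius_le_entropy hTp (hSl.posDef hc hS) hc hK.le hSl hSu hSgu hK'.le
  have h2 := logdet_sub_le_trace hTp hSgp
  rw [Fintype.card_fin] at h1 h2
  have h3 : (Sg⁻¹ * T).trace ≤ n + 1 / l * η * n := by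
    have e1 : Sg⁻¹ * T = 1 + η • (Sg⁻¹ * 1) := by
      rw [hT, mul_add, Matrix.nonsing_inv_mul _ ((Matrix.isUnit_iff_isUnit_det _).1 hSgp.isUnit),
        Matrix.mul_smul]
    have e2 := trace_mul_le hSgp.inv.posSemidef.isSymm (qUpper_inv hSg hl hSgl)
      (Matrix.PosSemidef.one (n := Fin n) (R := ℝ))
    rw [Matrix.trace_one, Fintype.card_fin] at e2
    rw [e1, Matrix.trace_add, Matrix.trace_one, Fintype.card_fin, Matrix.trace_smul, smul_eq_mul]
    nlinarith
  have h4 : ∑ i, ∑ j, (Sg i j - S i j) ^ 2 ≤ 2 * ∑ i, ∑ j, (T i j - S i j) ^ 2 + 2 * η * n := by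
    have e1 : ∀ i j, (Sg i j - S i j) ^ 2 ≤
        2 * (T i j - S i j) ^ 2 + 2 * η * (1 : Matrix (Fin n) (Fin n) ℝ) i j := fun i j => by
      have e2 : T i j = Sg i j + η * (1 : Matrix (Fin n) (Fin n) ℝ) i j := by
        simp [hT, Matrix.add_apply]
      rw [e2]
      by_cases hij : i = j
      · subst hij
        rw [Matrix.one_apply_eq]
        nlinarith [sq_nonneg (Sg i i - S i i + 2 * η)]
      · rw [Matrix.one_apply_ne hij]
        nlinarith [sq_nonneg (Sg i j - S i j)]
    calc _ ≤ ∑ i, ∑ j, (2 * (T i j - S i j) ^ 2 +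
          2 * η * (1 : Matrix (Fin n) (Fin n) ℝ) i j) :=
          Finset.sum_le_sum fun i _ => Finset.sum_le_sum fun j _ => e1 i j
      _ = _ := by
          simp only [Finset.sum_add_distrib, ← Finset.mul_sum, Matrix.one_apply]
          simp
  have h5 : (∑ i, ∑ j, (Sg i j - S i j) ^ 2) / (2 * Q) ≤
      (∑ i, ∑ j, (T i j - S i j) ^ 2) / Q + 1 / Q * η * n := by
    rw [div_le_iff₀ (by positivity)]
    calc _ ≤ _ := h4
      _ = _ := by field_simp
  rw [add_mul, add_mul]
  linarith

set_option maxHeartbeats 1000000 in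
/-- With probability close to one, every element of the sieve whose likelihood is at least that of
the sieve approximation of the truth is close to the truth, in Frobenius norm for the covariance
and in Euclidean norm for the mean. -/
theorem exists_mle_bound (d p : ℕ) {C₀ : ℝ≥0 → ℝ} {f₀ : ℝ → ℝ} (hf₀ : IsDensity C₀ f₀)
    (h0 : 0 < C₀ 0) {c K L U Bd e R c₁ c₂ ζ : ℝ} (hc : 0 < c) (hc1 : c ≤ 1) (hK : 1 ≤ K)
    (hL : 0 < L) (hU : 0 < U) (hBd : 0 ≤ Bd) (he : 0 < e) (hc₁ : 0 < c₁) (hc₂ : 0 < c₂)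
    (hζ : 0 < ζ) :
    ∃ m₀ n₀ : ℕ, ∀ m ≥ m₀, ∀ n ≥ n₀, ∀ (x : Fin n → EuclideanSpace ℝ (Fin d))
      (X : Matrix (Fin n) (Fin p) ℝ) (Z : Ω → Fin n → ℝ),
      QLower c (covMatrix x C₀) → QUpper (covMatrix x C₀) K →
      QLower c (covMatrix x (basisFn 1 1)) → QUpper (covMatrix x (basisFn 1 1)) K →
      QUpper (covMatrix x (basisFn m m)) K →
      QUpper (Xᵀ * X) (n * K) → QLower (n * c) (Xᵀ * X) →
      e * n ≤ (nbrLap x R).trace → IsCenteredGauss P (covMatrix x C₀) Z →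
      ∃ bad : Set Ω, P bad ≤ ENNReal.ofReal ζ ∧ ∀ ω ∉ bad, ∀ C ∈ sieveA m, L ≤ C 0 → C 0 ≤ U →
        ∀ δ : Fin p → ℝ, (∀ a, |δ a| ≤ Bd) →
          Real.log (covMatrix x C).det +
              (Z ω + X *ᵥ δ) ⬝ᵥ (covMatrix x C)⁻¹ *ᵥ (Z ω + X *ᵥ δ) ≤
            Real.log (covMatrix x (sieveApprox f₀ m)).det +
              Z ω ⬝ᵥ (covMatrix x (sieveApprox f₀ m))⁻¹ *ᵥ Z ω →
          ∑ i, ∑ j, (covMatrix x C i j - covMatrix x C₀ i j) ^ 2 < c₁ * n ∧ δ ⬝ᵥ δ < c₂ := by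
  have hK0 : 0 < K := by linarith
  have hζ3 : 0 < ζ / 3 := by positivity
  obtain ⟨a, ha, n₁, hdeg⟩ := exists_degenerate_bound (P := P) (R := R) d p hc hK hBd he hζ3
  obtain ⟨D, m₁, hlow⟩ := exists_sieve_lower (U := U) d hc hc1 hK hL (half_pos ha)
  -- below the degeneracy `τ`, the bound `a / (2 τ) - D` exceeds the deviance of the competitor
  set τ : ℝ := a / (2 * (|D| + K + 2)) with hτ
  have hτ0 : 0 < τ := by positivity
  set l : ℝ := Real.exp (-(a / 2 / τ + D)) with hl
  have hl0 : 0 < l := Real.exp_pos _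
  set K' : ℝ := U * K + 1 with hK'
  have hK'0 : 0 < K' := by positivity
  set Q : ℝ := K ^ 2 * (K' / c * (1 + √(K' / c)) ^ 2) with hQ
  have hQ0 : 0 < Q := by positivity
  -- the excess deviance that is to be ruled out; the regularization and the stochastic error are
  -- chosen small compared to it
  set g : ℝ := min (c₁ / (2 * Q)) (c / K' * c₂) with hg
  have hg0 : 0 < g := lt_min (by positivity) (by positivity)
  set η : ℝ := min 1 (g / (4 * (1 / Q + 1 / l))) with hη
  have hη0 : 0 < η := lt_min one_pos (by positivity)
  have hη1 : η ≤ 1 := min_le_left _ _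
  have hηg : (1 / Q + 1 / l) * η ≤ g / 4 := by
    calc (1 / Q + 1 / l) * η ≤ (1 / Q + 1 / l) * (g / (4 * (1 / Q + 1 / l))) := by
          gcongr; exact min_le_right _ _
      _ = g / 4 := by field_simp
  set θ : ℝ := min 1 (g / 4) with hθ
  have hθ0 : 0 < θ := lt_min one_pos (by positivity)
  have hθ1 : θ ≤ 1 := min_le_left _ _
  have hθg : θ ≤ g / 4 := min_le_right _ _
  obtain ⟨n₂, hunif⟩ := exists_uniform_lower (P := P) p hc hK hU hBd hη0 hθ0 hζ3
  obtain ⟨m₃, n₃, hcomp⟩ := exists_competitor_bound (P := P) d hf₀ h0 hc hc1 hK hθ0 hζ3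
  refine ⟨max 1 (max m₁ m₃), max 1 (max n₁ (max n₂ n₃)), ?_⟩
  intro m hm n hn x X Z hS₀l hS₀u h11l h11u htop hXu hXl hlap hZ
  simp only [ge_iff_le, max_le_iff] at hm hn
  obtain ⟨hm1, hmm₁, hmm₃⟩ := hm
  obtain ⟨hn1, hnn₁, hnn₂, hnn₃⟩ := hn
  have hn0 : (0 : ℝ) < n := by exact_mod_cast hn1
  obtain ⟨b₁, hb₁, hdeg⟩ := hdeg n hnn₁ x X C₀ Z hS₀l hS₀u h11u hXu hlap hZ
  obtain ⟨b₂, hb₂, hunif⟩ := hunif n hnn₂ d m x X _ Z hm1 hS₀l hS₀u htop hXu hXl hZ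
  obtain ⟨b₃, hb₃, hcomp⟩ := hcomp m hmm₃ n hnn₃ x Z hS₀l hS₀u h11l htop hZ
  refine ⟨b₁ ∪ b₂ ∪ b₃, ?_, ?_⟩
  · calc _ ≤ ENNReal.ofReal (ζ / 3) + ENNReal.ofReal (ζ / 3) + ENNReal.ofReal (ζ / 3) :=
          (measure_union_le _ _).trans (add_le_add ((measure_union_le _ _).trans
            (add_le_add hb₁ hb₂)) hb₃)
      _ = ENNReal.ofReal ζ := by
          rw [← ENNReal.ofReal_add (by positivity) (by positivity),
            ← ENNReal.ofReal_add (by positivity) (by positivity)]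
          congr 1; ring
  intro ω hω C hC hCL hCU δ hδ hlik
  simp only [Set.mem_union, not_or] at hω
  obtain ⟨⟨hω₁, hω₂⟩, hω₃⟩ := hω
  obtain ⟨f, hf⟩ := exists_density (sieveA_subset_classA m hC)
  have hCl := hlow m hmm₁ n x h11l htop C f hf hC hCL hCU
  have hCs := covMatrix_isSymm x C
  have hCp := hCl.posDef (Real.exp_pos _) hCs
  have hC0 : 0 < C 0 := hL.trans_le hCL
  have hS₀p := hS₀l.posDef hc (covMatrix_isSymm x C₀)
  have hrhs := hlik.trans (hcomp ω hω₃)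
  -- a nearly degenerate covariance function is excluded, as the residual form would be too large
  have hτf : τ ≤ degen f := by
    by_contra hcon
    have hcon := not_le.1 hcon
    have hf0 := hf.degen_pos hC0
    have h1 := hdeg ω hω₁ C f hf hC0 hCp δ hδ
    have h2 := logdet_ge hCs (Real.exp_pos _) hCl
    rw [Real.log_exp, Fintype.card_fin] at h2
    have h3 := logdet_sub_le_trace hS₀p (Matrix.PosDef.one (n := Fin n) (R := ℝ))
    have h4 : (covMatrix x C₀).trace ≤ K * n := by
      have := trace_mul_le (covMatrix_isSymm x C₀) hS₀u
        (Matrix.PosSemidef.one (n := Fin n) (R := ℝ))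
      rwa [mul_one, Matrix.trace_one, Fintype.card_fin] at this
    rw [Matrix.det_one, Real.log_one, inv_one, one_mul, Fintype.card_fin] at h3
    have h5 : |D| + K + 2 < a / 2 / degen f := by
      rw [lt_div_iff₀ hf0]
      rw [hτ, lt_div_iff₀ (by positivity)] at hcon
      linarith
    have h6 : a * n / degen f = n * (2 * (a / 2 / degen f)) := by ring
    rw [h6] at h1
    have h7 := le_abs_self D
    have h8 : (n : ℝ) * (a / 2 / degen f - D) ≤ n * (K + θ) := by nlinarith
    have h9 := le_of_mul_le_mul_left h8 hn0
    linarith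
  have hCl' : QLower l (covMatrix x C) := hCl.mono (Real.exp_le_exp.2 (by
    have : a / 2 / degen f ≤ a / 2 / τ := by gcongr
    linarith))
  have hTu : QUpper (covMatrix x C + η • 1) K' := fun v => by
    rw [Matrix.add_mulVec, dotProduct_add, Matrix.smul_mulVec, Matrix.one_mulVec,
      dotProduct_smul, smul_eq_mul]
    have h1 := qUpper_of_mem_sieveA hC hCU hK0.le htop v
    have h2 := mul_le_mul_of_nonneg_right hη1 (dotProduct_self_nonneg' v)
    rw [hK', add_mul]
    linarith
  have hdisc := discrepancy_le hc hK0 hK'0 hl0 hη0 hη1 hCs hCl' hTu (covMatrix_isSymm x C₀) hS₀l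
    hS₀u
  rw [← hQ] at hdisc
  have hun := hunif ω hω₂ C hC hCU hCp δ hδ
  have hδ0 := dotProduct_self_nonneg' δ
  have hκ : c / K' * (δ ⬝ᵥ δ) * n ≤ (U * K + η)⁻¹ * (n * c * (δ ⬝ᵥ δ)) := by
    have : K'⁻¹ ≤ (U * K + η)⁻¹ := inv_anti₀ (by positivity) (by rw [hK']; linarith)
    calc _ = K'⁻¹ * (n * c * (δ ⬝ᵥ δ)) := by ring
      _ ≤ _ := by gcongr
  have hηn := mul_le_mul_of_nonneg_right hηg hn0.le
  have hθn := mul_le_mul_of_nonneg_right hθg hn0.le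
  have hgn : 0 < g * n := by positivity
  set F := ∑ i, ∑ j, (covMatrix x C i j - covMatrix x C₀ i j) ^ 2 with hF
  have hF0 : 0 ≤ F := Finset.sum_nonneg fun i _ => Finset.sum_nonneg fun j _ => sq_nonneg _
  have hsum : F / (2 * Q) + c / K' * (δ ⬝ᵥ δ) * n < g * n := by linarith
  have hF0' : 0 ≤ F / (2 * Q) := by positivity
  have hδ0' : 0 ≤ c / K' * (δ ⬝ᵥ δ) * n := by positivity
  constructor
  · have h1 : F / (2 * Q) < c₁ / (2 * Q) * n := by
      have := mul_le_mul_of_nonneg_right (min_le_left (c₁ / (2 * Q)) (c / K' * c₂)) hn0.le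
      linarith
    rw [div_mul_eq_mul_div] at h1
    exact (div_lt_div_iff_of_pos_right (by positivity)).1 h1
  · have h1 : c / K' * (δ ⬝ᵥ δ) * n < c / K' * c₂ * n := by
      have := mul_le_mul_of_nonneg_right (min_le_right (c₁ / (2 * Q)) (c / K' * c₂)) hn0.le
      linarith
    exact lt_of_mul_lt_mul_left (lt_of_mul_lt_mul_right h1 hn0.le) (by positivity)

end

section

/-! ### Extraction of the constants -/

lemma exists_eventually_le_of_limsup {u : ℕ → EReal} (h : limsup u atTop < ⊤) :
    ∃ K : ℝ, ∀ᶠ n in atTop, u n ≤ (K : EReal) := by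
  obtain ⟨K, hK, -⟩ := EReal.lt_iff_exists_real_btwn.1 h
  exact ⟨K, (eventually_lt_of_limsup_lt hK).mono fun n hn => hn.le⟩

lemma exists_eventually_lt_of_liminf {u : ℕ → EReal} (h : 0 < liminf u atTop) :
    ∃ c : ℝ, 0 < c ∧ ∀ᶠ n in atTop, (c : EReal) < u n := by
  obtain ⟨c, hc, hc'⟩ := EReal.lt_iff_exists_real_btwn.1 h
  exact ⟨c, by exact_mod_cast hc, eventually_lt_of_lt_liminf hc'⟩

/-- Some multiple of a basis function has the same value at zero as a given covariance function
without being equal to it. -/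
lemma exists_basis_ne (C₀ : ℝ≥0 → ℝ) (h0 : 0 < C₀ 0) :
    ∃ k : ℕ, 1 ≤ k ∧ C₀ 0 * basisFn k k 1 ≠ C₀ 1 := by
  by_cases h : C₀ 0 * basisFn 1 1 1 = C₀ 1
  · refine ⟨2, by norm_num, fun h2 => ?_⟩
    rw [← h] at h2
    have := mul_left_cancel₀ h0.ne' h2
    rw [basisFn_self, basisFn_self] at this
    norm_num at this
  · exact ⟨1, le_rfl, h⟩

lemma covDiscrepancy_eq {d n : ℕ} (x : Fin n → EuclideanSpace ℝ (Fin d)) (C C₀ : ℝ≥0 → ℝ) :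
    covDiscrepancy x C C₀ =
      1 / n * ∑ i, ∑ j, (covMatrix x C i j - covMatrix x C₀ i j) ^ 2 := rfl

lemma designMatrix_mulVec_apply {p n : ℕ} (X : Fin n → EuclideanSpace ℝ (Fin p))
    (β : EuclideanSpace ℝ (Fin p)) (i : Fin n) :
    (designMatrix X *ᵥ β.ofLp) i = inner ℝ (X i) β := by
  rw [PiLp.inner_apply]
  simp [designMatrix, Matrix.mulVec, dotProduct, mul_comm]

lemma residual_eq {p n : ℕ} (X : Fin n → EuclideanSpace ℝ (Fin p)) (y : Fin n → ℝ)
    (β β₀ : EuclideanSpace ℝ (Fin p)) :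
    y - designMatrix X *ᵥ β.ofLp =
      (fun i => y i - inner ℝ (X i) β₀) + designMatrix X *ᵥ (β₀ - β).ofLp := by
  ext i
  rw [Pi.sub_apply, Pi.add_apply, WithLp.ofLp_sub, Matrix.mulVec_sub, Pi.sub_apply,
    designMatrix_mulVec_apply, designMatrix_mulVec_apply]
  ring

end

end SieveCov

open SieveCov

theorem theorem2
    {d p : ℕ}
    -- the spatial region, the predictors and the observed Gaussian process
    (S : Set (EuclideanSpace ℝ (Fin d)))
    (X : S → EuclideanSpace ℝ (Fin p))
    {Ω : Type*} [MeasurableSpace Ω] (P : Measure Ω) [IsProbabilityMeasure P]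
    (Y : S → Ω → ℝ)
    -- the bounds of the parameter space and the true parameter, an interior point
    (Uβ L U : ℝ) (hL : 0 < L)
    (β₀ : EuclideanSpace ℝ (Fin p)) (C₀ : ℝ≥0 → ℝ)
    (hint : SieveCov.IsInteriorParam Uβ L U (β₀, C₀))
    -- the law of the process under the true parameter
    (hGauss : IsGaussianProcess Y P)
    (hmean : ∀ t : S, ∫ ω, Y t ω ∂P = inner ℝ (X t) β₀)
    (hcov : ∀ t u : S, cov[Y t, Y u; P] = C₀ (nndist (t : EuclideanSpace ℝ (Fin d)) u))
    -- the sampling locations and the sieve order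
    (s : (n : ℕ) → Fin n → S)
    (m : ℕ → ℕ) (hm_pos : ∀ n, 1 ≤ m n) (hm : Tendsto m atTop atTop)
    -- identifiability
    (hident : ∀ θ ∈ SieveCov.paramSpace p Uβ L U, θ ≠ (β₀, C₀) →
      ∃ n : ℕ, 1 ≤ n ∧
        (SieveCov.covMatrix (fun i => (s n i : EuclideanSpace ℝ (Fin d))) C₀ ≠
            SieveCov.covMatrix (fun i => (s n i : EuclideanSpace ℝ (Fin d))) θ.2 ∨
          SieveCov.designMatrix (fun i => X (s n i)) *ᵥ θ.1.ofLp ≠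
            SieveCov.designMatrix (fun i => X (s n i)) *ᵥ β₀.ofLp))
    -- eigenvalue bounds on `XᵀX / n`
    (hX_max : limsup (fun n : ℕ => SieveCov.lamMax ((1 / (n : ℝ)) •
      ((SieveCov.designMatrix fun i => X (s n i))ᵀ *
        (SieveCov.designMatrix fun i => X (s n i))))) atTop < ⊤)
    (hX_min : 0 < liminf (fun n : ℕ => SieveCov.lamMin ((1 / (n : ℝ)) •
      ((SieveCov.designMatrix fun i => X (s n i))ᵀ *
        (SieveCov.designMatrix fun i => X (s n i))))) atTop)
    -- eigenvalue bounds on the true covariance matrices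
    (hCov_max : limsup (fun n : ℕ => SieveCov.lamMax
      (SieveCov.covMatrix (fun i => (s n i : EuclideanSpace ℝ (Fin d))) C₀)) atTop < ⊤)
    (hCov_min : 0 < liminf (fun n : ℕ => SieveCov.lamMin
      (SieveCov.covMatrix (fun i => (s n i : EuclideanSpace ℝ (Fin d))) C₀)) atTop)
    -- eigenvalue bounds on the basis matrices, for each fixed order
    (hA_max : ∀ k : ℕ, 1 ≤ k → limsup (fun n : ℕ => SieveCov.lamMax
      (SieveCov.covMatrix (fun i => (s n i : EuclideanSpace ℝ (Fin d)))
        (SieveCov.basisFn k k))) atTop < ⊤)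
    (hA_min : ∀ k : ℕ, 1 ≤ k → 0 < liminf (fun n : ℕ => SieveCov.lamMin
      (SieveCov.covMatrix (fun i => (s n i : EuclideanSpace ℝ (Fin d)))
        (SieveCov.basisFn k k))) atTop)
    -- upper eigenvalue bound on the basis matrices along the sieve order `m n`
    (hAm_max : limsup (fun n : ℕ => SieveCov.lamMax
      (SieveCov.covMatrix (fun i => (s n i : EuclideanSpace ℝ (Fin d)))
        (SieveCov.basisFn (m n) (m n)))) atTop < ⊤)
    -- covariance functions away from `C₀` are separated from it by the design
    (hsep : ∀ ε : ℝ, 0 < ε → 0 < liminf (fun n : ℕ =>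
      ⨅ C ∈ {C : ℝ≥0 → ℝ | C ∈ SieveCov.covSpace L U ∧ ε ≤ SieveCov.supNorm (C - C₀)},
        ((SieveCov.covDiscrepancy (fun i => (s n i : EuclideanSpace ℝ (Fin d))) C C₀ : ℝ) :
          EReal)) atTop)
    -- the sieve maximum likelihood estimators
    (θhat : ℕ → Ω → EuclideanSpace ℝ (Fin p) × (ℝ≥0 → ℝ))
    (hθhat : ∀ n, ∀ᵐ ω ∂P, SieveCov.IsSieveMLE Uβ L U (m n)
      (fun i => (s n i : EuclideanSpace ℝ (Fin d))) (fun i => X (s n i))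
      (fun i => Y (s n i) ω) (θhat n ω)) :
    ∀ ε : ℝ, 0 < ε →
      Tendsto (fun n => P {ω | ε ≤ SieveCov.dbar (θhat n ω) (β₀, C₀)}) atTop (𝓝 0) := by
  intro ε hε
  obtain ⟨⟨hβ₀, hC₀, hLC₀, hC₀U⟩, -⟩ := hint
  have hβ₀' : ‖β₀‖ ≤ Uβ := hβ₀
  have hUβ : 0 ≤ Uβ := (norm_nonneg _).trans hβ₀'
  rw [supNorm_eq hC₀] at hLC₀ hC₀U
  obtain ⟨f₀, hf₀⟩ := exists_density hC₀
  have h0 : 0 < C₀ 0 := hL.trans_le hLC₀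
  have hU : 0 < U := h0.trans_le hC₀U
  -- a covariance function with the same variance as the truth, to which `hsep` is applied in order
  -- to see that the sites have many neighbours
  obtain ⟨k, hk, hne⟩ := exists_basis_ne C₀ h0
  set C₁ : ℝ≥0 → ℝ := fun h => C₀ 0 * basisFn k k h with hC₁
  have hC₁A : C₁ ∈ classA := classA_smul (basisFn_mem_classA hk le_rfl) h0.le
  have hC₁0 : C₁ 0 = C₀ 0 := by simp [hC₁, basisFn_zero]
  have hC₁ε : 0 < supNorm (C₁ - C₀) :=
    (abs_pos.2 (sub_ne_zero.2 hne)).trans_le (abs_sub_le_supNorm hC₁A hC₀ 1)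
  obtain ⟨K₁, hK₁⟩ := exists_eventually_le_of_limsup hX_max
  obtain ⟨K₂, hK₂⟩ := exists_eventually_le_of_limsup hCov_max
  obtain ⟨K₃, hK₃⟩ := exists_eventually_le_of_limsup (hA_max 1 le_rfl)
  obtain ⟨K₄, hK₄⟩ := exists_eventually_le_of_limsup (hA_max k hk)
  obtain ⟨K₅, hK₅⟩ := exists_eventually_le_of_limsup hAm_max
  obtain ⟨c₁, hc₁, hc₁'⟩ := exists_eventually_lt_of_liminf hX_min
  obtain ⟨c₂, hc₂, hc₂'⟩ := exists_eventually_lt_of_liminf hCov_min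
  obtain ⟨c₃, hc₃, hc₃'⟩ := exists_eventually_lt_of_liminf (hA_min 1 le_rfl)
  obtain ⟨b, hb, hb'⟩ := exists_eventually_lt_of_liminf (hsep _ hC₁ε)
  obtain ⟨q, hq, hq'⟩ := exists_eventually_lt_of_liminf (hsep (ε / 2) (half_pos hε))
  set K : ℝ := max 1 (max K₁ (max K₂ (max K₃ (max K₄ K₅)))) with hK
  set c : ℝ := min 1 (min c₁ (min c₂ c₃)) with hc
  have hK1 : 1 ≤ K := le_max_left _ _
  have hKK : K₁ ≤ K ∧ K₂ ≤ K ∧ K₃ ≤ K ∧ K₄ ≤ K ∧ K₅ ≤ K := by simp [hK]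
  have hc0 : 0 < c := lt_min one_pos (lt_min hc₁ (lt_min hc₂ hc₃))
  have hc1 : c ≤ 1 := min_le_left _ _
  have hcc : c ≤ c₁ ∧ c ≤ c₂ ∧ c ≤ c₃ := by simp [hc]
  obtain ⟨hKK₁, hKK₂, hKK₃, hKK₄, hKK₅⟩ := hKK
  obtain ⟨hcc₁, hcc₂, hcc₃⟩ := hcc
  obtain ⟨R, e, he, hnbr⟩ := exists_nbr_lower (d := d) hC₀ hC₁A hC₁0 (K := K) (K₁ := C₀ 0 * K)
    (by positivity) (by positivity) hb
  rw [ENNReal.tendsto_nhds_zero]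
  intro ζ' hζ'
  set ζ : ℝ := (min ζ' 1).toReal with hζ
  have hζt : min ζ' 1 ≠ ⊤ := ne_top_of_le_ne_top ENNReal.one_ne_top (min_le_right _ _)
  have hζ0 : 0 < ζ := ENNReal.toReal_pos (lt_min hζ' one_pos).ne' hζt
  have hζζ : ENNReal.ofReal ζ ≤ ζ' := by
    rw [hζ, ENNReal.ofReal_toReal hζt]; exact min_le_left _ _
  obtain ⟨m₀, n₀, hmain⟩ := exists_mle_bound (P := P) (U := U) (Bd := 2 * Uβ) (R := R)
    (c₂ := (ε / 2) ^ 2) d p hf₀ h0 hc0 hc1 hK1 hL hU (by positivity) he hq (by positivity) hζ0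
  filter_upwards [hK₁, hK₂, hK₃, hK₄, hK₅, hc₁', hc₂', hc₃', hb', hq', hm.eventually_ge_atTop m₀,
    eventually_ge_atTop n₀, eventually_ge_atTop 1] with n g₁ g₂ g₃ g₄ g₅ l₁ l₂ l₃ hbn hqn hmn hn hn1
  have hn0 : (0 : ℝ) < n := by exact_mod_cast hn1
  set x : Fin n → EuclideanSpace ℝ (Fin d) := fun i => (s n i : EuclideanSpace ℝ (Fin d)) with hx
  set M : Matrix (Fin n) (Fin p) ℝ := designMatrix fun i => X (s n i) with hM
  set Z : Ω → Fin n → ℝ := fun ω i => Y (s n i) ω - inner ℝ (X (s n i)) β₀ with hZdef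
  have hZ : IsCenteredGauss P (covMatrix x C₀) Z := by
    have := IsCenteredGauss.of_process hGauss (fun t => inner ℝ (X t) β₀) hmean (s n)
    simp only [hcov] at this
    exact this
  have hup : ∀ {C : ℝ≥0 → ℝ} {κ : ℝ}, lamMax (covMatrix x C) ≤ (κ : EReal) → κ ≤ K →
      QUpper (covMatrix x C) K := fun h h' => (qUpper_of_lamMax_le (covMatrix_isSymm _ _) h).mono h'
  have hlo : ∀ {C : ℝ≥0 → ℝ} {κ : ℝ}, (κ : EReal) < lamMin (covMatrix x C) → c ≤ κ →
      QLower c (covMatrix x C) := fun h h' =>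
    (qLower_of_le_lamMin (covMatrix_isSymm _ _) h.le).mono h'
  have hMs : ((1 / (n : ℝ)) • (Mᵀ * M)).IsSymm := by
    rw [Matrix.IsSymm, Matrix.transpose_smul, Matrix.transpose_mul, Matrix.transpose_transpose]
  have hMq : ∀ v : Fin p → ℝ, v ⬝ᵥ ((1 / (n : ℝ)) • (Mᵀ * M)) *ᵥ v =
      1 / n * (v ⬝ᵥ (Mᵀ * M) *ᵥ v) := fun v => by
    rw [Matrix.smul_mulVec, dotProduct_smul, smul_eq_mul]
  have hMu : QUpper (Mᵀ * M) (n * K) := fun v => by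
    have := (qUpper_of_lamMax_le hMs g₁).mono hKK₁ v
    rw [hMq, one_div, inv_mul_le_iff₀ hn0] at this
    linarith
  have hMl : QLower (n * c) (Mᵀ * M) := fun v => by
    have := (qLower_of_le_lamMin hMs l₁.le).mono hcc₁ v
    rw [hMq, one_div, le_inv_mul_iff₀ hn0] at this
    linarith
  have hS₀u := hup g₂ hKK₂
  have hC₁u : QUpper (covMatrix x C₁) (C₀ 0 * K) := fun v => by
    have e1 : covMatrix x C₁ = C₀ 0 • covMatrix x (basisFn k k) := rfl
    rw [e1, Matrix.smul_mulVec, dotProduct_smul, smul_eq_mul, mul_assoc]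
    exact mul_le_mul_of_nonneg_left (hup g₄ hKK₄ v) h0.le
  have hlap : e * n ≤ (nbrLap x R).trace := by
    refine hnbr n x hS₀u hC₁u ?_
    have hmem : C₁ ∈ {C : ℝ≥0 → ℝ | C ∈ covSpace L U ∧ supNorm (C₁ - C₀) ≤ supNorm (C - C₀)} :=
      ⟨⟨hC₁A, by rw [supNorm_eq hC₁A, hC₁0]; exact hLC₀, by
        rw [supNorm_eq hC₁A, hC₁0]; exact hC₀U⟩, le_rfl⟩
    have := hbn.trans_le (iInf₂_le C₁ hmem)
    exact (EReal.coe_lt_coe_iff.1 this).le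
  obtain ⟨bad, hbad, hgood⟩ := hmain (m n) hmn n hn x M Z (hlo l₂ hcc₂) hS₀u (hlo l₃ hcc₃)
    (hup g₃ hKK₃) (hup g₅ hKK₅) hMu hMl hlap hZ
  have hnull := ae_iff.1 (hθhat n)
  refine le_trans (measure_mono (t := bad ∪ {ω | ¬ IsSieveMLE Uβ L U (m n) x (fun i => X (s n i))
    (fun i => Y (s n i) ω) (θhat n ω)}) ?_) ((measure_union_le _ _).trans ?_)
  swap
  · rw [hnull, add_zero]; exact hbad.trans hζζ
  intro ω hω
  by_contra hcon
  simp only [Set.mem_union, Set.mem_ofPred_eq, not_or, not_not] at hcon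
  obtain ⟨hωb, ⟨hβm, ⟨hCA, hCL, hCU⟩, hCs⟩, hmax⟩ := hcon
  set β := (θhat n ω).1 with hβ
  set C := (θhat n ω).2 with hC
  have hsup := supNorm_eq hCA
  have hmA := sieveApprox_mem_sieveA hf₀ (hm_pos n)
  have hmA' := sieveA_subset_classA _ hmA
  have hm0 := sieveApprox_zero hf₀ (m n)
  have hcmp := hmax (β₀, sieveApprox f₀ (m n)) ⟨hβ₀, ⟨hmA', by
    rw [supNorm_eq hmA', hm0]; exact hLC₀, by rw [supNorm_eq hmA', hm0]; exact hC₀U⟩, hmA⟩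
  have hlik := le_of_mul_le_mul_left hcmp (by positivity)
  simp only [logLik] at hlik
  rw [residual_eq _ _ β₀ β₀, residual_eq _ _ (θhat n ω).1 β₀, sub_self, WithLp.ofLp_zero,
    Matrix.mulVec_zero, add_zero] at hlik
  set δ : Fin p → ℝ := (β₀ - β).ofLp with hδ
  have hδn : ‖β₀ - β‖ ≤ 2 * Uβ := (norm_sub_le _ _).trans (by
    have : ‖β‖ ≤ Uβ := hβm
    linarith)
  have hδa : ∀ a, |δ a| ≤ 2 * Uβ := fun a => (PiLp.norm_apply_le (β₀ - β) a).trans hδn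
  have hδδ : δ ⬝ᵥ δ = ‖β₀ - β‖ ^ 2 := by
    rw [EuclideanSpace.norm_sq_eq]
    simp [dotProduct, hδ, sq]
  obtain ⟨r₁, r₂⟩ := hgood ω hωb C hCs (by rwa [← hsup]) (by rwa [← hsup]) δ hδa (by linarith)
  rw [hδδ] at r₂
  have r₃ : ‖β - β₀‖ < ε / 2 := by
    rw [norm_sub_rev]; exact lt_of_pow_lt_pow_left₀ 2 (by positivity) r₂
  have r₄ : supNorm (C - C₀) < ε / 2 := by
    by_contra hge
    have hmem : C ∈ {C : ℝ≥0 → ℝ | C ∈ covSpace L U ∧ ε / 2 ≤ supNorm (C - C₀)} :=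
      ⟨⟨hCA, hCL, hCU⟩, not_lt.1 hge⟩
    have h1 := EReal.coe_lt_coe_iff.1 (hqn.trans_le (iInf₂_le C hmem))
    rw [covDiscrepancy_eq, one_div, lt_inv_mul_iff₀ hn0] at h1
    linarith
  have r₅ : ε ≤ ‖β - β₀‖ + supNorm (C - C₀) := hω
  linarith
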